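/- **Minimality Result, Optimized.** *Source calculus.* Processes of the session $\pi$-calculus are $P,Q ::= \mathbf 0 \mid u!\langle z\rangle.P \mid u?(y).P \mid P\,|\,Q \mid (\nu s:C)P \mid X \mid \mu X.P$, where $u,z$ range over endpoints $a$, $\overline a$. Types are $C ::= \langle C\rangle \mid S$ and $S ::= \mathsf{end}\mid\ !\langle C\rangle;S \mid\ ?(C);S \mid \mu t.S \mid t$. A type is *well-formed* if it and hereditarily all its payloads are closed and are either $\langle C\rangle$, or a finite sequence of actions followed by $\mathsf{end}$, or *tail-recursive* ($\mathsf{tr}$): $\mu t.B$ with $B$ a nonempty finite sequence of actions followed by $t$, or $S\{\mu t.B/t\}$ with $S$ a suffix of such a $B$. A recursive type may be exchanged with its unfolding in linear environments. The judgment $\Gamma;\Delta\vdash P\triangleright\diamond$ ($\Gamma$ shared, $\Delta$ linear, with disjoint domains) is given by the usual rules: inaction with empty $\Delta$, weakening of $\Delta$ by $u:\mathsf{end}$, splitting of $\Delta$ in parallel composition, input and output on linear and on shared names, restriction of a session name $s:S$, $\overline s:\overline S$ or of a shared name, $\Gamma,X:\Delta;\Delta\vdash X$, and "$\Gamma,X:\Delta;\Delta\vdash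 P$ implies $\Gamma;\Delta\vdash\mu X.P$". In the rule for $\mu X.P$, $\mathrm{dom}(\Delta)\subseteq\mathrm{fn}(P)$; and a linear name whose session ends with an action (its remaining type is $\mathsf{end}$) is not free in the continuation of that action. Binders of names are pairwise distinct and distinct from the free names, no recursion occurs in the body of another one, and $P$ has no free recursion variables. *Minimal session types (MSTs)* are $M ::= \mathsf{end}\mid\ !\langle\widetilde M\rangle;\mathsf{end}\mid\ ?(\widetilde M);\mathsf{end}\mid\mu t.!\langle\widetilde M\rangle;t\mid\mu t.?(\widetilde M);t\mid\langle\widetilde M\rangle$; the polyadic calculus is typed with MSTs by the polyadic versions of the same rules, without the two side conditions above. The decomposition of types is $G(\langle C\rangle)=\langle G(C)\rangle$, $G(\mathsf{end})=\mathsf{end}$, $G(!\langle C\rangle;\mathsf{end})=\,!\langle G(C)\rangle;\mathsf{end}$, $G(!\langle C\rangle;S)=\,!\langle G(C)\rangle;\mathsf{end},\,G(S)$ for $S\ne\mathsf{end}$ not tail-recursive, $G(\mu t.S)=R(S)$, $G(!\langle C\rangle;S)=G(S)$ for $S$ tail-recursive, $R(!\langle C\rangle;S)=\mu t.!\langle G(C)\rangle;t,\,R(S)$,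 $R(t)=\epsilon$, and dually for inputs. For tail-recursive $T$, $f(T)$ is the position in $G(T)$ of the component of the next action of $T$: $f(\mu t.S)=1$, and otherwise $f(T)=|G(T)|-n+1$ with $n$ the number of actions in front of $\mu$. *Breakdown.* An indexed name $u_i:C$ has the breakdown $\widetilde u=(u_i,\dots,u_{i+|G(C)|-1})$. In the tables the process is indexed, $\sigma'$ is the index update after a prefix on $u_i$ ($u_i\mapsto u_{i+1}$ if $u$ is linear and not tail-recursive, otherwise nothing), $l=f(C)$ if $u_i:C$ is tail-recursive and $l=i$ otherwise, and $\widetilde w=u_i$ if $u$ is linear and not tail-recursive, $\widetilde w=\epsilon$ otherwise. $\mathrm{fnb}(Q,\widetilde x)$ is the part of $\widetilde x$ that consists of components of free names of $Q$. Bound names $y,s$ get index $1$. The degree $|P|^*$ is $1$ for $\mathbf 0$ and $X$, $|Q|^*+1$ for prefixes and $\mu X.Q$, $|Q|^*+|R|^*+1$ for $Q|R$, and for $(\nu s:C)Q$ it is $|Q|^*+1$ if $C$ is tail-recursive or the restriction occurs in the body of a recursion, and $|Q|^*$ otherwise. - $B_k^{\tilde x}(\mathbf 0)=c_k?(\widetilde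 x).\mathbf 0$. - $B_k^{\tilde x}(u_i!\langle z\rangle.Q)=c_k?(\widetilde x).u_l!\langle\widetilde z\rangle.\overline{c_{k+1}}!\langle\widetilde y\rangle.\mathbf 0\mid B_{k+1}^{\tilde y}(Q\sigma')$, $\widetilde y=\mathrm{fnb}(Q,\widetilde x\setminus\widetilde w)$. - $B_k^{\tilde x}(u_i?(y).Q)=c_k?(\widetilde x).u_l?(\widetilde y).\overline{c_{k+1}}!\langle\widetilde z\rangle.\mathbf 0\mid B_{k+1}^{\tilde z}(Q\sigma')$, $\widetilde z=\mathrm{fnb}(Q,\widetilde x\widetilde y\setminus\widetilde w)$. - $B_k^{\tilde x}(Q|R)=c_k?(\widetilde x).\overline{c_{k+1}}!\langle\widetilde y\rangle.\overline{c_{k+m+1}}!\langle\widetilde z\rangle.\mathbf 0\mid B_{k+1}^{\tilde y}(Q)\mid B_{k+m+1}^{\tilde z}(R)$, $m=|Q|^*$, $\widetilde y=\mathrm{fnb}(Q,\widetilde x)$, $\widetilde z=\mathrm{fnb}(R,\widetilde x)$. - $B_k^{\tilde x}((\nu s:C)Q)=(\nu\widetilde s:G(C))B_k^{\tilde x}(Q)$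 if $C$ is not tail-recursive, and $(\nu\widetilde s:G(C))(c_k?(\widetilde x).\overline{c_{k+1}}!\langle\widetilde x\widetilde s\widetilde{\overline s}\rangle.\mathbf 0\mid B_{k+1}^{\tilde x\tilde s\tilde{\overline s}}(Q))$ if it is. - $B_k^{\tilde x}(\mu X.Q)=(\nu c^r_X)(c_k?(\widetilde x).d!\langle\widetilde m\rangle.\mu X.c^r_X?(\widetilde m).d!\langle\widetilde m\rangle.X\mid B^{\mathrm{rec}}_{k+1,\tilde m}(Q))$, where $\widetilde m$ is the breakdown of $\mathrm{fn}(Q)$ and $d$ is the output endpoint of $c^r_{k+1}$. In the body of a recursion every trio is recursive and is connected through propagators $c^r_k$. They are linear on the parts of the body that contain $X$ if $X$ occurs exactly once in the body, and shared otherwise. With $\mathrm{fwd}_k(\widetilde y)=\overline{c^r_k}!\langle\widetilde y\rangle.X$, $\mathrm{trio}_k^{\tilde x}(T)=\mu X.c^r_k?(\widetilde x).T$ and $0_X=X$ in the linear mode, and $\mathrm{fwd}_k(\widetilde y)=c^r_k!\langle\widetilde y\rangle.\mathbf 0$, $\mathrm{trio}_k^{\tilde x}(T)=\mu X.c^r_k?(\widetilde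 x).(T\mid X)$ and $0_X=\mathbf 0$ in the shared mode: $B^{\mathrm{rec}}_{k,\tilde x}$ maps $\mathbf 0$ to $\mathrm{trio}_k^{\tilde x}(0_X)$; $X$ to $\mathrm{trio}_k^{\tilde x}(c^r_X!\langle\widetilde m\rangle.0_X)$; $u_i!\langle z\rangle.Q$ to $\mathrm{trio}_k^{\tilde x}(u_l!\langle\widetilde z\rangle.\mathrm{fwd}_{k+1}(\widetilde y))\mid B^{\mathrm{rec}}_{k+1,\tilde y}(Q\sigma')$; $u_i?(y).Q$ to $\mathrm{trio}_k^{\tilde x}(u_l?(\widetilde y).\mathrm{fwd}_{k+1}(\widetilde z))\mid B^{\mathrm{rec}}_{k+1,\tilde z}(Q\sigma')$; $Q|R$ to $\mathrm{trio}_k^{\tilde x}(\mathrm{fwd}_{k+1}(\widetilde y)\mid\mathrm{fwd}_{k+m+1}(\widetilde z))\mid B^{\mathrm{rec}}_{k+1,\tilde y}(Q)\mid B^{\mathrm{rec}}_{k+m+1,\tilde z}(R)$, $m=|Q|^*$, each side in its own mode; $(\nu s:C)Q$ to $\mu X.(\nu\widetilde s:G(C))c^r_k?(\widetilde x).T\mid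 B^{\mathrm{rec}}_{k+1,\tilde y}(Q)$, where $T$ is $\mathrm{fwd}_{k+1}(\widetilde y)$, in the shared mode in parallel with $X$, and $\widetilde y=\widetilde x\widetilde s\widetilde{\overline s}$ (without $\widetilde{\overline s}$ if $s$ is shared). The propagated names are as above, and in addition contain all of $\widetilde m$ whenever $X$ occurs in the remaining process. *Theorem.* Suppose that $\Gamma;\Delta\vdash P\triangleright\diamond$, with all types in $\Gamma,\Delta$ well-formed. Let $\sigma$ be the initializing substitution, which replaces every free name $u$ of $P$ by $u_1$, so that $P\sigma$ is initialized. Let $k>0$, and let $\widetilde v\subseteq\mathrm{fn}(P)$ be a list of distinct names that contains all the free names of $P$ whose type is tail-recursive; let $\widetilde r$ be the breakdown of $\widetilde v\sigma$, and let $\widetilde c$ consist of the propagators $c_j$ and $c^r_j$ for $k\le j\le k+|P|^*-1$. Then $$G(\Gamma\sigma);G(\Delta\sigma)\vdash(\nu\widetilde c)\big(\overline{c_k}!\langle\widetilde r\rangle.\mathbf 0\mid B_k^{\tilde r}(P\sigma)\big)\triangleright\diamond$$ in the type system with MSTs, where $G(\Gamma\sigma)$ assigns $G(\langle C\rangle)$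 to $u_1$ for $u:\langle C\rangle$ in $\Gamma$, and $G(\Delta\sigma)$ assigns the components of $G(S)$ to $u_1,\dots,u_{|G(S)|}$ for $u:S$ in $\Delta$. That is, the optimized decomposition of $P$ is typable with minimal session types. -/

import Mathlib

namespace MST

/-! ## Names and polarities -/

/-- Direction of a session prefix: output or input. -/
inductive Dir
  | out
  | inp
  deriving DecidableEq

/-- The opposite direction. -/
def Dir.flip : Dir → Dir
  | .out => .inp
  | .inp => .out

/-- A source name is an endpoint `(a, b)`: `(a, false)` stands for the name `a` and `(a, true)`
for its dual endpoint. Shared names are used through one endpoint only. -/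
abbrev Name := ℕ × Bool

/-- Typing environments: partial maps. -/
abbrev Env (N T : Type) := N → Option T

/-- The empty environment. -/
def Env.empty {N T : Type} : Env N T := fun _ => none

/-- The environment with the single assignment `u : t`. -/
def Env.single {N T : Type} [DecidableEq N] (u : N) (t : T) : Env N T :=
  Function.update Env.empty u (some t)

/-- `E` with the assignment of `u` set to `t`. -/
def Env.set {N T : Type} [DecidableEq N] (E : Env N T) (u : N) (t : T) : Env N T :=
  Function.update E u (some t)

/-- `E` without an assignment for `u`. -/
def Env.erase {N T : Type} [DecidableEq N] (E : Env N T) (u : N) : Env N T :=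
  Function.update E u none

/-- `Δ` is the disjoint union `Δ₁, Δ₂` of linear environments. -/
def Env.Split {N T : Type} (Δ Δ₁ Δ₂ : Env N T) : Prop :=
  ∀ u, (Δ₁ u = Δ u ∧ Δ₂ u = none) ∨ (Δ₁ u = none ∧ Δ₂ u = Δ u)

/-! ## Session types of the source calculus -/

/-- Value types `C` and session types `S`:
`sh C` is the shared channel type `⟨C⟩`, `fin` is `end`, `act out C S` is `!⟨C⟩;S`,
`act inp C S` is `?(C);S`, `mu S` is `μt.S` and `var` is the recursion variable `t`
(one variable suffices, see `STy.WF`). -/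
inductive STy
  | sh (C : STy)
  | fin
  | act (d : Dir) (C S : STy)
  | mu (S : STy)
  | var
  deriving DecidableEq

namespace STy

/-- Substitution of `T` for the recursion variable in tail position. Payload types are closed. -/
def subst (T : STy) : STy → STy
  | sh C => sh C
  | fin => fin
  | act d C S => act d C (subst T S)
  | mu S => mu S
  | var => T

/-- The first action of a session type, with recursion unfolded: direction, payload,
continuation. -/
def act? : STy → Option (Dir × STy × STy)
  | act d C S => some (d, C, S)
  | mu (act d C S) => some (d, C, subst (mu (act d C S)) S)
  | _ => none

/-- Session type duality (payloads are unchanged). -/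
def dual : STy → STy
  | sh C => sh C
  | fin => fin
  | act d C S => act d.flip C (dual S)
  | mu S => mu (dual S)
  | var => var

/-- Session types, as opposed to shared channel types. -/
def isSession : STy → Bool
  | sh _ => false
  | _ => true

/-- `tr S`: the type is tail-recursive, that is, a recursive type or an unfolding of one. -/
def tr : STy → Bool
  | act _ _ S => tr S
  | mu _ => true
  | _ => false

/-- A finite session type: actions followed by `end`. -/
def finite : STy → Bool
  | fin => true
  | act _ _ S => finite S
  | _ => false

/-- The body of a recursive type: actions followed by the recursion variable. -/
def body : STy → Bool
  | var => true
  | act _ _ S => body S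
  | _ => false

/-- The suffixes of a sequence of actions. -/
def suffixes : STy → List STy
  | act d C S => act d C S :: suffixes S
  | S => [S]

/-- The spine of a type is a shared type, a finite session type, or a tail-recursive session
type `μt.B` at some stage `S[μt.B/t]` of its execution, `S` a suffix of the (contractive)
body `B`. -/
def Shape (C : STy) : Prop :=
  (∃ D, C = sh D) ∨ C.finite = true ∨
    ∃ B S, body B = true ∧ B ≠ var ∧ S ∈ suffixes B ∧ C = subst (mu B) S

/-- All the payload types in a type have the required shape, hereditarily. -/
def AllPay : STy → Prop
  | sh C => Shape C ∧ AllPay C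
  | fin => True
  | act _ C S => Shape C ∧ AllPay C ∧ AllPay S
  | mu S => AllPay S
  | var => True

/-- Well-formed closed types of the source calculus. -/
def WF (C : STy) : Prop := Shape C ∧ AllPay C

/-- `Unf T T'`: one of `T`, `T'` is a recursive type and the other one its unfolding. -/
def Unf (T T' : STy) : Prop :=
  ∃ B, body B = true ∧ B ≠ var ∧
    ((T = mu B ∧ T' = subst (mu B) B) ∨ (T = subst (mu B) B ∧ T' = mu B))

end STy

/-! ## Minimal session types -/

/-- Minimal session types. `fin` is `end`; `once out ps` and `once inp ps` are `!⟨ps⟩;end` and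
`?(ps);end`; `loop out ps` and `loop inp ps` are `μt.!⟨ps⟩;t` and `μt.?(ps);t`; `sh ps` is the
shared type `⟨ps⟩`. There is no sequential composition of actions in a type, and `ps` is a
tuple of types of the same kind. -/
inductive MTy
  | fin
  | once (d : Dir) (ps : List MTy)
  | loop (d : Dir) (ps : List MTy)
  | sh (ps : List MTy)

namespace MTy

/-- The first action of a minimal session type, with recursion unfolded. -/
def act? : MTy → Option (Dir × List MTy × MTy)
  | once d ps => some (d, ps, fin)
  | loop d ps => some (d, ps, loop d ps)
  | _ => none

/-- Duality. -/
def dual : MTy → MTy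
  | fin => fin
  | once d ps => once d.flip ps
  | loop d ps => loop d.flip ps
  | sh ps => sh ps

/-- Session types, as opposed to shared channel types. -/
def isSession : MTy → Bool
  | sh _ => false
  | _ => true

end MTy

namespace STy

mutual

/-- The decomposition `G` of a type into a list of minimal session types:
`G(⟨C⟩) = ⟨G(C)⟩`, `G(end) = end`, `G(!⟨C⟩;end) = !⟨G(C)⟩;end`,
`G(!⟨C⟩;S) = !⟨G(C)⟩;end, G(S)`, and dually for inputs; `G(μt.S) = R(S)`; on a tail-recursive
type with actions in front of `μ`, these actions are skipped, so that an unfolded type is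
decomposed as its recursive type. -/
def G : STy → List MTy
  | sh C => [.sh (G C)]
  | fin => [.fin]
  | act d C S =>
      if S.tr then G S
      else if S = fin then [.once d (G C)]
      else .once d (G C) :: G S
  | mu S => R S
  | var => []

/-- The decomposition `R` of the body of a recursive type: `R(t)` is empty,
`R(!⟨C⟩;S) = μt.!⟨G(C)⟩;t, R(S)`, and dually for inputs. -/
def R : STy → List MTy
  | act d C S => .loop d (G C) :: R S
  | sh _ => []
  | fin => []
  | mu _ => []
  | var => []

end

/-- The number of actions before the end, the recursion or the recursion variable. -/
def prefixLen : STy → ℕ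
  | act _ _ S => prefixLen S + 1
  | _ => 0

/-- The index function `f` on tail-recursive types: the position, in `G T`, of the component
which carries the next action of `T`. -/
def f : STy → ℕ
  | mu _ => 1
  | T => (G T).length - prefixLen T + 1

end STy

/-! ## The source calculus -/

/-- Source processes. `out u z P` is `u!⟨z⟩.P`; `inp u y P` is `u?(y).P` and binds the name
`(y, false)`; `res s C P` is `(ν s : C) P` and binds both endpoints of `s`; `mu X P` is
`μX.P`. -/
inductive SProc
  | nil
  | out (u z : Name) (P : SProc)
  | inp (u : Name) (y : ℕ) (P : SProc)
  | par (P Q : SProc)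
  | res (s : ℕ) (C : STy) (P : SProc)
  | pvar (X : ℕ)
  | mu (X : ℕ) (P : SProc)

namespace SProc

/-- Free names (with repetitions). -/
def fn : SProc → List Name
  | nil => []
  | out u z P => u :: z :: fn P
  | inp u y P => u :: (fn P).filter (fun v => v ≠ (y, false))
  | par P Q => fn P ++ fn Q
  | res s _ P => (fn P).filter (fun v => v.1 ≠ s)
  | pvar _ => []
  | mu _ P => fn P

/-- The binders of names of a process. -/
def bound : SProc → List ℕ
  | nil => []
  | out _ _ P => bound P
  | inp _ y P => y :: bound P
  | par P Q => bound P ++ bound Q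
  | res s _ P => s :: bound P
  | pvar _ => []
  | mu _ P => bound P

/-- The number of free occurrences of the recursion variable `X`. -/
def occ (X : ℕ) : SProc → ℕ
  | nil => 0
  | out _ _ P => occ X P
  | inp _ _ P => occ X P
  | par P Q => occ X P + occ X Q
  | res _ _ P => occ X P
  | pvar Y => if X = Y then 1 else 0
  | mu Y P => if X = Y then 0 else occ X P

/-- No recursion at all. -/
def NoMu : SProc → Prop
  | nil => True
  | out _ _ P => NoMu P
  | inp _ _ P => NoMu P
  | par P Q => NoMu P ∧ NoMu Q
  | res _ _ P => NoMu P
  | pvar _ => True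
  | mu _ _ => False

/-- No recursion inside the body of another recursion. -/
def NoNested : SProc → Prop
  | nil => True
  | out _ _ P => NoNested P
  | inp _ _ P => NoNested P
  | par P Q => NoNested P ∧ NoNested Q
  | res _ _ P => NoNested P
  | pvar _ => True
  | mu _ P => NoMu P

/-- The variable convention: the binders of names are pairwise distinct, and distinct from
the free names. -/
def Barendregt (P : SProc) : Prop :=
  P.bound.Nodup ∧ ∀ u ∈ P.fn, u.1 ∉ P.bound

end SProc

/-- Shared environments: `Γ u = some C` means `u : ⟨C⟩`. -/
abbrev ShEnv := Env Name STy

/-- Linear environments: `Δ u = some S` means `u : S`. -/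
abbrev LinEnv := Env Name STy

/-- Assignments of linear environments to recursion variables. -/
abbrev RecEnv := Env ℕ LinEnv

/-- The shared environment after the binding `y : C`. -/
def shBind (Γ : ShEnv) (y : Name) : STy → ShEnv
  | .sh C => Γ.set y C
  | _ => Γ.erase y

/-- The linear environment after the binding `y : C`. -/
def linBind (Δ : LinEnv) (y : Name) : STy → LinEnv
  | .sh _ => Δ.erase y
  | C => Δ.set y C

/-- Typing of names as values, `Γ; Δ ⊢ z ▷ C`. -/
inductive SVal : ShEnv → LinEnv → Name → STy → Prop
  | shared {Γ : ShEnv} {z : Name} {C : STy} : Γ z = some C → SVal Γ Env.empty z (.sh C)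
  | session {Γ : ShEnv} {z : Name} {S : STy} : S.isSession = true → SVal Γ (Env.single z S) z S

/-- Typing of source processes, `Γ, Ξ; Δ ⊢ P ▷ ⋄`, where `Ξ` is the part of the shared
environment on recursion variables. -/
inductive STyped : ShEnv → RecEnv → LinEnv → SProc → Prop
  | nil {Γ : ShEnv} {Ξ : RecEnv} : STyped Γ Ξ Env.empty .nil
  | wk {Γ : ShEnv} {Ξ : RecEnv} {Δ : LinEnv} {P : SProc} (u : Name) :
      STyped Γ Ξ Δ P → Γ u = none → Δ u = none →
      STyped Γ Ξ (Δ.set u .fin) P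
  | unf {Γ : ShEnv} {Ξ : RecEnv} {Δ : LinEnv} {P : SProc} (u : Name) (T T' : STy) :
      STy.Unf T T' → Δ u = some T →
      STyped Γ Ξ Δ P → STyped Γ Ξ (Δ.set u T') P
  | pvar {Γ : ShEnv} {Ξ : RecEnv} {Δ : LinEnv} {X : ℕ} : Ξ X = some Δ → STyped Γ Ξ Δ (.pvar X)
  | mu {Γ : ShEnv} {Ξ : RecEnv} {Δ : LinEnv} {X : ℕ} {P : SProc} :
      STyped Γ (Ξ.set X Δ) Δ P → (∀ u, Δ u ≠ none → u ∈ P.fn) →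
      STyped Γ Ξ Δ (.mu X P)
  | par {Γ : ShEnv} {Ξ : RecEnv} {Δ Δ₁ Δ₂ : LinEnv} {P Q : SProc} :
      Δ.Split Δ₁ Δ₂ → STyped Γ Ξ Δ₁ P → STyped Γ Ξ Δ₂ Q →
      STyped Γ Ξ Δ (.par P Q)
  | send {Γ : ShEnv} {Ξ : RecEnv} {Δ Δ₁ Δ₂ : LinEnv} {u z : Name} {P : SProc} {T C S : STy} :
      STyped Γ Ξ Δ₁ P → Δ₁ u = some S → SVal Γ Δ₂ z C →
      Δ.Split Δ₁ Δ₂ → T.act? = some (.out, C, S) → (S = .fin → u ∉ P.fn) →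
      STyped Γ Ξ (Δ.set u T) (.out u z P)
  | rcv {Γ : ShEnv} {Ξ : RecEnv} {Δ : LinEnv} {u : Name} {y : ℕ} {P : SProc} {T C S : STy} :
      Δ u = some T → T.act? = some (.inp, C, S) →
      Δ (y, false) = none →
      STyped (shBind Γ (y, false) C) Ξ (linBind (Δ.set u S) (y, false) C) P →
      (S = .fin → u ∉ P.fn) → STyped Γ Ξ Δ (.inp u y P)
  | req {Γ : ShEnv} {Ξ : RecEnv} {Δ Δ₁ Δ₂ : LinEnv} {u z : Name} {P : SProc} {C : STy} :
      Γ u = some C → STyped Γ Ξ Δ₁ P → SVal Γ Δ₂ z C →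
      Δ.Split Δ₁ Δ₂ → STyped Γ Ξ Δ (.out u z P)
  | acc {Γ : ShEnv} {Ξ : RecEnv} {Δ : LinEnv} {u : Name} {y : ℕ} {P : SProc} {C : STy} :
      Γ u = some C → Δ (y, false) = none →
      STyped (shBind Γ (y, false) C) Ξ (linBind Δ (y, false) C) P →
      STyped Γ Ξ Δ (.inp u y P)
  | resS {Γ : ShEnv} {Ξ : RecEnv} {Δ : LinEnv} {s : ℕ} {P : SProc} {S : STy} :
      S.WF → S.isSession = true →
      Δ (s, false) = none → Δ (s, true) = none →
      STyped ((Γ.erase (s, false)).erase (s, true)) Ξ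
        ((Δ.set (s, false) S).set (s, true) S.dual) P →
      STyped Γ Ξ Δ (.res s S P)
  | res {Γ : ShEnv} {Ξ : RecEnv} {Δ : LinEnv} {s : ℕ} {P : SProc} {C : STy} :
      (STy.sh C).WF → Δ (s, false) = none → Δ (s, true) = none →
      STyped ((Γ.set (s, false) C).erase (s, true)) Ξ Δ P →
      STyped Γ Ξ Δ (.res s (.sh C) P)

/-! ## The target calculus: polyadic, with minimal session types -/

/-- Channels of decomposed processes: the component `a_i` of the source name `a`, the
propagators `c_k` and `c^r_k`, and the propagator `c^r_X` of a recursion variable. -/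
inductive TChan
  | idx (a i : ℕ)
  | prop (k : ℕ)
  | rprop (k : ℕ)
  | rvar (X : ℕ)
  deriving DecidableEq

/-- Names of decomposed processes: `(c, true)` is the dual endpoint of `(c, false)`. -/
abbrev TName := TChan × Bool

/-- Decomposed processes: polyadic communication; restrictions `res c (some M) P` carry a type
annotation and `res c none P` carry none. -/
inductive TProc
  | nil
  | out (u : TName) (zs : List TName) (P : TProc)
  | inp (u : TName) (ys : List TName) (P : TProc)
  | par (P Q : TProc)
  | res (c : TChan) (ann : Option MTy) (P : TProc)
  | pvar (X : ℕ)
  | mu (X : ℕ) (P : TProc)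

namespace TProc

/-- Free names. -/
def fn : TProc → List TName
  | nil => []
  | out u zs P => u :: zs ++ fn P
  | inp u ys P => u :: (fn P).filter (fun v => v ∉ ys)
  | par P Q => fn P ++ fn Q
  | res c _ P => (fn P).filter (fun v => v.1 ≠ c)
  | pvar _ => []
  | mu _ P => fn P

/-- Bound names. -/
def bn : TProc → List TName
  | nil => []
  | out _ _ P => bn P
  | inp _ ys P => ys ++ bn P
  | par P Q => bn P ++ bn Q
  | res c _ P => (c, false) :: (c, true) :: bn P
  | pvar _ => []
  | mu _ P => bn P

end TProc

/-- Shared environments: `Γ u = some ps` means `u : ⟨ps⟩`. -/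
abbrev TShEnv := Env TName (List MTy)

/-- Linear environments. -/
abbrev TLinEnv := Env TName MTy

/-- Assignments of linear environments to recursion variables. -/
abbrev TRecEnv := Env ℕ TLinEnv

/-- The shared environment after the bindings `ys : Ms`. -/
def tshBind (Γ : TShEnv) : List TName → List MTy → TShEnv
  | y :: ys, .sh ps :: Ms => (tshBind Γ ys Ms).set y ps
  | y :: ys, _ :: Ms => (tshBind Γ ys Ms).erase y
  | _, _ => Γ

/-- The linear environment after the bindings `ys : Ms`. -/
def tlinBind (Δ : TLinEnv) : List TName → List MTy → TLinEnv
  | y :: ys, .sh _ :: Ms => (tlinBind Δ ys Ms).erase y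
  | y :: ys, M :: Ms => (tlinBind Δ ys Ms).set y M
  | _, _ => Δ

/-- Typing of tuples of names as values, `Γ; Δ ⊢ zs ▷ Ms`. -/
inductive TVals : TShEnv → TLinEnv → List TName → List MTy → Prop
  | nil {Γ : TShEnv} : TVals Γ Env.empty [] []
  | shared {Γ : TShEnv} {Δ : TLinEnv} {z : TName} {zs : List TName} {ps Ms : List MTy} :
      Γ z = some ps → TVals Γ Δ zs Ms →
      TVals Γ Δ (z :: zs) (.sh ps :: Ms)
  | session {Γ : TShEnv} {Δ : TLinEnv} {z : TName} {zs : List TName} {M : MTy} {Ms : List MTy} :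
      M.isSession = true → Δ z = none → TVals Γ Δ zs Ms →
      TVals Γ (Δ.set z M) (z :: zs) (M :: Ms)

/-- Typing of processes with minimal session types, `Γ, Ξ; Δ ⊢ P ▷ ⋄`. The rules are those of
the source calculus, in polyadic form. As processes have concrete binders here, the rule for
recursion makes explicit that the bound names of the body do not capture the names which an
unfolding of the recursion would insert. -/
inductive TTyped : TShEnv → TRecEnv → TLinEnv → TProc → Prop
  | nil {Γ : TShEnv} {Ξ : TRecEnv} : TTyped Γ Ξ Env.empty .nil
  | wk {Γ : TShEnv} {Ξ : TRecEnv} {Δ : TLinEnv} {P : TProc} (u : TName) :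
      TTyped Γ Ξ Δ P → Γ u = none → Δ u = none →
      TTyped Γ Ξ (Δ.set u .fin) P
  | pvar {Γ : TShEnv} {Ξ : TRecEnv} {Δ : TLinEnv} {X : ℕ} : Ξ X = some Δ → TTyped Γ Ξ Δ (.pvar X)
  | mu {Γ : TShEnv} {Ξ : TRecEnv} {Δ : TLinEnv} {X : ℕ} {P : TProc} :
      TTyped Γ (Ξ.set X Δ) Δ P → (∀ y ∈ P.bn, y ∉ P.fn ∧ Δ y = none) →
      TTyped Γ Ξ Δ (.mu X P)
  | par {Γ : TShEnv} {Ξ : TRecEnv} {Δ Δ₁ Δ₂ : TLinEnv} {P Q : TProc} :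
      Δ.Split Δ₁ Δ₂ → TTyped Γ Ξ Δ₁ P → TTyped Γ Ξ Δ₂ Q →
      TTyped Γ Ξ Δ (.par P Q)
  | send {Γ : TShEnv} {Ξ : TRecEnv} {Δ Δ₁ Δ₂ : TLinEnv} {u : TName} {zs : List TName}
      {P : TProc} {T S : MTy} {Ms : List MTy} :
      TTyped Γ Ξ Δ₁ P → Δ₁ u = some S →
      TVals Γ Δ₂ zs Ms → Δ.Split Δ₁ Δ₂ → T.act? = some (.out, Ms, S) →
      TTyped Γ Ξ (Δ.set u T) (.out u zs P)
  | rcv {Γ : TShEnv} {Ξ : TRecEnv} {Δ : TLinEnv} {u : TName} {ys : List TName} {P : TProc}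
      {T S : MTy} {Ms : List MTy} :
      Δ u = some T → T.act? = some (.inp, Ms, S) →
      ys.length = Ms.length → ys.Nodup → (∀ y ∈ ys, Δ y = none) →
      TTyped (tshBind Γ ys Ms) Ξ (tlinBind (Δ.set u S) ys Ms) P →
      TTyped Γ Ξ Δ (.inp u ys P)
  | req {Γ : TShEnv} {Ξ : TRecEnv} {Δ Δ₁ Δ₂ : TLinEnv} {u : TName} {zs : List TName}
      {P : TProc} {Ms : List MTy} :
      Γ u = some Ms → TTyped Γ Ξ Δ₁ P → TVals Γ Δ₂ zs Ms →
      Δ.Split Δ₁ Δ₂ → TTyped Γ Ξ Δ (.out u zs P)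
  | acc {Γ : TShEnv} {Ξ : TRecEnv} {Δ : TLinEnv} {u : TName} {ys : List TName} {P : TProc}
      {Ms : List MTy} :
      Γ u = some Ms → ys.length = Ms.length → ys.Nodup →
      (∀ y ∈ ys, Δ y = none) → TTyped (tshBind Γ ys Ms) Ξ (tlinBind Δ ys Ms) P →
      TTyped Γ Ξ Δ (.inp u ys P)
  | resS {Γ : TShEnv} {Ξ : TRecEnv} {Δ : TLinEnv} {c : TChan} {ann : Option MTy} {P : TProc}
      {M : MTy} :
      M.isSession = true → (ann = none ∨ ann = some M) →
      Δ (c, false) = none → Δ (c, true) = none →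
      TTyped ((Γ.erase (c, false)).erase (c, true)) Ξ
        ((Δ.set (c, false) M).set (c, true) M.dual) P →
      TTyped Γ Ξ Δ (.res c ann P)
  | res {Γ : TShEnv} {Ξ : TRecEnv} {Δ : TLinEnv} {c : TChan} {ann : Option MTy} {P : TProc}
      {ps : List MTy} :
      (ann = none ∨ ann = some (.sh ps)) →
      Δ (c, false) = none → Δ (c, true) = none →
      TTyped ((Γ.set (c, false) ps).erase (c, true)) Ξ Δ P →
      TTyped Γ Ξ Δ (.res c ann P)

/-! ## The optimized breakdown -/

/-- An indexed typing context `E`: `E u = (i, C)` means that the name `u` of type `C` stands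
for the indexed name `u_i` in the process under consideration. -/
abbrev Ctx := Name → ℕ × STy

/-- The indexed name `u_i`. -/
def nm (u : Name) (i : ℕ) : TName := (.idx u.1 i, u.2)

/-- The source name of which a name is a component. -/
def base : TName → Option Name
  | (.idx a _, b) => some (a, b)
  | _ => none

namespace Ctx

/-- The breakdown `u_i, …, u_{i+|G(C)|-1}` of the name `u_i` of type `C`. -/
def names (E : Ctx) (u : Name) : List TName :=
  (List.range (STy.G (E u).2).length).map (fun j => nm u ((E u).1 + j))

/-- The indexed name which performs the next action of `u`: `u_{f(S)}` if the type `S` of `u`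
is tail-recursive, and `u_i` otherwise. -/
def subj (E : Ctx) (u : Name) : TName :=
  nm u (if (E u).2.tr then (E u).2.f else (E u).1)

/-- The names used up by the next action of `u`: only `u_i`, and only if it is linear and not
tail-recursive. -/
def used (E : Ctx) (u : Name) : List TName :=
  if (E u).2.isSession && !(E u).2.tr then [nm u (E u).1] else []

/-- The context after an action of `u`. -/
def next (E : Ctx) (u : Name) : Ctx :=
  match (E u).2.act? with
  | some (_, _, S) => Function.update E u (if (E u).2.tr then (E u).1 else (E u).1 + 1, S)
  | none => E

/-- The type of the objects which are sent or received along `u`. -/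
def payload (E : Ctx) (u : Name) : STy :=
  match (E u).2 with
  | .sh C => C
  | T => match T.act? with
    | some (_, C, _) => C
    | none => .fin

/-- The context with `y_1 : C` in addition. -/
def bind (E : Ctx) (y : Name) (C : STy) : Ctx := Function.update E y (1, C)

/-- The context with `s_1 : C` in addition, and the dual endpoint of `s_1` of dual type. -/
def bindRes (E : Ctx) (s : ℕ) (C : STy) : Ctx :=
  (E.bind (s, false) C).bind (s, true) C.dual

end Ctx

/-- The names of `xs` that are components of names that are free in `Q`. -/
def fnb (Q : SProc) (xs : List TName) : List TName :=
  xs.filter (fun x => (base x).any (fun u => u ∈ Q.fn))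

/-- The names of `xs` without those of `ws`. -/
def minus (xs ws : List TName) : List TName := xs.filter (fun x => x ∉ ws)

/-- Restriction of the components of `s`, of the types in `G C`. -/
def nus (s : ℕ) (C : STy) (P : TProc) : TProc :=
  ((STy.G C).zipIdx 1).foldr (fun p Q => .res (.idx s p.2) (some p.1) Q) P

/-- The degree: the number of propagators used in a breakdown. The flag says whether the process
occurs in the body of a recursion. -/
def deg : Bool → SProc → ℕ
  | _, .nil => 1
  | r, .out _ _ P => deg r P + 1
  | r, .inp _ _ P => deg r P + 1
  | r, .par P Q => deg r P + deg r Q + 1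
  | r, .res _ C P => if r || C.tr then deg r P + 1 else deg r P
  | _, .pvar _ => 1
  | _, .mu _ P => deg true P + 1

/-- Output on a propagator: `cOut k` is the output endpoint of `c_k`, `cIn k` the input
endpoint. -/
def cOut (k : ℕ) : TName := (.prop k, true)

/-- The input endpoint of `c_k`. -/
def cIn (k : ℕ) : TName := (.prop k, false)

/-- The output endpoint of `c^r_k`: the dual endpoint if the propagator is linear, the shared
name `c^r_k` otherwise. -/
def rOut (lin : Bool) (k : ℕ) : TName := (.rprop k, lin)

/-- The input endpoint of `c^r_k`. -/
def rIn (k : ℕ) : TName := (.rprop k, false)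

/-- The shared propagator `c^r_X`. -/
def rX (X : ℕ) : TName := (.rvar X, false)

/-- The end of a trio in the breakdown of the body of the recursion on `X`: the trio forwards
`ys` to the next one, on a linear propagator before it starts again, and on a shared propagator
otherwise. -/
def fwd (X : ℕ) (lin : Bool) (k : ℕ) (ys : List TName) : TProc :=
  .out (rOut lin k) ys (if lin then .pvar X else .nil)

/-- A recursive trio. If its propagator is shared, it makes a replica of itself when it is
triggered. -/
def trio (X : ℕ) (lin : Bool) (k : ℕ) (xs : List TName) (P : TProc) : TProc :=
  .mu X (.inp (rIn k) xs (if lin then P else .par P (.pvar X)))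

/-- The names of `xs` to be propagated to the body part `Q` of a recursion on `X` with
parameters `ms`: those that are free in `Q`, and all the parameters if the recursion variable
occurs in `Q`. -/
def keep (X : ℕ) (ms : List TName) (Q : SProc) (xs : List TName) : List TName :=
  if Q.occ X = 0 then fnb Q xs else ms ++ minus (fnb Q xs) ms

/-- The breakdown of the body of the recursion on `X` with parameters `ms`. The flag `lin`
says that the propagators are linear, which is the case for the part of the body with the
recursion variable if that variable occurs exactly once. -/
def Brec (X : ℕ) (ms : List TName) : Ctx → Bool → ℕ → List TName → SProc → TProc
  | _, lin, k, xs, .nil => trio X lin k xs (if lin then .pvar X else .nil)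
  | E, lin, k, xs, .out u z Q =>
      let ys := keep X ms Q (minus xs (E.used u))
      .par (trio X lin k xs (.out (E.subj u) (E.names z) (fwd X lin (k + 1) ys)))
        (Brec X ms (E.next u) lin (k + 1) ys Q)
  | E, lin, k, xs, .inp u y Q =>
      let E' := (E.next u).bind (y, false) (E.payload u)
      let ws := E'.names (y, false)
      let ys := keep X ms Q (minus (xs ++ ws) (E.used u))
      .par (trio X lin k xs (.inp (E.subj u) ws (fwd X lin (k + 1) ys)))
        (Brec X ms E' lin (k + 1) ys Q)
  | E, lin, k, xs, .par Q R =>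
      let l := deg true Q
      let lQ := lin && decide (Q.occ X ≠ 0)
      let lR := lin && decide (R.occ X ≠ 0)
      let ys := keep X ms Q xs
      let zs := keep X ms R xs
      .par
        (trio X lin k xs (.par (fwd X lQ (k + 1) ys) (fwd X lR (k + l + 1) zs)))
        (.par (Brec X ms E lQ (k + 1) ys Q) (Brec X ms E lR (k + l + 1) zs R))
  | E, lin, k, xs, .res s C Q =>
      let E' := E.bindRes s C
      let ss := if C.isSession then E'.names (s, false) ++ E'.names (s, true)
        else E'.names (s, false)
      let ys := xs ++ ss
      .par
        (.mu X (nus s C (.inp (rIn k) xs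
          (if lin then fwd X lin (k + 1) ys
            else .par (fwd X lin (k + 1) ys) (.pvar X)))))
        (Brec X ms E' lin (k + 1) ys Q)
  | _, lin, k, xs, .pvar _ =>
      trio X lin k xs (.out (rX X) ms (if lin then .pvar X else .nil))
  | _, _, _, _, .mu _ _ => .nil

/-- The breakdown of a process. -/
def B : Ctx → ℕ → List TName → SProc → TProc
  | _, k, xs, .nil => .inp (cIn k) xs .nil
  | E, k, xs, .out u z Q =>
      let ys := fnb Q (minus xs (E.used u))
      .par (.inp (cIn k) xs (.out (E.subj u) (E.names z) (.out (cOut (k + 1)) ys .nil)))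
        (B (E.next u) (k + 1) ys Q)
  | E, k, xs, .inp u y Q =>
      let E' := (E.next u).bind (y, false) (E.payload u)
      let ws := E'.names (y, false)
      let ys := fnb Q (minus (xs ++ ws) (E.used u))
      .par (.inp (cIn k) xs (.inp (E.subj u) ws (.out (cOut (k + 1)) ys .nil)))
        (B E' (k + 1) ys Q)
  | E, k, xs, .par Q R =>
      let l := deg false Q
      let ys := fnb Q xs
      let zs := fnb R xs
      .par (.inp (cIn k) xs (.out (cOut (k + 1)) ys (.out (cOut (k + l + 1)) zs .nil)))
        (.par (B E (k + 1) ys Q) (B E (k + l + 1) zs R))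
  | E, k, xs, .res s C Q =>
      let E' := E.bindRes s C
      if C.tr then
        let ys := xs ++ (E'.names (s, false) ++ E'.names (s, true))
        nus s C (.par (.inp (cIn k) xs (.out (cOut (k + 1)) ys .nil)) (B E' (k + 1) ys Q))
      else nus s C (B E' k xs Q)
  | _, _, _, .pvar _ => .nil
  | E, k, xs, .mu X Q =>
      let ms := Q.fn.dedup.flatMap E.names
      let lin := decide (Q.occ X = 1)
      .res (.rvar X) none
        (.par
          (.inp (cIn k) xs (.out (rOut lin (k + 1)) ms
            (.mu X (.inp (rX X) ms (.out (rOut lin (k + 1)) ms (.pvar X))))))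
          (Brec X ms E lin (k + 1) ms Q))

/-- Restriction of the propagators `c_j` and `c^r_j`, for `j` in the list. -/
def nuProps (js : List ℕ) (P : TProc) : TProc :=
  js.foldr (fun j Q => .res (.prop j) none (.res (.rprop j) none Q)) P

/-- The indexed context of the initialized process: every name `u` is replaced by `u_1`. -/
def initCtx (Γ : ShEnv) (Δ : LinEnv) : Ctx := fun u =>
  match Γ u with
  | some C => (1, .sh C)
  | none => (1, (Δ u).getD .fin)

/-- The optimized decomposition `(ν c)(c_k!⟨r⟩.0 | B_k^r(Pσ))`, with `r` the breakdown of the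
names in `vs`. -/
def decomp (Γ : ShEnv) (Δ : LinEnv) (k : ℕ) (vs : List Name) (P : SProc) : TProc :=
  let E := initCtx Γ Δ
  let rs := vs.flatMap E.names
  nuProps (List.range' k (deg false P)) (.par (.out (cOut k) rs .nil) (B E k rs P))

/-- The decomposed shared environment `G(Γσ)`. -/
def GSh (Γ : ShEnv) : TShEnv
  | (.idx a i, b) => if i = 1 then (Γ (a, b)).map STy.G else none
  | _ => none

/-- The decomposed linear environment `G(Δσ)`: a name `u : S` yields
`u_1, …, u_{|G(S)|} : G(S)`. -/
def GLin (Δ : LinEnv) : TLinEnv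
  | (.idx a i, b) => if i = 0 then none else (Δ (a, b)).bind (fun S => (STy.G S)[i - 1]?)
  | _ => none

end MST

/-!
The typing derivation of the decomposition is built over one fixed assignment of types to target
names. A context `E` records for each source name its current index and its current type; it
determines the type of every component, through `G`, and each propagator is given a kind `π`: it
carries its objects once, or repeatedly as a linear name, or as a shared name. All names then have a
type `ty E π`, and a linear environment is the restriction `lenv` of this assignment to a set of
names. An application of a typing rule amounts to a statement about sets of names, and weakening
concerns the names of type `end` in a set (`TTyped.send_use`, `TTyped.recv_use`, `TTyped.weaken`).
An action of a source name changes `E`, but not the types of the components that are left: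
`G` of a finite type loses its first entry while the index increases, and `G` of a tail-recursive
type does not change (`Acts.cty_next`). Hence the assignment serves for all trios between two
binders.

Of the typing of the source process, only its discipline of linearity is used. It is expressed by
induction on the process, without the rules of weakening and unfolding, as `Good`
(`STyped.good`): a linear name is free in the continuation as long as its session is not over, not
afterwards; an object of an output and the parts of a parallel composition do not share linear
names; and the linear names in the body of a recursion whose variable occurs are tail-recursive. The
last point holds because each action shortens a finite type, while the recursion variable requires
the type from the start of the recursion (`STyped.finite_lt`). If the variable occurs more than
once, there are no linear names at all, as two occurrences cannot both be given the same linear name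
in a parallel composition (`STyped.false_of_one_lt_occ`).

The components which a trio receives are used by its action, passed on to its successor, or weakened.
The components of a name which is not live afterwards may be weakened because its session is over or
it is shared (`Comp.mem_next`, `typed_output`, `typed_input`). Outside recursions, each propagator
`c_k` is used once, and the components which are not received by the trios are in the linear
environment of the trio that uses them (`BInv`, `BTyped`, `b_typed`). In the body of a recursion all
components are received, and only propagators are in the linear environment, which therefore is the
same in each round of a recursive trio (`RecInv`, `BrecTyped`, `brec_typed`). The parameters of the
recursion are tail-recursive or shared, so their components are the same when they are returned on
`c^r_X` (`Stable`). A part of the body where the variable occurs once has linear propagators; in all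
other parts they are shared, so that the environment of a trio is empty between two rounds. The
payloads of the propagators depend on the continuation, so the kinds `π` are found by induction on
the process. At the end the propagators are restricted (`typed_nuProps`), and names of the initial
environment which the process does not use have type `end` and are weakened.
-/

namespace MST

/-! ### Well-formed source types and their decomposition -/

namespace STy

theorem body_of_mem_suffixes {B S : STy} (hB : body B = true) (hS : S ∈ suffixes B) :
    body S = true ∧ ∃ n, R S = (R B).drop n ∧ (R B).length = n + (R S).length := by
  induction B with
  | act d C T _ ih =>
    simp only [suffixes, List.mem_cons] at hS
    rcases hS with rfl | hS
    · exact ⟨hB, 0, by simp⟩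
    · obtain ⟨h, n, h1, h2⟩ := ih hB hS
      exact ⟨h, n + 1, by simpa [R] using h1, by simp [R, h2]; omega⟩
  | var => simp only [suffixes, List.mem_singleton] at hS; subst hS; exact ⟨hB, 0, by simp⟩
  | sh => simp [body] at hB
  | fin => simp [body] at hB
  | mu => simp [body] at hB

theorem mem_suffixes_self (B : STy) : B ∈ suffixes B := by
  cases B <;> simp [suffixes]

theorem mem_suffixes_tail {B S C : STy} {d : Dir} (h : act d C S ∈ suffixes B) :
    S ∈ suffixes B := by
  induction B with
  | act d' C' T _ ih =>
    simp only [suffixes, List.mem_cons] at h ⊢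
    rcases h with h | h
    · cases h; exact .inr (mem_suffixes_self _)
    · exact .inr (ih h)
  | var => simp [suffixes] at h
  | sh => simp [suffixes] at h
  | fin => simp [suffixes] at h
  | mu => simp [suffixes] at h

theorem tr_subst_mu {B S : STy} (hS : body S = true) : (subst (mu B) S).tr = true := by
  induction S with
  | act d C T _ ih => simpa [subst, tr] using ih hS
  | var => simp [subst, tr]
  | sh => simp [body] at hS
  | fin => simp [body] at hS
  | mu => simp [body] at hS

theorem G_subst_mu {B S : STy} (hS : body S = true) : G (subst (mu B) S) = R B := by
  induction S with
  | act d C T _ ih =>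
    have := tr_subst_mu (B := B) (S := T) hS
    simpa [subst, G, this] using ih hS
  | var => simp [subst, G]
  | sh => simp [body] at hS
  | fin => simp [body] at hS
  | mu => simp [body] at hS

theorem prefixLen_subst_mu {B S : STy} (hS : body S = true) :
    prefixLen (subst (mu B) S) = (R S).length := by
  induction S with
  | act d C T _ ih => simpa [subst, prefixLen, R] using ih hS
  | var => simp [subst, prefixLen, R]
  | sh => simp [body] at hS
  | fin => simp [body] at hS
  | mu => simp [body] at hS

theorem isSession_subst_mu {B S : STy} (hS : body S = true) :
    (subst (mu B) S).isSession = true := by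
  cases S <;> simp [subst, isSession, body] at *

theorem finite_subst_mu {B S : STy} (hS : body S = true) :
    (subst (mu B) S).finite = false := by
  induction S with
  | act d C T _ ih => simpa [subst, finite] using ih hS
  | var => simp [subst, finite]
  | sh => simp [body] at hS
  | fin => simp [body] at hS
  | mu => simp [body] at hS

theorem allPay_subst {B S : STy} (hS : body S = true) :
    AllPay (subst (mu B) S) ↔ AllPay S ∧ AllPay B := by
  induction S with
  | act d C T _ ih => simp [subst, AllPay, ih hS]; tauto
  | var => simp [subst, AllPay]
  | sh => simp [body] at hS
  | fin => simp [body] at hS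
  | mu => simp [body] at hS

theorem f_subst_mu {B S : STy} (hS : body S = true) (h : S ≠ var) :
    (subst (mu B) S).f = (R B).length - (R S).length + 1 := by
  have h1 := G_subst_mu (B := B) hS
  have h2 := prefixLen_subst_mu (B := B) hS
  cases S with
  | act d C T => simp only [subst] at h1 h2 ⊢; simp [f, h1, h2]
  | var => exact absurd rfl h
  | sh => simp [body] at hS
  | fin => simp [body] at hS
  | mu => simp [body] at hS

theorem tr_of_finite {T : STy} (h : T.finite = true) : T.tr = false := by
  induction T with
  | act d C T _ ih => simpa [tr] using ih h
  | _ => simp [finite, tr] at *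

theorem isSession_of_finite {T : STy} (h : T.finite = true) : T.isSession = true := by
  cases T <;> simp [finite, isSession] at *

theorem isSession_of_tr {T : STy} (h : T.tr = true) : T.isSession = true := by
  cases T <;> simp [tr, isSession] at *

theorem WF.finite_of_not_tr {T : STy} (h : T.WF) (hs : T.isSession = true) (ht : T.tr = false) :
    T.finite = true := by
  obtain ⟨⟨D, rfl⟩ | h | ⟨B, S, hB, hv, hS, rfl⟩, -⟩ := h
  · simp [isSession] at hs
  · exact h
  · rw [tr_subst_mu (body_of_mem_suffixes hB hS).1] at ht; cases ht

/-- Payload and continuation of a well-formed type are well-formed. -/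
theorem WF.of_act? {T C S : STy} {d : Dir} (h : T.WF) (ha : T.act? = some (d, C, S)) :
    C.WF ∧ S.WF := by
  obtain ⟨⟨D, rfl⟩ | h | ⟨B, S', hB, hv, hS, rfl⟩, hp⟩ := h
  · simp [act?] at ha
  · cases T <;> simp [act?, finite, AllPay] at *
    obtain ⟨rfl, rfl, rfl⟩ := ha
    exact ⟨⟨hp.1, hp.2.1⟩, .inr (.inl h), hp.2.2⟩
  · have hb := (body_of_mem_suffixes hB hS).1
    have hp' := (allPay_subst hb).1 hp
    cases S' with
    | act d' C' S'' =>
      simp only [subst, act?, Option.some.injEq, Prod.mk.injEq] at ha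
      obtain ⟨rfl, rfl, rfl⟩ := ha
      have h2 := mem_suffixes_tail hS
      exact ⟨⟨hp'.1.1, hp'.1.2.1⟩, .inr (.inr ⟨B, S'', hB, hv, h2, rfl⟩),
        (allPay_subst (S := S'') hb).2 ⟨hp'.1.2.2, hp'.2⟩⟩
    | var =>
      cases B with
      | act d' C' S'' =>
        simp only [subst, act?, Option.some.injEq, Prod.mk.injEq] at ha
        obtain ⟨rfl, rfl, rfl⟩ := ha
        refine ⟨⟨hp'.2.1, hp'.2.2.1⟩, .inr (.inr ⟨_, S'', hB, hv, ?_, rfl⟩),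
          (allPay_subst (S := S'') hB).2 ⟨hp'.2.2.2, hp'.2⟩⟩
        exact mem_suffixes_tail (mem_suffixes_self _)
      | _ => simp [body] at hB hv
    | sh => simp [body] at hb
    | fin => simp [body] at hb
    | mu => simp [body] at hb

/-- The decomposition of a finite type with a first action: a component for this action, and the
components of the continuation, if any. -/
theorem finite_of_act? {T C S : STy} {d : Dir} (h : T.finite = true)
    (ha : T.act? = some (d, C, S)) :
    S.finite = true ∧ G T = .once d (G C) :: (if S = fin then [] else G S) ∧
      T.prefixLen = S.prefixLen + 1 := by
  cases T <;> simp [act?, finite] at *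
  obtain ⟨rfl, rfl, rfl⟩ := ha
  refine ⟨h, ?_, rfl⟩
  simp [G, tr_of_finite h]
  split_ifs <;> simp

/-- The decomposition of a tail-recursive type does not change when it acts, and the component
at the position given by the index function carries this action. -/
theorem WF.tr_of_act? {T C S : STy} {d : Dir} (h : T.WF) (ht : T.tr = true)
    (ha : T.act? = some (d, C, S)) :
    S.tr = true ∧ G S = G T ∧ 0 < T.f ∧ (G T)[T.f - 1]? = some (.loop d (G C)) := by
  obtain ⟨⟨D, rfl⟩ | h | ⟨B, S', hB, hv, hS, rfl⟩, hp⟩ := h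
  · simp [tr] at ht
  · rw [tr_of_finite h] at ht; cases ht
  · obtain ⟨hb, n, h1, h2⟩ := body_of_mem_suffixes hB hS
    cases S' with
    | act d' C' S'' =>
      have hf := f_subst_mu (B := B) hb (by simp)
      simp only [subst, act?, Option.some.injEq, Prod.mk.injEq] at ha
      obtain ⟨rfl, rfl, rfl⟩ := ha
      rw [G_subst_mu hb, hf, G_subst_mu (S := S'') hb]
      refine ⟨tr_subst_mu hb, rfl, by omega, ?_⟩
      rw [h2]
      have : ((R B).drop n).head? = some (.loop d' (G C')) := by rw [← h1]; simp [R]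
      simpa using this
    | var =>
      cases B with
      | act d' C' S'' =>
        simp only [subst, act?, Option.some.injEq, Prod.mk.injEq] at ha
        obtain ⟨rfl, rfl, rfl⟩ := ha
        refine ⟨tr_subst_mu hB, ?_, ?_, ?_⟩
        · rw [G_subst_mu (S := S'') hB]; simp [subst, G]
        · simp [subst, f]
        · simp [subst, f, G, R]
      | _ => simp [body] at hB hv
    | sh => simp [body] at hb
    | fin => simp [body] at hb
    | mu => simp [body] at hb

theorem isSession_of_mem_R {T : STy} : ∀ M ∈ R T, M.isSession = true := by
  induction T with
  | act d C S _ ih =>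
    simp only [R, List.mem_cons]
    rintro M (rfl | h)
    · rfl
    · exact ih M h
  | _ => simp [R]

theorem isSession_of_mem_G_of_finite {T : STy} (h : T.finite = true) :
    ∀ M ∈ G T, M.isSession = true := by
  induction T with
  | fin => simp [G, MTy.isSession]
  | act d C S _ ih =>
    rw [(finite_of_act? (T := act d C S) h rfl).2.1]
    intro M hM
    rcases List.mem_cons.1 hM with rfl | hM
    · rfl
    · split_ifs at hM
      · simp at hM
      · exact ih h M hM
  | _ => simp [finite] at h

/-- The components of a session type are session types. -/
theorem WF.isSession_of_mem_G {T : STy} (h : T.WF) (hs : T.isSession = true) :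
    ∀ M ∈ G T, M.isSession = true := by
  obtain ⟨⟨D, rfl⟩ | h | ⟨B, S', hB, hv, hS, rfl⟩, hp⟩ := h
  · simp [isSession] at hs
  · exact isSession_of_mem_G_of_finite h
  · rw [G_subst_mu (body_of_mem_suffixes hB hS).1]; exact isSession_of_mem_R

/-! Duality. -/

theorem tr_dual (T : STy) : T.dual.tr = T.tr := by
  induction T with
  | act d C S _ ih => simpa [dual, tr] using ih
  | _ => simp [dual, tr]

theorem finite_dual (T : STy) : T.dual.finite = T.finite := by
  induction T with
  | act d C S _ ih => simpa [dual, finite] using ih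
  | _ => simp [dual, finite]

theorem body_dual (T : STy) : T.dual.body = T.body := by
  induction T with
  | act d C S _ ih => simpa [dual, body] using ih
  | _ => simp [dual, body]

theorem isSession_dual (T : STy) : T.dual.isSession = T.isSession := by
  cases T <;> simp [dual, isSession]

theorem dual_eq_fin (T : STy) : T.dual = fin ↔ T = fin := by
  cases T <;> simp [dual]

theorem dual_subst {B S : STy} (hS : body S = true) :
    dual (subst (mu B) S) = subst (mu B.dual) S.dual := by
  induction S with
  | act d C T _ ih => simpa [subst, dual] using ih hS
  | var => simp [subst, dual]
  | sh => simp [body] at hS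
  | fin => simp [body] at hS
  | mu => simp [body] at hS

theorem mem_suffixes_dual {B S : STy} (hB : body B = true) (h : S ∈ suffixes B) :
    S.dual ∈ suffixes B.dual := by
  induction B with
  | act d' C' T _ ih =>
    simp only [suffixes, dual, List.mem_cons] at h ⊢
    rcases h with rfl | h
    · exact .inl rfl
    · exact .inr (ih hB h)
  | var => simp [suffixes] at h; subst h; simp [dual, suffixes]
  | sh => simp [body] at hB
  | fin => simp [body] at hB
  | mu => simp [body] at hB

theorem allPay_dual {T : STy} (h : AllPay T) : AllPay T.dual := by
  induction T with
  | act d C S _ ih => exact ⟨h.1, h.2.1, ih h.2.2⟩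
  | mu S ih => exact ih h
  | _ => simpa [dual] using h

theorem WF.dual {T : STy} (h : T.WF) : T.dual.WF := by
  refine ⟨?_, allPay_dual h.2⟩
  obtain ⟨⟨D, rfl⟩ | h | ⟨B, S', hB, hv, hS, rfl⟩, hp⟩ := h
  · exact .inl ⟨D, rfl⟩
  · exact .inr (.inl (by rwa [finite_dual]))
  · refine .inr (.inr ⟨B.dual, S'.dual, by rwa [body_dual], ?_, mem_suffixes_dual hB hS,
      dual_subst (body_of_mem_suffixes hB hS).1⟩)
    cases B <;> simp [STy.dual] at hv ⊢

theorem R_dual (T : STy) : R T.dual = (R T).map MTy.dual := by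
  induction T with
  | act d C S _ ih => simp [STy.dual, R, ih, MTy.dual]
  | _ => simp [STy.dual, R]

theorem G_dual (T : STy) : G T.dual = (G T).map MTy.dual := by
  induction T with
  | act d C S _ ih =>
    simp only [STy.dual, G, tr_dual, dual_eq_fin]
    split_ifs <;> simp [ih, MTy.dual]
  | mu S ih => simp [STy.dual, G, R_dual]
  | sh => simp [STy.dual, G, MTy.dual]
  | fin => simp [STy.dual, G, MTy.dual]
  | var => simp [STy.dual, G]

/-- Agreement of two types in all that the decomposition depends on; a recursive type and its
unfolding are similar. -/
def Sim (T T' : STy) : Prop :=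
  T.act? = T'.act? ∧ G T = G T' ∧ T.tr = T'.tr ∧ T.isSession = T'.isSession ∧
    T.finite = T'.finite

theorem Sim.refl (T : STy) : Sim T T := ⟨rfl, rfl, rfl, rfl, rfl⟩

theorem Sim.symm {T T' : STy} (h : Sim T T') : Sim T' T :=
  ⟨h.1.symm, h.2.1.symm, h.2.2.1.symm, h.2.2.2.1.symm, h.2.2.2.2.symm⟩

theorem Sim.trans {T T' T'' : STy} (h : Sim T T') (h' : Sim T' T'') : Sim T T'' :=
  ⟨h.1.trans h'.1, h.2.1.trans h'.2.1, h.2.2.1.trans h'.2.2.1, h.2.2.2.1.trans h'.2.2.2.1,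
    h.2.2.2.2.trans h'.2.2.2.2⟩

theorem sim_mu {B : STy} (hB : body B = true) (hv : B ≠ var) : Sim (mu B) (subst (mu B) B) := by
  refine ⟨?_, ?_, ?_, ?_, ?_⟩
  · cases B <;> simp [body, act?, subst] at hB hv ⊢
  · rw [G_subst_mu hB]; simp [G]
  · rw [tr_subst_mu hB]; simp [tr]
  · rw [isSession_subst_mu hB]; simp [isSession]
  · rw [finite_subst_mu hB]; simp [finite]

theorem Unf.sim {T T' : STy} (h : Unf T T') : Sim T T' := by
  obtain ⟨B, hB, hv, ⟨rfl, rfl⟩ | ⟨rfl, rfl⟩⟩ := h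
  · exact sim_mu hB hv
  · exact (sim_mu hB hv).symm

end STy

/-! ### Typing of decomposed processes over a fixed assignment of types to names -/

/-- The payload of a shared type. -/
def MTy.shOf : MTy → Option (List MTy)
  | .sh ps => some ps
  | _ => none

theorem MTy.shOf_eq_none {M : MTy} (h : M.isSession = true) : M.shOf = none := by
  cases M <;> simp [MTy.isSession, MTy.shOf] at *

theorem MTy.eq_sh_of_not_isSession {M : MTy} (h : ¬ M.isSession = true) : ∃ ps, M = .sh ps := by
  cases M <;> simp [MTy.isSession] at *

open Classical in
/-- The linear environment with the domain `L`, as far as `τ` assigns session types to the names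
in `L`. Names in `L` of a shared type are ignored. -/
noncomputable def lenv (τ : TName → MTy) (L : Set TName) : TLinEnv := fun x =>
  if x ∈ L ∧ (τ x).isSession = true then some (τ x) else none

section lenv

variable {τ τ' : TName → MTy} {L L' A W : Set TName} {x u : TName}

theorem lenv_of_mem (h : x ∈ L) (hs : (τ x).isSession = true) : lenv τ L x = some (τ x) := by
  simp [lenv, h, hs]

theorem lenv_of_notMem (h : x ∉ L) : lenv τ L x = none := by simp [lenv, h]

theorem lenv_of_not_isSession (h : ¬ (τ x).isSession = true) : lenv τ L x = none := by
  simp [lenv, h]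

theorem lenv_eq_none_iff : lenv τ L x = none ↔ ((τ x).isSession = true → x ∉ L) := by
  unfold lenv
  split_ifs with h
  · simp [h.1, h.2]
  · simp only [true_iff]; tauto

theorem lenv_apply_congr (h : (τ x).isSession = true → (x ∈ L ↔ x ∈ L')) :
    lenv τ L x = lenv τ L' x := by
  unfold lenv
  by_cases hs : (τ x).isSession = true
  · by_cases hx : x ∈ L
    · simp [hx, (h hs).1 hx]
    · simp [hx, mt (h hs).2 hx]
  · rw [if_neg (fun h => hs h.2), if_neg (fun h => hs h.2)]

theorem lenv_congr (h : ∀ x, (τ x).isSession = true → (x ∈ L ↔ x ∈ L'))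
    (hτ : ∀ x, x ∈ L ∪ L' → τ x = τ' x) : lenv τ L = lenv τ' L' := by
  funext x
  by_cases hx : x ∈ L ∪ L'
  · by_cases hs : (τ x).isSession = true
    · rw [lenv_apply_congr (L' := L') (fun hs => h x hs)]
      unfold lenv
      rw [hτ x hx]
    · rw [lenv_of_not_isSession hs, lenv_of_not_isSession (by rwa [← hτ x hx])]
  · rw [lenv_of_notMem (fun h => hx (.inl h)), lenv_of_notMem (fun h => hx (.inr h))]

theorem lenv_ext (h : ∀ x, (τ x).isSession = true → (x ∈ L ↔ x ∈ L')) :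
    lenv τ L = lenv τ L' := lenv_congr h fun _ _ => rfl

theorem lenv_eq_empty (h : ∀ x ∈ L, ¬ (τ x).isSession = true) : lenv τ L = Env.empty := by
  funext x
  exact lenv_eq_none_iff.2 fun hs hx => h x hx hs

/-- Two disjoint domains split the environment; since `τ` is fixed, only the domains matter. -/
theorem lenv_split (hL : ∀ x, (τ x).isSession = true → (x ∈ L ↔ x ∈ A ∨ x ∈ W))
    (hd : ∀ x, (τ x).isSession = true → x ∈ A → x ∉ W) :
    (lenv τ L).Split (lenv τ A) (lenv τ W) := by
  intro x
  by_cases hs : (τ x).isSession = true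
  · have h1 := hL x hs
    have h2 := hd x hs
    by_cases hA : x ∈ A
    · exact .inl ⟨lenv_apply_congr fun _ => by tauto, lenv_of_notMem (h2 hA)⟩
    · exact .inr ⟨lenv_of_notMem hA, lenv_apply_congr fun _ => by tauto⟩
  · simp [lenv, hs]

end lenv

theorem tshBind_map (Γ : TShEnv) (τ : TName → MTy) (ys : List TName) (x : TName) :
    tshBind Γ ys (ys.map τ) x = if x ∈ ys then (τ x).shOf else Γ x := by
  induction ys with
  | nil => simp [tshBind]
  | cons y ys ih =>
    rcases h : τ y with _ | _ | _ | ps <;>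
    · simp only [List.map_cons, h, tshBind, Env.set, Env.erase, Function.update_apply, ih]
      by_cases hx : x = y
      · subst hx; simp [h, MTy.shOf]
      · simp [hx]

theorem tlinBind_map (τ : TName → MTy) (A : Set TName) (ys : List TName) :
    tlinBind (lenv τ A) ys (ys.map τ) = lenv τ (A ∪ {x | x ∈ ys}) := by
  induction ys with
  | nil => simp [tlinBind]
  | cons y ys ih =>
    funext x
    by_cases hx : x = y
    · subst hx
      rcases h : τ x with _ | _ | _ | ps <;>
        simp [h, tlinBind, Env.set, Env.erase, lenv, MTy.isSession]
    · have : tlinBind (lenv τ A) (y :: ys) ((y :: ys).map τ) x =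
          tlinBind (lenv τ A) ys (ys.map τ) x := by
        rcases h : τ y with _ | _ | _ | ps <;>
          simp [h, tlinBind, Env.set, Env.erase, hx]
      rw [this, ih]
      exact lenv_apply_congr fun _ => by simp [hx]

/-- A list of distinct names has the types that `τ` assigns, if `Γ` agrees with `τ` on its shared
names. -/
theorem TVals.of_lenv {Γ : TShEnv} {τ : TName → MTy} {zs : List TName} (hnd : zs.Nodup)
    (hz : ∀ z ∈ zs, Γ z = (τ z).shOf) : TVals Γ (lenv τ {x | x ∈ zs}) zs (zs.map τ) := by
  induction zs with
  | nil => rw [lenv_eq_empty (by simp)]; exact .nil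
  | cons z zs ih =>
    obtain ⟨h1, h2⟩ := List.nodup_cons.1 hnd
    have ih := ih h2 fun y hy => hz y (List.mem_cons_of_mem _ hy)
    have hz := hz z List.mem_cons_self
    by_cases hs : (τ z).isSession = true
    · have := TVals.session (z := z) hs (lenv_of_notMem (by simpa using h1)) ih
      rw [List.map_cons]
      convert this using 1
      funext x
      by_cases hx : x = z
      · subst hx; simp [lenv, hs, Env.set]
      · simp [lenv, hx, Env.set]
    · obtain ⟨ps, hps⟩ := MTy.eq_sh_of_not_isSession hs
      rw [List.map_cons, hps]
      rw [hps] at hz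
      convert TVals.shared hz ih using 1
      refine lenv_ext fun x hx => ?_
      have : x ≠ z := by rintro rfl; exact hs hx
      simp [this]

/-- Weakening by finitely many names of type `end`. -/
theorem TTyped.weaken {Γ : TShEnv} {Ξ : TRecEnv} {τ : TName → MTy} {A L : Set TName} {P : TProc}
    (h : TTyped Γ Ξ (lenv τ A) P) (hAL : ∀ x ∈ A, (τ x).isSession = true → x ∈ L)
    (hfin : {x | x ∈ L ∧ x ∉ A ∧ (τ x).isSession = true}.Finite)
    (hw : ∀ x ∈ L, x ∉ A → (τ x).isSession = true → τ x = .fin ∧ Γ x = none) :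
    TTyped Γ Ξ (lenv τ L) P := by
  obtain ⟨s, hs⟩ := hfin.exists_finset_coe
  have hs : ∀ x, x ∈ s ↔ x ∈ L ∧ x ∉ A ∧ (τ x).isSession = true := fun x => by
    rw [← Finset.mem_coe, hs]; rfl
  suffices H : ∀ t ⊆ s, TTyped Γ Ξ (lenv τ (A ∪ {x | x ∈ t})) P by
    convert H s (Finset.Subset.refl s) using 1
    refine lenv_ext fun x hx => ?_
    have := hs x
    have := hAL x
    simp only [Set.mem_union, Set.mem_ofPred_eq]
    tauto
  intro t ht
  induction t using Finset.induction_on with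
  | empty => simpa using h
  | insert a t ha ih =>
    have ih := ih ((Finset.subset_insert a t).trans ht)
    obtain ⟨h1, h2, h3⟩ := (hs a).1 (ht (Finset.mem_insert_self a t))
    obtain ⟨h4, h5⟩ := hw a h1 h2 h3
    convert TTyped.wk a ih h5 (lenv_of_notMem (by simp [ha, h2])) using 1
    funext x
    by_cases hx : x = a
    · subst hx; simp [lenv, Env.set, h4, MTy.isSession]
    · rw [Env.set, Function.update_of_ne hx]
      exact lenv_apply_congr fun _ => by simp [hx]

/-- `Use Γ τ u d Ms A W`: the name `u` can perform an action with direction `d` and objects of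
types `Ms`, where `A` is the domain of the linear environment of the continuation and `W` the set
of names used up by the action: `u` itself if it is linear and not recursive, and nothing if it is
a recursive name, which stays available, or a shared name. -/
def Use (Γ : TShEnv) (τ : TName → MTy) (u : TName) (d : Dir) (Ms : List MTy)
    (A W : Set TName) : Prop :=
  (τ u = .once d Ms ∧ Γ u = none ∧ u ∉ A ∧ W = {u}) ∨ (τ u = .loop d Ms ∧ u ∈ A ∧ W = ∅) ∨
    (Γ u = some Ms ∧ W = ∅)

section rules

variable {Γ : TShEnv} {Ξ : TRecEnv} {τ : TName → MTy} {A W L : Set TName} {u : TName}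
  {zs ys : List TName} {P Q : TProc}

/-- Output by any of the three kinds of subject. -/
theorem TTyped.send_use (hP : TTyped Γ Ξ (lenv τ A) P) (hu : Use Γ τ u .out (zs.map τ) A W)
    (hnd : zs.Nodup) (hz : ∀ z ∈ zs, Γ z = (τ z).shOf)
    (hd : ∀ z ∈ zs, (τ z).isSession = true → z ∉ A ∧ z ∉ W)
    (hL : ∀ x, (τ x).isSession = true → (x ∈ L ↔ x ∈ W ∨ x ∈ A ∨ x ∈ zs)) :
    TTyped Γ Ξ (lenv τ L) (.out u zs P) := by
  have hv := TVals.of_lenv hnd hz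
  have hsp : (lenv τ (A ∪ {x | x ∈ zs})).Split (lenv τ A) (lenv τ {x | x ∈ zs}) :=
    lenv_split (fun x _ => by simp) fun x hx hA hz => (hd x hz hx).1 hA
  rcases hu with ⟨h1, h2, h3, rfl⟩ | ⟨h1, h2, rfl⟩ | ⟨h1, rfl⟩
  · have hs : (τ u).isSession = true := by rw [h1]; rfl
    have huz : u ∉ zs := fun h => (hd u h hs).2 rfl
    have hP' := TTyped.wk u hP h2 (lenv_of_notMem h3)
    have := TTyped.send (Δ := (lenv τ (A ∪ {x | x ∈ zs})).set u .fin) (u := u) (T := τ u) hP'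
      (by simp [Env.set]; rfl) hv ?_ (by rw [h1]; rfl)
    · convert this using 1
      funext x
      by_cases hx : x = u
      · subst hx; simp [Env.set, lenv, hs, hL x hs]
      · rw [Env.set, Function.update_of_ne hx, Env.set, Function.update_of_ne hx]
        exact lenv_apply_congr fun hsx => by simp [hL x hsx, hx]
    · intro x
      by_cases hx : x = u
      · subst hx; simp [Env.set, lenv, huz]
      · simpa [Env.set, hx] using hsp x
  · have hs : (τ u).isSession = true := by rw [h1]; rfl
    have := TTyped.send (u := u) (T := τ u) (S := τ u) hP (lenv_of_mem h2 hs) hv hsp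
      (by rw [h1]; rfl)
    convert this using 1
    funext x
    by_cases hx : x = u
    · subst hx; simp [Env.set, lenv, hs, hL x hs, h2]
    · rw [Env.set, Function.update_of_ne hx]
      exact lenv_apply_congr fun hsx => by simp [hL x hsx]
  · have := TTyped.req h1 hP hv hsp
    convert this using 1
    refine lenv_ext fun x hx => ?_
    simp [hL x hx]

/-- Input by any of the three kinds of subject; the linear and the shared bound names are told apart
by `τ`. -/
theorem TTyped.recv_use
    (hP : ∀ Γ', (∀ x, Γ' x = if x ∈ ys then (τ x).shOf else Γ x) →
      TTyped Γ' Ξ (lenv τ (A ∪ {x | x ∈ ys})) P)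
    (hu : Use Γ τ u .inp (ys.map τ) A W) (hnd : ys.Nodup) (huy : u ∉ ys)
    (hd : ∀ y ∈ ys, (τ y).isSession = true → y ∉ A)
    (hL : ∀ x, (τ x).isSession = true → (x ∈ L ↔ x ∈ W ∨ x ∈ A)) :
    TTyped Γ Ξ (lenv τ L) (.inp u ys P) := by
  have hP := hP _ (tshBind_map Γ τ ys)
  have hy : ∀ y ∈ ys, lenv τ L y = none := by
    intro y hy
    refine lenv_eq_none_iff.2 fun hs hyL => ?_
    rcases (hL y hs).1 hyL with h | h
    · rcases hu with ⟨-, -, -, rfl⟩ | ⟨-, -, rfl⟩ | ⟨-, rfl⟩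
      · exact huy (by rwa [← Set.mem_singleton_iff.1 h])
      · exact h
      · exact h
    · exact hd y hy hs h
  rcases hu with ⟨h1, h2, h3, rfl⟩ | ⟨h1, h2, rfl⟩ | ⟨h1, rfl⟩
  · have hs : (τ u).isSession = true := by rw [h1]; rfl
    refine TTyped.rcv (T := τ u) (S := .fin) (Ms := ys.map τ)
      (lenv_of_mem ((hL u hs).2 (.inl rfl)) hs) (by rw [h1]; rfl) (by simp) hnd hy ?_
    have hP' := TTyped.wk u hP (by rw [tshBind_map, if_neg huy, h2])
      (lenv_of_notMem (by simp [h3, huy]))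
    convert hP' using 1
    -- The update of `u` commutes with the binding of `ys`, as `u` is not one of them.
    have key : ∀ (Δ : TLinEnv) (zs : List TName) (Ms : List MTy), u ∉ zs →
        tlinBind (Δ.set u .fin) zs Ms = (tlinBind Δ zs Ms).set u .fin := by
      intro Δ zs
      induction zs with
      | nil => intro Ms _; simp [tlinBind]
      | cons z zs ih =>
        intro Ms hz
        obtain ⟨hz1, hz2⟩ : u ≠ z ∧ u ∉ zs := by simpa using hz
        rcases Ms with _ | ⟨M, Ms⟩
        · simp [tlinBind]
        · rcases M with _ | _ | _ | _ <;>
            simp only [tlinBind, Env.set, Env.erase] <;>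
            rw [show tlinBind (Function.update Δ u (some MTy.fin)) zs Ms = _ from ih Ms hz2,
              Env.set, Function.update_comm (Ne.symm hz1)]
    rw [← tlinBind_map, ← key _ _ _ huy]
    have e : (lenv τ L).set u .fin = (lenv τ A).set u .fin := by
      funext x
      by_cases hx : x = u
      · subst hx; simp [Env.set]
      · rw [Env.set, Function.update_of_ne hx, Env.set, Function.update_of_ne hx]
        exact lenv_apply_congr fun hsx => by simp [hL x hsx, hx]
    rw [e]
  · have hs : (τ u).isSession = true := by rw [h1]; rfl
    refine TTyped.rcv (T := τ u) (S := τ u) (Ms := ys.map τ)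
      (lenv_of_mem ((hL u hs).2 (.inr h2)) hs) (by rw [h1]; rfl) (by simp) hnd hy ?_
    have e : (lenv τ L).set u (τ u) = lenv τ A := by
      funext x
      by_cases hx : x = u
      · subst hx; simp [Env.set, lenv, hs, h2]
      · rw [Env.set, Function.update_of_ne hx]
        exact lenv_apply_congr fun hsx => by simp [hL x hsx]
    rw [e, tlinBind_map]
    exact hP
  · have e : lenv τ L = lenv τ A := lenv_ext fun x hx => by simp [hL x hx]
    refine TTyped.acc (Ms := ys.map τ) h1 (by simp) hnd hy ?_
    rw [e, tlinBind_map]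
    exact hP

theorem TTyped.par_lenv (hP : TTyped Γ Ξ (lenv τ A) P) (hQ : TTyped Γ Ξ (lenv τ W) Q)
    (hL : ∀ x, (τ x).isSession = true → (x ∈ L ↔ x ∈ A ∨ x ∈ W))
    (hd : ∀ x, (τ x).isSession = true → x ∈ A → x ∉ W) :
    TTyped Γ Ξ (lenv τ L) (.par P Q) :=
  .par (lenv_split hL hd) hP hQ

/-- Restriction of a channel whose endpoints are of dual session types, or whose first endpoint is
shared while the second one is not used. -/
theorem TTyped.res_lenv {c : TChan} {ann : Option MTy}
    (hP : ∀ Γ' : TShEnv, (∀ x, x.1 ≠ c → Γ' x = Γ x) → Γ' (c, false) = (τ (c, false)).shOf →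
      Γ' (c, true) = none → TTyped Γ' Ξ (lenv τ L) P)
    (hτ : τ (c, true) = (τ (c, false)).dual) (hann : ann = none ∨ ann = some (τ (c, false)))
    (hL : ∀ x, (τ x).isSession = true → (x ∈ L ↔ x ∈ A ∨ x.1 = c))
    (hA : ∀ x ∈ A, x.1 ≠ c) :
    TTyped Γ Ξ (lenv τ A) (.res c ann P) := by
  have hn : ∀ b, lenv τ A (c, b) = none := fun b => lenv_of_notMem fun h => hA _ h rfl
  by_cases hs : (τ (c, false)).isSession = true
  · have hs' : (τ (c, true)).isSession = true := by
      rw [hτ]; revert hs; cases τ (c, false) <;> simp [MTy.isSession, MTy.dual]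
    refine .resS (M := τ (c, false)) hs hann (hn _) (hn _) ?_
    convert hP ((Γ.erase (c, false)).erase (c, true)) ?_ ?_ ?_ using 1
    · funext ⟨c', b⟩
      by_cases hc : c' = c
      · subst hc
        have e1 := hL (c', true) hs'
        have e2 := hL (c', false) hs
        cases b <;> simp [Env.set, lenv, hs, e1, e2, hτ]
        simpa [hτ] using hs'
      · rw [Env.set, Function.update_of_ne (by simp [hc]), Env.set,
          Function.update_of_ne (by simp [hc])]
        exact lenv_apply_congr fun hsx => by simp [hL _ hsx, hc]
    · rintro ⟨c', b⟩ hc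
      have hc : c' ≠ c := hc
      simp [Env.erase, hc]
    · rw [MTy.shOf_eq_none hs]; simp [Env.erase]
    · simp [Env.erase]
  · obtain ⟨ps, hps⟩ := MTy.eq_sh_of_not_isSession hs
    refine .res (ps := ps) (by rwa [hps] at hann) (hn _) (hn _) ?_
    convert hP ((Γ.set (c, false) ps).erase (c, true)) ?_ ?_ ?_ using 1
    · refine lenv_ext fun x hx => ?_
      rw [hL x hx]
      constructor
      · exact .inl
      · rintro (h | h)
        · exact h
        · obtain ⟨c', b⟩ := x
          cases h
          cases b
          · exact absurd hx hs
          · rw [hτ, hps] at hx; cases hx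
    · rintro ⟨c', b⟩ hc
      have hc : c' ≠ c := hc
      simp [Env.erase, Env.set, hc]
    · rw [hps]; simp [Env.erase, Env.set, MTy.shOf]
    · simp [Env.erase]

end rules

/-! ### Linearity in the source calculus -/

theorem Env.set_self {T : Type} (E : Env Name T) (u : Name) (t : T) : E.set u t u = some t := by
  simp [Env.set]

theorem Env.set_of_ne {T : Type} (E : Env Name T) {u v : Name} (t : T) (h : v ≠ u) :
    E.set u t v = E v := by
  simp [Env.set, h]

theorem Env.erase_self {T : Type} (E : Env Name T) (u : Name) : E.erase u u = none := by
  simp [Env.erase]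

theorem Env.erase_of_ne {T : Type} (E : Env Name T) {u v : Name} (h : v ≠ u) :
    E.erase u v = E v := by
  simp [Env.erase, h]

theorem recSet_of_ne {Ξ : RecEnv} {X Y : ℕ} {Δ : LinEnv} (h : X ≠ Y) : Ξ.set Y Δ X = Ξ X := by
  simp [Env.set, h]

theorem shBind_of_ne (Γ : ShEnv) {y v : Name} (C : STy) (h : v ≠ y) :
    shBind Γ y C v = Γ v := by
  cases C <;> simp [shBind, Env.set, Env.erase, h]

theorem linBind_of_ne (Δ : LinEnv) {y v : Name} (C : STy) (h : v ≠ y) :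
    linBind Δ y C v = Δ v := by
  cases C <;> simp [linBind, Env.set, Env.erase, h]

theorem linBind_self (Δ : LinEnv) (y : Name) {C : STy} (h : C.isSession = true) :
    linBind Δ y C y = some C := by
  cases C <;> simp [linBind, Env.set, STy.isSession] at *

theorem shBind_linBind_disjoint {Γ : ShEnv} {Δ : LinEnv} {y : Name} {C : STy}
    (h : ∀ u, Γ u = none ∨ Δ u = none) (u : Name) :
    shBind Γ y C u = none ∨ linBind Δ y C u = none := by
  by_cases hu : u = y
  · subst hu; cases C <;> simp [shBind, linBind, Env.set, Env.erase]
  · rw [shBind_of_ne _ _ hu, linBind_of_ne _ _ hu]; exact h u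

theorem Env.Split.of_left {T : Type} {Δ Δ₁ Δ₂ : Env Name T} (h : Δ.Split Δ₁ Δ₂) {u : Name} {S : T}
    (hu : Δ₁ u = some S) : Δ u = some S ∧ Δ₂ u = none := by
  rcases h u with ⟨h1, h2⟩ | ⟨h1, h2⟩
  · exact ⟨h1 ▸ hu, h2⟩
  · rw [h1] at hu; cases hu

theorem Env.Split.symm {T : Type} {Δ Δ₁ Δ₂ : Env Name T} (h : Δ.Split Δ₁ Δ₂) :
    Δ.Split Δ₂ Δ₁ := fun u => (h u).symm.imp And.symm And.symm

theorem Env.Split.of_right {T : Type} {Δ Δ₁ Δ₂ : Env Name T} (h : Δ.Split Δ₁ Δ₂) {u : Name}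
    {S : T} (hu : Δ₂ u = some S) : Δ u = some S ∧ Δ₁ u = none := h.symm.of_left hu

theorem SVal.dom {Γ : ShEnv} {Δ : LinEnv} {z : Name} {C : STy} (h : SVal Γ Δ z C) :
    (∃ D, C = .sh D ∧ Γ z = some D ∧ ∀ u, Δ u = none) ∨
      (C.isSession = true ∧ Δ z = some C ∧ ∀ u, u ≠ z → Δ u = none) := by
  cases h with
  | shared h => exact .inl ⟨_, rfl, h, fun _ => rfl⟩
  | session h => exact .inr ⟨h, by simp [Env.single],
      fun u hu => by simp [Env.single, Env.empty, hu]⟩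

/-- A linear name whose session is not over occurs in the process, or is left to the recursion
variable. -/
theorem STyped.mem_fn_of_ne_fin {Γ : ShEnv} {Ξ : RecEnv} {Δ : LinEnv} {P : SProc}
    (h : STyped Γ Ξ Δ P) {u : Name} {S : STy} (hu : Δ u = some S) (hS : S ≠ .fin) :
    u ∈ P.fn ∨ ∃ X Δ₀, Ξ X = some Δ₀ ∧ P.occ X ≠ 0 ∧ Δ₀ u ≠ none := by
  induction h generalizing S with
  | nil => cases hu
  | @wk _ _ Δ P v h _ _ ih =>
    by_cases huv : u = v
    · subst huv; rw [Env.set_self] at hu; cases hu; exact absurd rfl hS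
    · rw [Env.set_of_ne _ _ huv] at hu; exact ih hu hS
  | @unf _ _ Δ P v T T' hT hv h ih =>
    by_cases huv : u = v
    · subst huv
      refine ih hv ?_
      rintro rfl
      obtain ⟨B, hB, hv, ⟨h, -⟩ | ⟨h, -⟩⟩ := hT
      · cases h
      · cases B <;> simp [STy.body, STy.subst] at hB hv h
    · rw [Env.set_of_ne _ _ huv] at hu; exact ih hu hS
  | @pvar _ Ξ Δ X h => exact .inr ⟨X, Δ, h, by simp [SProc.occ], by simp [hu]⟩
  | mu h hfn => exact .inl (hfn u (by simp [hu]))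
  | @par _ _ Δ Δ₁ Δ₂ P Q hsp hP hQ ihP ihQ =>
    rcases hsp u with ⟨h1, -⟩ | ⟨-, h1⟩
    · rcases ihP (h1.trans hu) hS with h | ⟨X, Δ₀, h, h', h''⟩
      · exact .inl (by simp [SProc.fn, h])
      · exact .inr ⟨X, Δ₀, h, by simp [SProc.occ, h'], h''⟩
    · rcases ihQ (h1.trans hu) hS with h | ⟨X, Δ₀, h, h', h''⟩
      · exact .inl (by simp [SProc.fn, h])
      · exact .inr ⟨X, Δ₀, h, by simp [SProc.occ, h'], h''⟩
  | @send _ _ Δ Δ₁ Δ₂ v z P T C S' hP hv hz hsp hT hfin ih =>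
    by_cases huv : u = v
    · exact .inl (by simp [SProc.fn, huv])
    rw [Env.set_of_ne _ _ huv] at hu
    rcases hsp u with ⟨h1, -⟩ | ⟨-, h1⟩
    · rcases ih (h1.trans hu) hS with h | h
      · exact .inl (by simp [SProc.fn, h])
      · exact .inr h
    · rcases hz.dom with ⟨D, -, -, h⟩ | ⟨-, -, h⟩
      · rw [h u, hu] at h1; cases h1
      · by_cases hzu : u = z
        · exact .inl (by simp [SProc.fn, hzu])
        · rw [h u hzu, hu] at h1; cases h1
  | @rcv _ _ Δ v y P T C S' hv hT hy hP hfin ih =>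
    by_cases huv : u = v
    · exact .inl (by simp [SProc.fn, huv])
    have huy : u ≠ (y, false) := by rintro rfl; rw [hy] at hu; cases hu
    rcases ih (by rw [linBind_of_ne _ _ huy, Env.set_of_ne _ _ huv, hu]) hS with h | h
    · exact .inl (by simp [SProc.fn, h, huy])
    · exact .inr h
  | @req _ _ Δ Δ₁ Δ₂ v z P C hv hP hz hsp ih =>
    rcases hsp u with ⟨h1, -⟩ | ⟨-, h1⟩
    · rcases ih (h1.trans hu) hS with h | h
      · exact .inl (by simp [SProc.fn, h])
      · exact .inr h
    · rcases hz.dom with ⟨D, -, -, h⟩ | ⟨-, -, h⟩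
      · rw [h u, hu] at h1; cases h1
      · by_cases hzu : u = z
        · exact .inl (by simp [SProc.fn, hzu])
        · rw [h u hzu, hu] at h1; cases h1
  | @acc _ _ Δ v y P C hv hy hP ih =>
    have huy : u ≠ (y, false) := by rintro rfl; rw [hy] at hu; cases hu
    rcases ih (by rw [linBind_of_ne _ _ huy, hu]) hS with h | h
    · exact .inl (by simp [SProc.fn, h, huy])
    · exact .inr h
  | @resS _ _ Δ s P S' hWF hses h1 h2 hP ih =>
    have hu1 : u ≠ (s, false) := by rintro rfl; rw [h1] at hu; cases hu
    have hu2 : u ≠ (s, true) := by rintro rfl; rw [h2] at hu; cases hu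
    have hu3 : u.1 ≠ s := by
      rintro rfl
      obtain ⟨a, b⟩ := u
      cases b
      · exact hu1 rfl
      · exact hu2 rfl
    rcases ih (by rw [Env.set_of_ne _ _ hu2, Env.set_of_ne _ _ hu1, hu]) hS with h | h
    · exact .inl (by simp [SProc.fn, h, hu3])
    · exact .inr h
  | @res _ _ Δ s P C hWF h1 h2 hP ih =>
    have hu3 : u.1 ≠ s := by
      rintro rfl
      obtain ⟨a, b⟩ := u
      cases b
      · rw [h1] at hu; cases hu
      · rw [h2] at hu; cases hu
    rcases ih hu hS with h | h
    · exact .inl (by simp [SProc.fn, h, hu3])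
    · exact .inr h

/-- The free names of a typed process are in the domain of the environments. -/
theorem STyped.dom_of_mem_fn {Γ : ShEnv} {Ξ : RecEnv} {Δ : LinEnv} {P : SProc}
    (h : STyped Γ Ξ Δ P) {u : Name} (hu : u ∈ P.fn) : Γ u ≠ none ∨ Δ u ≠ none := by
  induction h with
  | nil => simp [SProc.fn] at hu
  | @wk _ _ Δ P v h _ _ ih =>
    by_cases huv : u = v
    · subst huv; right; simp [Env.set]
    · rw [Env.set_of_ne _ _ huv]; exact ih hu
  | @unf _ _ Δ P v T T' hT hv h ih =>
    by_cases huv : u = v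
    · subst huv; right; simp [Env.set]
    · rw [Env.set_of_ne _ _ huv]; exact ih hu
  | pvar h => simp [SProc.fn] at hu
  | mu h hfn ih => exact ih hu
  | @par _ _ Δ Δ₁ Δ₂ P Q hsp hP hQ ihP ihQ =>
    rcases List.mem_append.1 hu with h | h
    · refine (ihP h).imp_right fun h => ?_
      obtain ⟨S, hS⟩ := Option.ne_none_iff_exists'.1 h
      simp [(hsp.of_left hS).1]
    · refine (ihQ h).imp_right fun h => ?_
      obtain ⟨S, hS⟩ := Option.ne_none_iff_exists'.1 h
      simp [(hsp.of_right hS).1]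
  | @send _ _ Δ Δ₁ Δ₂ v z P T C S' hP hv hz hsp hT hfin ih =>
    by_cases huv : u = v
    · subst huv; right; simp [Env.set]
    rw [Env.set_of_ne _ _ huv]
    simp only [SProc.fn, List.mem_cons, huv, false_or] at hu
    rcases hu with rfl | h
    · rcases hz.dom with ⟨D, -, h, -⟩ | ⟨-, h, -⟩
      · left; simp [h]
      · right; simp [(hsp.of_right h).1]
    · refine (ih h).imp_right fun h => ?_
      obtain ⟨S, hS⟩ := Option.ne_none_iff_exists'.1 h
      simp [(hsp.of_left hS).1]
  | @rcv _ _ Δ v y P T C S' hv hT hy hP hfin ih =>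
    by_cases huv : u = v
    · subst huv; right; simp [hv]
    simp only [SProc.fn, List.mem_cons, huv, false_or, List.mem_filter, decide_eq_true_eq] at hu
    have := ih hu.1
    rwa [linBind_of_ne _ _ hu.2, shBind_of_ne _ _ hu.2, Env.set_of_ne _ _ huv] at this
  | @req _ _ Δ Δ₁ Δ₂ v z P C hv hP hz hsp ih =>
    simp only [SProc.fn, List.mem_cons] at hu
    rcases hu with rfl | rfl | h
    · left; simp [hv]
    · rcases hz.dom with ⟨D, -, h, -⟩ | ⟨-, h, -⟩
      · left; simp [h]
      · right; simp [(hsp.of_right h).1]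
    · refine (ih h).imp_right fun h => ?_
      obtain ⟨S, hS⟩ := Option.ne_none_iff_exists'.1 h
      simp [(hsp.of_left hS).1]
  | @acc _ _ Δ v y P C hv hy hP ih =>
    by_cases huv : u = v
    · subst huv; left; simp [hv]
    simp only [SProc.fn, List.mem_cons, huv, false_or, List.mem_filter, decide_eq_true_eq] at hu
    have := ih hu.1
    rwa [linBind_of_ne _ _ hu.2, shBind_of_ne _ _ hu.2] at this
  | @resS _ _ Δ s P S' hWF hses h1 h2 hP ih =>
    simp only [SProc.fn, List.mem_filter, decide_eq_true_eq] at hu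
    have hu1 : u ≠ (s, false) := by rintro rfl; exact hu.2 rfl
    have hu2 : u ≠ (s, true) := by rintro rfl; exact hu.2 rfl
    have := ih hu.1
    rwa [Env.set_of_ne _ _ hu2, Env.set_of_ne _ _ hu1, Env.erase_of_ne _ hu2,
      Env.erase_of_ne _ hu1] at this
  | @res _ _ Δ s P C hWF h1 h2 hP ih =>
    simp only [SProc.fn, List.mem_filter, decide_eq_true_eq] at hu
    have hu1 : u ≠ (s, false) := by rintro rfl; exact hu.2 rfl
    have hu2 : u ≠ (s, true) := by rintro rfl; exact hu.2 rfl
    have := ih hu.1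
    rwa [Env.erase_of_ne _ hu2, Env.set_of_ne _ _ hu1] at this

/-- The linear names which a recursion variable needs are available wherever it occurs. -/
theorem STyped.dom_of_occ {Γ : ShEnv} {Ξ : RecEnv} {Δ : LinEnv} {P : SProc}
    (h : STyped Γ Ξ Δ P) {X : ℕ} {Δ₀ : LinEnv} (hX : Ξ X = some Δ₀) (ho : P.occ X ≠ 0)
    {u : Name} (hu : Δ₀ u ≠ none) (hb : u.1 ∉ P.bound) : Δ u ≠ none := by
  induction h with
  | nil => simp [SProc.occ] at ho
  | @wk _ _ Δ P v h _ _ ih =>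
    by_cases huv : u = v
    · subst huv; simp [Env.set]
    · rw [Env.set_of_ne _ _ huv]; exact ih hX ho hb
  | @unf _ _ Δ P v T T' hT hv h ih =>
    by_cases huv : u = v
    · subst huv; simp [Env.set]
    · rw [Env.set_of_ne _ _ huv]; exact ih hX ho hb
  | @pvar _ Ξ Δ Y h =>
    have : X = Y := by by_contra hXY; simp [SProc.occ, hXY] at ho
    subst this; rw [h] at hX; cases hX; exact hu
  | @mu _ Ξ Δ Y P h hfn ih =>
    have hXY : X ≠ Y := by rintro rfl; simp [SProc.occ] at ho
    exact ih (by rw [recSet_of_ne hXY, hX]) (by simpa [SProc.occ, hXY] using ho) hb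
  | @par _ _ Δ Δ₁ Δ₂ P Q hsp hP hQ ihP ihQ =>
    simp only [SProc.bound, List.mem_append, not_or] at hb
    have : P.occ X ≠ 0 ∨ Q.occ X ≠ 0 := by simp only [SProc.occ] at ho; omega
    rcases this with ho | ho
    · obtain ⟨S, hS⟩ := Option.ne_none_iff_exists'.1 (ihP hX ho hb.1)
      simp [(hsp.of_left hS).1]
    · obtain ⟨S, hS⟩ := Option.ne_none_iff_exists'.1 (ihQ hX ho hb.2)
      simp [(hsp.of_right hS).1]
  | @send _ _ Δ Δ₁ Δ₂ v z P T C S' hP hv hz hsp hT hfin ih =>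
    by_cases huv : u = v
    · subst huv; simp [Env.set]
    rw [Env.set_of_ne _ _ huv]
    obtain ⟨S, hS⟩ := Option.ne_none_iff_exists'.1 (ih hX ho hb)
    simp [(hsp.of_left hS).1]
  | @rcv _ _ Δ v y P T C S' hv hT hy hP hfin ih =>
    by_cases huv : u = v
    · subst huv; simp [hv]
    simp only [SProc.bound, List.mem_cons, not_or] at hb
    have huy : u ≠ (y, false) := by rintro rfl; exact hb.1 rfl
    have := ih hX ho hb.2
    rwa [linBind_of_ne _ _ huy, Env.set_of_ne _ _ huv] at this
  | @req _ _ Δ Δ₁ Δ₂ v z P C hv hP hz hsp ih =>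
    obtain ⟨S, hS⟩ := Option.ne_none_iff_exists'.1 (ih hX ho hb)
    simp [(hsp.of_left hS).1]
  | @acc _ _ Δ v y P C hv hy hP ih =>
    simp only [SProc.bound, List.mem_cons, not_or] at hb
    have huy : u ≠ (y, false) := by rintro rfl; exact hb.1 rfl
    have := ih hX ho hb.2
    rwa [linBind_of_ne _ _ huy] at this
  | @resS _ _ Δ s P S' hWF hses h1 h2 hP ih =>
    simp only [SProc.bound, List.mem_cons, not_or] at hb
    have hu1 : u ≠ (s, false) := by rintro rfl; exact hb.1 rfl
    have hu2 : u ≠ (s, true) := by rintro rfl; exact hb.1 rfl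
    have := ih hX ho hb.2
    rwa [Env.set_of_ne _ _ hu2, Env.set_of_ne _ _ hu1] at this
  | @res _ _ Δ s P C hWF h1 h2 hP ih =>
    simp only [SProc.bound, List.mem_cons, not_or] at hb
    exact ih hX ho hb.2

/-- A recursion variable which occurs twice does not need any linear names. -/
theorem STyped.false_of_one_lt_occ {Γ : ShEnv} {Ξ : RecEnv} {Δ : LinEnv} {P : SProc}
    (h : STyped Γ Ξ Δ P) {X : ℕ} {Δ₀ : LinEnv} (hX : Ξ X = some Δ₀) (ho : 1 < P.occ X)
    {u : Name} (hu : Δ₀ u ≠ none) (hb : u.1 ∉ P.bound) : False := by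
  induction h with
  | nil => simp [SProc.occ] at ho
  | wk v h _ _ ih => exact ih hX ho hb
  | unf v T T' hT hv h ih => exact ih hX ho hb
  | @pvar _ Ξ Δ Y h => simp only [SProc.occ] at ho; split_ifs at ho <;> omega
  | @mu _ Ξ Δ Y P h hfn ih =>
    have hXY : X ≠ Y := by rintro rfl; simp [SProc.occ] at ho
    exact ih (by rw [recSet_of_ne hXY, hX]) (by simpa [SProc.occ, hXY] using ho) hb
  | @par _ _ Δ Δ₁ Δ₂ P Q hsp hP hQ ihP ihQ =>
    simp only [SProc.bound, List.mem_append, not_or] at hb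
    simp only [SProc.occ] at ho
    by_cases h1 : 1 < P.occ X
    · exact ihP hX h1 hb.1
    by_cases h2 : 1 < Q.occ X
    · exact ihQ hX h2 hb.2
    obtain ⟨S, hS⟩ := Option.ne_none_iff_exists'.1 (hP.dom_of_occ hX (by omega) hu hb.1)
    exact hQ.dom_of_occ hX (by omega) hu hb.2 (hsp.of_left hS).2
  | send hP hv hz hsp hT hfin ih => exact ih hX ho hb
  | rcv hv hT hy hP hfin ih =>
    simp only [SProc.bound, List.mem_cons, not_or] at hb
    exact ih hX ho hb.2
  | req hv hP hz hsp ih => exact ih hX ho hb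
  | acc hv hy hP ih =>
    simp only [SProc.bound, List.mem_cons, not_or] at hb
    exact ih hX ho hb.2
  | resS hWF hses h1 h2 hP ih =>
    simp only [SProc.bound, List.mem_cons, not_or] at hb
    exact ih hX ho hb.2
  | res hWF h1 h2 hP ih =>
    simp only [SProc.bound, List.mem_cons, not_or] at hb
    exact ih hX ho hb.2

theorem STy.var_mem_suffixes {B : STy} (h : B.body = true) : STy.var ∈ B.suffixes := by
  induction B with
  | act d C S _ ih => exact List.mem_cons_of_mem _ (ih h)
  | var => simp [suffixes]
  | _ => simp [body] at h

theorem STy.Unf.wf {T T' : STy} (h : Unf T T') (hw : T'.WF) : T.WF := by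
  obtain ⟨B, hB, hv, ⟨rfl, rfl⟩ | ⟨rfl, rfl⟩⟩ := h
  · exact ⟨.inr (.inr ⟨B, .var, hB, hv, var_mem_suffixes hB, rfl⟩), ((allPay_subst hB).1 hw.2).1⟩
  · exact ⟨.inr (.inr ⟨B, B, hB, hv, mem_suffixes_self B, rfl⟩),
      (allPay_subst hB).2 ⟨hw.2, hw.2⟩⟩

theorem STy.WF.finite_of_act? {T C S : STy} {d : Dir} (h : T.WF)
    (ha : T.act? = some (d, C, S)) (hS : S.finite = true) :
    T.finite = true ∧ S.prefixLen < T.prefixLen := by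
  have h1 : T.tr = false := by
    rw [Bool.eq_false_iff]
    intro ht
    have := (h.tr_of_act? ht ha).1
    rw [tr_of_finite hS] at this; cases this
  have h2 : T.isSession = true := by
    cases T <;> simp [act?, isSession] at *
  have h3 := h.finite_of_not_tr h2 h1
  exact ⟨h3, by have := (STy.finite_of_act? h3 ha).2.2; omega⟩

/-- A linear name of a finite type that the recursion variable needs cannot be used before: each
use shortens its type. -/
theorem STyped.finite_lt {Γ : ShEnv} {Ξ : RecEnv} {Δ : LinEnv} {P : SProc}
    (h : STyped Γ Ξ Δ P) {X : ℕ} {Δ₀ : LinEnv} (hX : Ξ X = some Δ₀) (ho : P.occ X ≠ 0)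
    {u : Name} {S₀ : STy} (hu : Δ₀ u = some S₀) (hS₀ : S₀.finite = true) (hb : u.1 ∉ P.bound)
    (hΓ : Γ u = none) (hW : ∀ T, Δ u = some T → T.WF) :
    ∃ S, Δ u = some S ∧ S.finite = true ∧ S₀.prefixLen ≤ S.prefixLen ∧
      (u ∈ P.fn → S₀.prefixLen < S.prefixLen) := by
  induction h with
  | nil => simp [SProc.occ] at ho
  | @wk _ _ Δ P v h _ hv ih =>
    by_cases huv : u = v
    · subst huv
      obtain ⟨S, hS, -⟩ := ih hX ho hb hΓ (by simp [hv])
      rw [hv] at hS; cases hS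
    · rw [Env.set_of_ne _ _ huv] at hW ⊢; exact ih hX ho hb hΓ hW
  | @unf _ _ Δ P v T T' hT hv h ih =>
    by_cases huv : u = v
    · subst huv
      obtain ⟨S, hS, hS', -⟩ := ih hX ho hb hΓ fun T₁ h => by
        rw [hv] at h; cases h; exact hT.wf (hW T' (Env.set_self _ _ _))
      rw [hv] at hS; cases hS
      obtain ⟨B, hB, -, ⟨rfl, rfl⟩ | ⟨rfl, rfl⟩⟩ := hT
      · simp [STy.finite] at hS'
      · rw [STy.finite_subst_mu hB] at hS'; cases hS'
    · rw [Env.set_of_ne _ _ huv] at hW ⊢; exact ih hX ho hb hΓ hW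
  | @pvar _ Ξ Δ Y h =>
    have : X = Y := by by_contra hXY; simp [SProc.occ, hXY] at ho
    subst this; rw [h] at hX; cases hX
    exact ⟨S₀, hu, hS₀, le_rfl, by simp [SProc.fn]⟩
  | @mu _ Ξ Δ Y P h hfn ih =>
    have hXY : X ≠ Y := by rintro rfl; simp [SProc.occ] at ho
    exact ih (by rw [recSet_of_ne hXY, hX]) (by simpa [SProc.occ, hXY] using ho) hb hΓ hW
  | @par _ _ Δ Δ₁ Δ₂ P Q hsp hP hQ ihP ihQ =>
    simp only [SProc.bound, List.mem_append, not_or] at hb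
    have : P.occ X ≠ 0 ∨ Q.occ X ≠ 0 := by simp only [SProc.occ] at ho; omega
    rcases this with ho | ho
    · obtain ⟨S, hS, h1, h2, h3⟩ := ihP hX ho hb.1 hΓ fun T hT => hW T (hsp.of_left hT).1
      have h4 := hsp.of_left hS
      refine ⟨S, h4.1, h1, h2, fun hm => ?_⟩
      rcases List.mem_append.1 hm with hm | hm
      · exact h3 hm
      · rcases hQ.dom_of_mem_fn hm with h | h
        · exact absurd hΓ h
        · exact absurd h4.2 h
    · obtain ⟨S, hS, h1, h2, h3⟩ := ihQ hX ho hb.2 hΓ fun T hT => hW T (hsp.of_right hT).1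
      have h4 := hsp.of_right hS
      refine ⟨S, h4.1, h1, h2, fun hm => ?_⟩
      rcases List.mem_append.1 hm with hm | hm
      · rcases hP.dom_of_mem_fn hm with h | h
        · exact absurd hΓ h
        · exact absurd h4.2 h
      · exact h3 hm
  | @send _ _ Δ Δ₁ Δ₂ v z P T C S' hP hv hz hsp hT hfin ih =>
    by_cases huv : u = v
    · subst huv
      -- The remaining type of the subject is shorter by one action.
      rw [Env.set_self] at hW ⊢
      have hWT := hW T rfl
      obtain ⟨S, hS, h1, h2, -⟩ := ih hX ho hb hΓ fun T₁ h => by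
        rw [hv] at h; cases h; exact (hWT.of_act? hT).2
      rw [hv] at hS; cases hS
      have h3 := hWT.finite_of_act? hT h1
      exact ⟨T, rfl, h3.1, by omega, fun _ => by omega⟩
    · rw [Env.set_of_ne _ _ huv] at hW ⊢
      obtain ⟨S, hS, h1, h2, h3⟩ := ih hX ho hb hΓ fun T hT => hW T (hsp.of_left hT).1
      have h4 := hsp.of_left hS
      refine ⟨S, h4.1, h1, h2, fun hm => ?_⟩
      simp only [SProc.fn, List.mem_cons, huv, false_or] at hm
      rcases hm with rfl | hm
      · rcases hz.dom with ⟨D, -, h, -⟩ | ⟨-, h, -⟩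
        · rw [hΓ] at h; cases h
        · rw [h4.2] at h; cases h
      · exact h3 hm
  | @rcv _ _ Δ v y P T C S' hv hT hy hP hfin ih =>
    simp only [SProc.bound, List.mem_cons, not_or] at hb
    have huy : u ≠ (y, false) := by rintro rfl; exact hb.1 rfl
    rw [linBind_of_ne _ _ huy, shBind_of_ne _ _ huy] at ih
    by_cases huv : u = v
    · subst huv
      rw [Env.set_self] at ih
      have hWT := hW T hv
      obtain ⟨S, hS, h1, h2, -⟩ := ih hX ho hb.2 hΓ fun T₁ h => by
        cases h; exact (hWT.of_act? hT).2
      cases hS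
      have h3 := hWT.finite_of_act? hT h1
      exact ⟨T, hv, h3.1, by omega, fun _ => by omega⟩
    · rw [Env.set_of_ne _ _ huv] at ih
      obtain ⟨S, hS, h1, h2, h3⟩ := ih hX ho hb.2 hΓ hW
      refine ⟨S, hS, h1, h2, fun hm => ?_⟩
      simp only [SProc.fn, List.mem_cons, huv, false_or, List.mem_filter] at hm
      exact h3 hm.1
  | @req _ _ Δ Δ₁ Δ₂ v z P C hv hP hz hsp ih =>
    have huv : u ≠ v := by rintro rfl; rw [hΓ] at hv; cases hv
    obtain ⟨S, hS, h1, h2, h3⟩ := ih hX ho hb hΓ fun T hT => hW T (hsp.of_left hT).1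
    have h4 := hsp.of_left hS
    refine ⟨S, h4.1, h1, h2, fun hm => ?_⟩
    simp only [SProc.fn, List.mem_cons, huv, false_or] at hm
    rcases hm with rfl | hm
    · rcases hz.dom with ⟨D, -, h, -⟩ | ⟨-, h, -⟩
      · rw [hΓ] at h; cases h
      · rw [h4.2] at h; cases h
    · exact h3 hm
  | @acc _ _ Δ v y P C hv hy hP ih =>
    have huv : u ≠ v := by rintro rfl; rw [hΓ] at hv; cases hv
    simp only [SProc.bound, List.mem_cons, not_or] at hb
    have huy : u ≠ (y, false) := by rintro rfl; exact hb.1 rfl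
    rw [linBind_of_ne _ _ huy, shBind_of_ne _ _ huy] at ih
    obtain ⟨S, hS, h1, h2, h3⟩ := ih hX ho hb.2 hΓ hW
    refine ⟨S, hS, h1, h2, fun hm => ?_⟩
    simp only [SProc.fn, List.mem_cons, huv, false_or, List.mem_filter] at hm
    exact h3 hm.1
  | @resS _ _ Δ s P S' hWF hses h1 h2 hP ih =>
    simp only [SProc.bound, List.mem_cons, not_or] at hb
    have hu1 : u ≠ (s, false) := by rintro rfl; exact hb.1 rfl
    have hu2 : u ≠ (s, true) := by rintro rfl; exact hb.1 rfl
    rw [Env.set_of_ne _ _ hu2, Env.set_of_ne _ _ hu1, Env.erase_of_ne _ hu2,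
      Env.erase_of_ne _ hu1] at ih
    obtain ⟨S, hS, h1, h2, h3⟩ := ih hX ho hb.2 hΓ hW
    exact ⟨S, hS, h1, h2, fun hm => h3 (List.mem_filter.1 hm).1⟩
  | @res _ _ Δ s P C hWF h1 h2 hP ih =>
    simp only [SProc.bound, List.mem_cons, not_or] at hb
    have hu1 : u ≠ (s, false) := by rintro rfl; exact hb.1 rfl
    have hu2 : u ≠ (s, true) := by rintro rfl; exact hb.1 rfl
    rw [Env.erase_of_ne _ hu2, Env.set_of_ne _ _ hu1] at ih
    obtain ⟨S, hS, h1, h2, h3⟩ := ih hX ho hb.2 hΓ hW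
    exact ⟨S, hS, h1, h2, fun hm => h3 (List.mem_filter.1 hm).1⟩

/-- The names which `Q` may use: its free names, and, in the body of a recursion (`ρ = some (X, M)`
with `M` the free names of the whole body), all names of `M` if the recursion variable `X` occurs
in `Q`. -/
def Live (ρ : Option (ℕ × List Name)) (Q : SProc) (u : Name) : Prop :=
  u ∈ Q.fn ∨ ∃ X M, ρ = some (X, M) ∧ Q.occ X ≠ 0 ∧ u ∈ M

/-- The name `u` can perform an action with direction `d` in the context `E`. -/
def Acts (E : Ctx) (u : Name) (d : Dir) : Prop :=
  (∃ C, (E u).2 = .sh C) ∨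
    ((E u).2.WF ∧ ((E u).2.tr = true → (E u).1 = 1) ∧ ∃ C S, (E u).2.act? = some (d, C, S))

/-- After a linear action of `u`, the continuation `Q` uses `u` exactly if its session is not
over. -/
def SubjLive (ρ : Option (ℕ × List Name)) (E : Ctx) (u : Name) (Q : SProc) : Prop :=
  ∀ d C S, (E u).2.act? = some (d, C, S) → (S = .fin → u ∉ Q.fn) ∧ (S ≠ .fin → Live ρ Q u)

/-- The linearity discipline of a process in an indexed context, in syntax-directed form: it is
what typability in the source calculus contributes to the typing of the breakdown. -/
def Good : Option (ℕ × List Name) → Ctx → SProc → Prop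
  | _, _, .nil => True
  | ρ, E, .out u z Q =>
      Acts E u .out ∧ SubjLive ρ E u Q ∧ STy.G (E z).2 = STy.G (E.payload u) ∧
        ((E z).2.isSession = true → z ≠ u ∧ ¬ Live ρ Q z) ∧ Good ρ (E.next u) Q
  | ρ, E, .inp u y Q =>
      Acts E u .inp ∧ SubjLive ρ E u Q ∧
        ((E.payload u).isSession = true → E.payload u ≠ .fin → Live ρ Q (y, false)) ∧
        Good ρ ((E.next u).bind (y, false) (E.payload u)) Q
  | ρ, E, .par Q R =>
      (∀ v, (E v).2.isSession = true → Live ρ Q v → ¬ Live ρ R v) ∧ Good ρ E Q ∧ Good ρ E R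
  | ρ, E, .res s C Q =>
      C.WF ∧ (C.isSession = true → C ≠ .fin → ∀ b, Live ρ Q (s, b)) ∧
        (C.isSession = false → (s, true) ∉ Q.fn) ∧ Good ρ (E.bindRes s C) Q
  | ρ, _, .pvar X => ∃ M, ρ = some (X, M)
  | ρ, E, .mu X Q =>
      ρ = none ∧
        (Q.occ X ≠ 0 → ∀ v ∈ Q.fn, (E v).2.isSession = true → (E v).2.tr = true) ∧
        (1 < Q.occ X → ∀ v ∈ Q.fn, (E v).2.isSession = false) ∧ Good (some (X, Q.fn)) E Q

/-- The indexed context `E` describes the environments `Γ` and `Δ`, up to the unfolding of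
recursive types. -/
def Match (E : Ctx) (Γ : ShEnv) (Δ : LinEnv) : Prop :=
  (∀ u C, Γ u = some C → E u = (1, .sh C) ∧ (STy.sh C).WF) ∧
    ∀ u S, Δ u = some S → (E u).2.Sim S ∧ (E u).2.WF ∧ (S.isSession = true ∧ S.WF) ∧
      ((E u).2.tr = true → (E u).1 = 1)

section

variable {E : Ctx} {Γ : ShEnv} {Δ Δ' : LinEnv} {u : Name} {d : Dir} {T C S : STy}

theorem Match.mono (h : Match E Γ Δ) (hs : ∀ u S, Δ' u = some S → Δ u = some S) :
    Match E Γ Δ' := ⟨h.1, fun u S hu => h.2 u S (hs u S hu)⟩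

theorem Match.act? (h : Match E Γ Δ) (hu : Δ u = some T) (ha : T.act? = some (d, C, S)) :
    (E u).2.act? = some (d, C, S) := by rw [(h.2 u T hu).1.1, ha]

theorem payload_of_act? (ha : (E u).2.act? = some (d, C, S)) : E.payload u = C := by
  unfold Ctx.payload
  split
  · next h => rw [h] at ha; cases ha
  · rw [ha]

theorem payload_of_sh (ha : (E u).2 = .sh C) : E.payload u = C := by
  unfold Ctx.payload; rw [ha]

theorem next_of_sh (ha : (E u).2 = .sh C) : E.next u = E := by
  unfold Ctx.next; rw [ha]; rfl

theorem next_of_act? (ha : (E u).2.act? = some (d, C, S)) :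
    E.next u = Function.update E u (if (E u).2.tr then (E u).1 else (E u).1 + 1, S) := by
  unfold Ctx.next; rw [ha]

theorem next_of_ne (E : Ctx) {u v : Name} (h : v ≠ u) : E.next u v = E v := by
  unfold Ctx.next
  rcases (E u).2.act? with _ | ⟨d, C, S⟩
  · rfl
  · simp [h]

theorem STy.WF.tr_iff_of_act? (h : T.WF) (ha : T.act? = some (d, C, S)) : S.tr = T.tr := by
  by_cases ht : T.tr = true
  · rw [ht, (h.tr_of_act? ht ha).1]
  · have ht : T.tr = false := by simpa using ht
    have h2 : T.isSession = true := by cases T <;> simp [STy.act?, STy.isSession] at *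
    rw [ht, STy.tr_of_finite (STy.finite_of_act? (h.finite_of_not_tr h2 ht) ha).1]

theorem STy.WF.isSession_of_act? (h : T.WF) (ha : T.act? = some (d, C, S)) :
    S.isSession = true := by
  have h2 : T.isSession = true := by cases T <;> simp [STy.act?, STy.isSession] at *
  by_cases ht : T.tr = true
  · exact STy.isSession_of_tr (h.tr_of_act? ht ha).1
  · have ht : T.tr = false := by simpa using ht
    exact STy.isSession_of_finite (STy.finite_of_act? (h.finite_of_not_tr h2 ht) ha).1

theorem Match.next (h : Match E Γ Δ) (hΓ : Γ u = none) (hu : Δ u = some T)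
    (ha : T.act? = some (d, C, S)) : Match (E.next u) Γ (Δ.set u S) := by
  have ha' := h.act? hu ha
  obtain ⟨h1, h2, h3, h4⟩ := h.2 u T hu
  refine ⟨fun v D hv => ?_, fun v S' hv => ?_⟩
  · have : v ≠ u := by rintro rfl; rw [hΓ] at hv; cases hv
    rw [next_of_ne _ this]; exact h.1 v D hv
  · by_cases huv : v = u
    · subst huv
      rw [Env.set_self] at hv; cases hv
      rw [next_of_act? ha', Function.update_self]
      refine ⟨.refl _, (h2.of_act? ha').2, ⟨h2.isSession_of_act? ha', (h2.of_act? ha').2⟩, fun ht => ?_⟩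
      have := h2.tr_iff_of_act? ha'
      simp only at ht
      rw [this] at ht
      simpa [ht] using h4 ht
    · rw [Env.set_of_ne _ _ huv] at hv
      rw [next_of_ne _ huv]; exact h.2 v S' hv

theorem Match.bind (h : Match E Γ Δ) (y : Name) (hC : C.WF) :
    Match (E.bind y C) (shBind Γ y C) (linBind Δ y C) := by
  refine ⟨fun v D hv => ?_, fun v S' hv => ?_⟩
  · by_cases hvy : v = y
    · subst hvy
      cases C <;> simp [shBind, Env.set, Env.erase] at hv
      subst hv
      exact ⟨by simp [Ctx.bind], hC⟩
    · rw [shBind_of_ne _ _ hvy] at hv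
      simpa [Ctx.bind, hvy] using h.1 v D hv
  · by_cases hvy : v = y
    · subst hvy
      have : C = S' ∧ C.isSession = true := by
        cases C <;> simp [linBind, Env.set, Env.erase, STy.isSession] at hv ⊢ <;> exact hv
      obtain ⟨rfl, hs⟩ := this
      simp only [Ctx.bind, Function.update_self]
      exact ⟨.refl _, hC, ⟨hs, hC⟩, fun _ => trivial⟩
    · rw [linBind_of_ne _ _ hvy] at hv
      simpa [Ctx.bind, hvy] using h.2 v S' hv

theorem Match.acts_of_lin (h : Match E Γ Δ) (hu : Δ u = some T)
    (ha : T.act? = some (d, C, S)) : Acts E u d := by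
  obtain ⟨h1, h2, h3, h4⟩ := h.2 u T hu
  exact .inr ⟨h2, h4, C, S, h.act? hu ha⟩

theorem Match.acts_of_sh (h : Match E Γ Δ) (hu : Γ u = some C) : Acts E u d :=
  .inl ⟨C, by rw [(h.1 u C hu).1]⟩

end

/-- The recursion variable of `ρ` is assigned an environment in `Ξ`, and its parameters are not in
`bs` and are shared or in this environment. -/
def Params (ρ : Option (ℕ × List Name)) (Ξ : RecEnv) (Γ : ShEnv) (bs : List ℕ) : Prop :=
  ∀ X M, ρ = some (X, M) → ∃ Δ₀, Ξ X = some Δ₀ ∧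
    ∀ u ∈ M, u.1 ∉ bs ∧ (Γ u ≠ none ∨ Δ₀ u ≠ none)

theorem Params.mono {ρ : Option (ℕ × List Name)} {Ξ : RecEnv} {Γ Γ' : ShEnv} {bs bs' : List ℕ}
    (h : Params ρ Ξ Γ bs) (hbs : bs' ⊆ bs) (hΓ : ∀ u : Name, u.1 ∉ bs → Γ' u = Γ u) :
    Params ρ Ξ Γ' bs' := fun X M hX => by
  obtain ⟨Δ₀, h1, h2⟩ := h X M hX
  exact ⟨Δ₀, h1, fun u hu => ⟨fun h => (h2 u hu).1 (hbs h), by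
    rw [hΓ u (h2 u hu).1]; exact (h2 u hu).2⟩⟩

/-- A live name is in the domain of the environments. -/
theorem STyped.dom_of_live {Γ : ShEnv} {Ξ : RecEnv} {Δ : LinEnv} {P : SProc}
    {ρ : Option (ℕ × List Name)} (h : STyped Γ Ξ Δ P)
    (hρ : Params ρ Ξ Γ P.bound)
    {u : Name} (hu : Live ρ P u) : Γ u ≠ none ∨ Δ u ≠ none := by
  rcases hu with hu | ⟨X, M, hX, ho, hu⟩
  · exact h.dom_of_mem_fn hu
  · obtain ⟨Δ₀, h1, h2⟩ := hρ X M hX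
    exact (h2 u hu).2.imp_right fun h3 => h.dom_of_occ h1 ho h3 (h2 u hu).1

theorem STyped.live_of_ne_fin {Γ : ShEnv} {Ξ : RecEnv} {Δ : LinEnv} {P : SProc}
    {ρ : Option (ℕ × List Name)} (h : STyped Γ Ξ Δ P)
    (hΞ : ∀ X Δ₀, Ξ X = some Δ₀ → ∃ M, ρ = some (X, M) ∧ ∀ u, Δ₀ u ≠ none → u ∈ M)
    {u : Name} {S : STy} (hu : Δ u = some S) (hS : S ≠ .fin) : Live ρ P u := by
  rcases h.mem_fn_of_ne_fin hu hS with h | ⟨X, Δ₀, h1, h2, h3⟩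
  · exact .inl h
  · obtain ⟨M, h4, h5⟩ := hΞ X Δ₀ h1
    exact .inr ⟨X, M, h4, h2, h5 u h3⟩

theorem STy.dual_ne_fin {S : STy} (h : S ≠ .fin) : S.dual ≠ .fin := mt S.dual_eq_fin.1 h

/-- The object of an output is not used by the continuation if it is linear. -/
theorem SVal.object {Γ : ShEnv} {Ξ : RecEnv} {Δ Δ₁ Δ₂ : LinEnv} {u z : Name} {P : SProc}
    {C : STy} {ρ : Option (ℕ × List Name)} {E : Ctx} (hz : SVal Γ Δ₂ z C)
    (hP : STyped Γ Ξ Δ₁ P) (hsp : Δ.Split Δ₁ Δ₂) (hM : Match E Γ Δ₂)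
    (hdisj : ∀ u, Γ u = none ∨ Δ₂ u = none) (hu : Γ u ≠ none ∨ Δ₁ u ≠ none)
    (hρ : Params ρ Ξ Γ P.bound) :
    STy.G (E z).2 = STy.G C ∧ ((E z).2.isSession = true → z ≠ u ∧ ¬ Live ρ P z) := by
  rcases hz.dom with ⟨D, rfl, h, -⟩ | ⟨hs, h, -⟩
  · rw [(hM.1 z D h).1]
    exact ⟨rfl, fun h => by cases h⟩
  · refine ⟨(hM.2 z C h).1.2.1, fun _ => ?_⟩
    have h1 : Δ₁ z = none := (hsp.of_right h).2
    have h2 : Γ z = none := (hdisj z).resolve_right (by simp [h])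
    exact ⟨by rintro rfl; simp [h1, h2] at hu, fun hl => by
      rcases hP.dom_of_live hρ hl with h | h
      · exact h h2
      · exact h h1⟩

set_option maxHeartbeats 1000000 in
/-- A typed process obeys the linearity discipline. The context `E` follows the actions of the
process, whereas `Δ` is also weakened and unfolded, which `Match` does not see. The clause of `Good`
for a recursion, that its linear parameters are tail-recursive and that there are none if the
variable occurs more than once, rests on `STyped.finite_lt` and `STyped.false_of_one_lt_occ`. -/
theorem STyped.good {Γ : ShEnv} {Ξ : RecEnv} {Δ : LinEnv} {P : SProc} (h : STyped Γ Ξ Δ P)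
    {ρ : Option (ℕ × List Name)} {E : Ctx} (hdisj : ∀ u, Γ u = none ∨ Δ u = none)
    (hM : Match E Γ Δ) (hnd : P.bound.Nodup) (hfr : ∀ u ∈ P.fn, u.1 ∉ P.bound)
    (hΞ : ∀ X Δ₀, Ξ X = some Δ₀ → ∃ M, ρ = some (X, M) ∧ ∀ u, Δ₀ u ≠ none → u ∈ M)
    (hρ : Params ρ Ξ Γ P.bound)
    (hm : (ρ = none ∧ P.NoNested) ∨ (ρ ≠ none ∧ P.NoMu)) : Good ρ E P := by
  induction h generalizing ρ E with
  | nil => trivial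
  | @wk _ _ Δ P v h hv hv' ih =>
    have hs : ∀ u, Δ u ≠ none → (Δ.set v .fin) u = Δ u := fun u hu => by
      rw [Env.set_of_ne]; rintro rfl; exact hu hv'
    refine ih (fun u => ?_) (hM.mono fun u S hu => ?_) hnd hfr hΞ hρ hm
    · refine (hdisj u).imp_right fun h => ?_
      by_contra h'
      rw [hs u h'] at h; exact h' h
    · rw [hs u (by simp [hu]), hu]
  | @unf _ _ Δ P v T T' hT hv h ih =>
    refine ih (fun u => ?_) ⟨hM.1, fun u S hu => ?_⟩ hnd hfr hΞ hρ hm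
    · by_cases huv : u = v
      · subst huv
        refine .inl ((hdisj u).resolve_right ?_)
        simp [Env.set]
      · have := hdisj u
        rwa [Env.set_of_ne _ _ huv] at this
    · by_cases huv : u = v
      · subst huv
        rw [hv] at hu; cases hu
        obtain ⟨h1, h2, h3, h4⟩ := hM.2 u T' (Env.set_self _ _ _)
        exact ⟨h1.trans hT.sim.symm, h2, ⟨by rw [hT.sim.2.2.2.1, h3.1], hT.wf h3.2⟩, h4⟩
      · exact hM.2 u S (by rw [Env.set_of_ne _ _ huv, hu])
  | @pvar _ Ξ Δ X hX =>
    obtain ⟨M, h, -⟩ := hΞ X Δ hX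
    exact ⟨M, h⟩
  | @mu Γ Ξ Δ X P h hfn ih =>
    have hρn : ρ = none ∧ P.NoMu := by
      rcases hm with hm | hm
      · exact hm
      · exact hm.2.elim
    have hfr' : ∀ u ∈ P.fn, u.1 ∉ P.bound := hfr
    have hΞX : (Ξ.set X Δ) X = some Δ := by simp [Env.set]
    have hlin : ∀ v ∈ P.fn, (E v).2.isSession = true → ∃ S, Δ v = some S := by
      intro v hv hs
      rcases h.dom_of_mem_fn hv with h1 | h1
      · obtain ⟨C, hC⟩ := Option.ne_none_iff_exists'.1 h1
        rw [(hM.1 v C hC).1] at hs; cases hs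
      · exact Option.ne_none_iff_exists'.1 h1
    refine ⟨hρn.1, fun ho v hv hs => ?_, fun ho v hv => ?_, ?_⟩
    · obtain ⟨S, hS⟩ := hlin v hv hs
      obtain ⟨h1, h2, h3, h4⟩ := hM.2 v S hS
      by_contra ht
      -- A free name of a finite type would be shorter at the variable than at the start.
      have ht : (E v).2.tr = false := by simpa using ht
      have hf := h2.finite_of_not_tr hs ht
      rw [h1.2.2.2.2] at hf
      have hW : ∀ T, Δ v = some T → T.WF := by
        intro T hT
        rw [hS] at hT; cases hT
        exact h3.2
      obtain ⟨S', h5, -, -, h6⟩ := h.finite_lt hΞX ho hS hf (hfr' v hv)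
        ((hdisj v).resolve_right (by simp [hS])) hW
      rw [hS] at h5; cases h5
      exact absurd (h6 hv) (lt_irrefl _)
    · by_contra hs
      have hs : (E v).2.isSession = true := by simpa using hs
      obtain ⟨S, hS⟩ := hlin v hv hs
      exact h.false_of_one_lt_occ hΞX ho (by simp [hS]) (hfr' v hv)
    · have hΞe : ∀ Y, Ξ Y = none := by
        intro Y
        by_contra hY
        obtain ⟨Δ', hY⟩ := Option.ne_none_iff_exists'.1 hY
        obtain ⟨M, h1, -⟩ := hΞ Y Δ' hY
        rw [hρn.1] at h1; cases h1
      refine ih hdisj hM hnd hfr' ?_ ?_ (.inr ⟨by simp, hρn.2⟩)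
      · intro Y Δ₀ hY
        by_cases hXY : Y = X
        · subst hXY; rw [hΞX] at hY; cases hY
          exact ⟨_, rfl, hfn⟩
        · rw [recSet_of_ne hXY, hΞe] at hY; cases hY
      · rintro Y M hY
        cases hY
        exact ⟨Δ, hΞX, fun u hu => ⟨hfr' u hu, h.dom_of_mem_fn hu⟩⟩
  | @par _ _ Δ Δ₁ Δ₂ P Q hsp hP hQ ihP ihQ =>
    have hnd := List.nodup_append.1 hnd
    have hρ1 : Params ρ _ _ P.bound :=
      hρ.mono (List.subset_append_left _ _) fun _ _ => rfl
    have hρ2 : Params ρ _ _ Q.bound :=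
      hρ.mono (List.subset_append_right _ _) fun _ _ => rfl
    have hd1 : ∀ u, Δ u = none → Δ₁ u = none := fun u hu => by
      by_contra h'
      obtain ⟨S, hS⟩ := Option.ne_none_iff_exists'.1 h'
      rw [(hsp.of_left hS).1] at hu; cases hu
    have hd2 : ∀ u, Δ u = none → Δ₂ u = none := fun u hu => by
      by_contra h'
      obtain ⟨S, hS⟩ := Option.ne_none_iff_exists'.1 h'
      rw [(hsp.of_right hS).1] at hu; cases hu
    refine ⟨fun v hv h1 h2 => ?_, ihP (fun u => (hdisj u).imp_right (hd1 u))
      (hM.mono fun u S hu => (hsp.of_left hu).1) hnd.1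
      (fun u hu h => hfr u (List.mem_append_left _ hu) (List.mem_append_left _ h)) hΞ hρ1
      (hm.imp (And.imp_right And.left) (And.imp_right And.left)),
      ihQ (fun u => (hdisj u).imp_right (hd2 u))
      (hM.mono fun u S hu => (hsp.of_right hu).1) hnd.2.1
      (fun u hu h => hfr u (List.mem_append_right _ hu) (List.mem_append_right _ h)) hΞ hρ2
      (hm.imp (And.imp_right And.right) (And.imp_right And.right))⟩
    rcases hP.dom_of_live hρ1 h1 with h3 | h3
    · obtain ⟨C, hC⟩ := Option.ne_none_iff_exists'.1 h3
      rw [(hM.1 v C hC).1] at hv; cases hv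
    rcases hQ.dom_of_live hρ2 h2 with h4 | h4
    · obtain ⟨C, hC⟩ := Option.ne_none_iff_exists'.1 h4
      rw [(hM.1 v C hC).1] at hv; cases hv
    obtain ⟨S, hS⟩ := Option.ne_none_iff_exists'.1 h3
    exact h4 (hsp.of_left hS).2
  | @send Γ _ Δ Δ₁ Δ₂ v z P T C S hP hv hz hsp hT hfin ih =>
    have hvΓ : Γ v = none := (hdisj v).resolve_right (by simp [Env.set])
    have ha := hM.act? (Env.set_self _ _ _) hT
    have hΔ : ∀ u S', u ≠ v → Δ u = some S' → (Δ.set v T) u = some S' := fun u S' hu h => by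
      rw [Env.set_of_ne _ _ hu, h]
    have hΔ2 : ∀ u S', Δ₂ u = some S' → (Δ.set v T) u = some S' := fun u S' h => by
      refine hΔ u S' ?_ (hsp.of_right h).1
      rintro rfl
      rw [(hsp.of_right h).2] at hv; cases hv
    have hM1 : Match (E.next v) Γ Δ₁ := by
      refine (hM.next hvΓ (Env.set_self _ _ _) hT).mono fun u S' hu => ?_
      by_cases huv : u = v
      · subst huv; rw [hv] at hu; cases hu; simp [Env.set]
      · rw [Env.set_of_ne _ _ huv, hΔ u S' huv (hsp.of_left hu).1]
    have hd1 : ∀ u, Γ u = none ∨ Δ₁ u = none := fun u => by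
      by_cases huv : u = v
      · subst huv; exact .inl hvΓ
      refine (hdisj u).imp_right fun h => ?_
      by_contra h'
      obtain ⟨S', hS⟩ := Option.ne_none_iff_exists'.1 h'
      rw [hΔ u S' huv (hsp.of_left hS).1] at h; cases h
    have hd2 : ∀ u, Γ u = none ∨ Δ₂ u = none := fun u => by
      refine (hdisj u).imp_right fun h => ?_
      by_contra h'
      obtain ⟨S', hS⟩ := Option.ne_none_iff_exists'.1 h'
      rw [hΔ2 u S' hS] at h; cases h
    have hob := hz.object (E := E) hP hsp (hM.mono hΔ2) hd2 (u := v) (.inr (by simp [hv])) hρ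
    refine ⟨hM.acts_of_lin (Env.set_self _ _ _) hT, fun d' C' S' h => ?_, ?_, hob.2,
      ih hd1 hM1 hnd (fun u hu => hfr u (by simp [SProc.fn, hu])) hΞ hρ hm⟩
    · rw [ha] at h; cases h
      exact ⟨hfin, fun hS => hP.live_of_ne_fin hΞ hv hS⟩
    · rw [payload_of_act? ha]; exact hob.1
  | @rcv Γ _ Δ v y P T C S hv hT hy hP hfin ih =>
    have hvΓ : Γ v = none := (hdisj v).resolve_right (by simp [hv])
    have ha := hM.act? hv hT
    have hpay := payload_of_act? ha
    have hC := ((hM.2 v T hv).2.1.of_act? ha).1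
    have hM1 := (hM.next hvΓ hv hT).bind (y, false) hC
    have hnd := List.nodup_cons.1 hnd
    have hvy : v ≠ (y, false) := by rintro rfl; rw [hv] at hy; cases hy
    have hρ' : Params ρ _ (shBind Γ (y, false) C) P.bound :=
      hρ.mono (List.subset_cons_self _ _) fun u hu => shBind_of_ne _ _ fun h => hu (by
        rw [h]; exact List.mem_cons_self)
    have hdis : ∀ u, shBind Γ (y, false) C u = none ∨
        linBind (Δ.set v S) (y, false) C u = none := by
      refine shBind_linBind_disjoint fun u => ?_
      by_cases huv : u = v
      · subst huv; exact .inl hvΓ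
      · rw [Env.set_of_ne _ _ huv]; exact hdisj u
    have hfr' : ∀ u ∈ P.fn, u.1 ∉ P.bound := fun u hu h => by
      by_cases huy : u = (y, false)
      · subst huy; exact hnd.1 h
      · exact hfr u (by simp [SProc.fn, hu, huy]) (List.mem_cons_of_mem _ h)
    refine ⟨hM.acts_of_lin hv hT, fun d' C' S' h => ?_, fun hs hne => ?_, ?_⟩
    · rw [ha] at h; cases h
      refine ⟨hfin, fun hS => hP.live_of_ne_fin hΞ ?_ hS⟩
      rw [linBind_of_ne _ _ hvy, Env.set_self]
    · rw [hpay] at hs hne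
      exact hP.live_of_ne_fin hΞ (linBind_self _ _ hs) hne
    · rw [hpay]
      exact ih hdis hM1 hnd.2 hfr' hΞ hρ' hm
  | @req Γ _ Δ Δ₁ Δ₂ v z P C hv hP hz hsp ih =>
    have hE := (hM.1 v C hv).1
    have hd1 : ∀ u, Γ u = none ∨ Δ₁ u = none := fun u => by
      refine (hdisj u).imp_right fun h => ?_
      by_contra h'
      obtain ⟨S', hS⟩ := Option.ne_none_iff_exists'.1 h'
      rw [(hsp.of_left hS).1] at h; cases h
    have hd2 : ∀ u, Γ u = none ∨ Δ₂ u = none := fun u => by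
      refine (hdisj u).imp_right fun h => ?_
      by_contra h'
      obtain ⟨S', hS⟩ := Option.ne_none_iff_exists'.1 h'
      rw [(hsp.of_right hS).1] at h; cases h
    have hob := hz.object (E := E) hP hsp (hM.mono fun u S h => (hsp.of_right h).1) hd2 (u := v)
      (.inl (by simp [hv])) hρ
    refine ⟨hM.acts_of_sh hv, fun d' C' S' h => ?_, ?_, hob.2, ?_⟩
    · rw [hE] at h; cases h
    · rw [payload_of_sh (C := C) (by rw [hE])]; exact hob.1
    · rw [next_of_sh (C := C) (by rw [hE])]
      exact ih hd1 (hM.mono fun u S h => (hsp.of_left h).1) hnd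
        (fun u hu => hfr u (by simp [SProc.fn, hu])) hΞ hρ hm
  | @acc Γ _ Δ v y P C hv hy hP ih =>
    obtain ⟨hE, hW⟩ := hM.1 v C hv
    have hpay := payload_of_sh (E := E) (u := v) (C := C) (by rw [hE])
    have hC : C.WF := hW.2
    have hM1 := hM.bind (y, false) hC
    have hnd := List.nodup_cons.1 hnd
    have hρ' : Params ρ _ (shBind Γ (y, false) C) P.bound :=
      hρ.mono (List.subset_cons_self _ _) fun u hu => shBind_of_ne _ _ fun h => hu (by
        rw [h]; exact List.mem_cons_self)
    have hfr' : ∀ u ∈ P.fn, u.1 ∉ P.bound := fun u hu h => by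
      by_cases huy : u = (y, false)
      · subst huy; exact hnd.1 h
      · exact hfr u (by simp [SProc.fn, hu, huy]) (List.mem_cons_of_mem _ h)
    refine ⟨hM.acts_of_sh hv, fun d' C' S' h => ?_, fun hs hne => ?_, ?_⟩
    · rw [hE] at h; cases h
    · rw [hpay] at hs hne
      exact hP.live_of_ne_fin hΞ (linBind_self _ _ hs) hne
    · rw [hpay, next_of_sh (C := C) (by rw [hE])]
      exact ih (shBind_linBind_disjoint hdisj) hM1 hnd.2 hfr' hΞ hρ' hm
  | @resS Γ _ Δ s P S hWF hses h1 h2 hP ih =>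
    have hnd := List.nodup_cons.1 hnd
    have hne : ∀ u : Name, u.1 ≠ s → u ≠ (s, false) ∧ u ≠ (s, true) := fun u hu =>
      ⟨by rintro rfl; exact hu rfl, by rintro rfl; exact hu rfl⟩
    have hρ' : Params ρ _ ((Γ.erase (s, false)).erase (s, true)) P.bound :=
      hρ.mono (List.subset_cons_self _ _) fun u hu => by
        have hu : u.1 ≠ s := fun h => hu (by rw [h]; exact List.mem_cons_self)
        rw [Env.erase_of_ne _ (hne u hu).2, Env.erase_of_ne _ (hne u hu).1]
    have hfr' : ∀ u ∈ P.fn, u.1 ∉ P.bound := fun u hu h => by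
      by_cases huy : u.1 = s
      · rw [huy] at h; exact hnd.1 h
      · exact hfr u (by simp [SProc.fn, hu, huy]) (List.mem_cons_of_mem _ h)
    have hb := (hM.bind (s, false) hWF).bind (s, true) hWF.dual
    have e1 : ∀ (Γ' : ShEnv) y (C : STy), C.isSession = true → shBind Γ' y C = Γ'.erase y := by
      intro Γ' y C hC; cases C <;> simp [shBind, STy.isSession] at *
    have e2 : ∀ (Δ' : LinEnv) y (C : STy), C.isSession = true → linBind Δ' y C = Δ'.set y C := by
      intro Γ' y C hC; cases C <;> simp [linBind, STy.isSession] at *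
    have hses' : S.dual.isSession = true := by rw [STy.isSession_dual, hses]
    rw [e1 _ _ _ hses, e1 _ _ _ hses', e2 _ _ _ hses, e2 _ _ _ hses'] at hb
    refine ⟨hWF, fun _ hf b => ?_, fun h => by simp [hses] at h, ?_⟩
    · cases b
      · exact hP.live_of_ne_fin hΞ (S := S) (by simp [Env.set]) hf
      · exact hP.live_of_ne_fin hΞ (S := S.dual) (by simp [Env.set]) (STy.dual_ne_fin hf)
    · refine ih (fun u => ?_) hb hnd.2 hfr' hΞ hρ' hm
      by_cases hu : u.1 = s
      · obtain ⟨a, b⟩ := u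
        cases hu
        cases b <;> simp [Env.erase]
      · rw [Env.erase_of_ne _ (hne u hu).2, Env.erase_of_ne _ (hne u hu).1,
          Env.set_of_ne _ _ (hne u hu).2, Env.set_of_ne _ _ (hne u hu).1]
        exact hdisj u
  | @res Γ _ Δ s P C hWF h1 h2 hP ih =>
    have hnd := List.nodup_cons.1 hnd
    have hne : ∀ u : Name, u.1 ≠ s → u ≠ (s, false) ∧ u ≠ (s, true) := fun u hu =>
      ⟨by rintro rfl; exact hu rfl, by rintro rfl; exact hu rfl⟩
    have hρ' : Params ρ _ ((Γ.set (s, false) C).erase (s, true)) P.bound :=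
      hρ.mono (List.subset_cons_self _ _) fun u hu => by
        have hu : u.1 ≠ s := fun h => hu (by rw [h]; exact List.mem_cons_self)
        rw [Env.erase_of_ne _ (hne u hu).2, Env.set_of_ne _ _ (hne u hu).1]
    have hfr' : ∀ u ∈ P.fn, u.1 ∉ P.bound := fun u hu h => by
      by_cases huy : u.1 = s
      · rw [huy] at h; exact hnd.1 h
      · exact hfr u (by simp [SProc.fn, hu, huy]) (List.mem_cons_of_mem _ h)
    have hM1 : Match (E.bindRes s (.sh C)) ((Γ.set (s, false) C).erase (s, true)) Δ := by
      refine ⟨fun u D hu => ?_, fun u S hu => ?_⟩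
      · by_cases hu2 : u = (s, true)
        · subst hu2; rw [Env.erase_self] at hu; cases hu
        rw [Env.erase_of_ne _ hu2] at hu
        by_cases hu1 : u = (s, false)
        · subst hu1; rw [Env.set_self] at hu; cases hu
          exact ⟨by simp [Ctx.bindRes, Ctx.bind], hWF⟩
        · rw [Env.set_of_ne _ _ hu1] at hu
          simpa [Ctx.bindRes, Ctx.bind, hu1, hu2] using hM.1 u D hu
      · have hu1 : u ≠ (s, false) := by rintro rfl; rw [h1] at hu; cases hu
        have hu2 : u ≠ (s, true) := by rintro rfl; rw [h2] at hu; cases hu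
        simpa [Ctx.bindRes, Ctx.bind, hu1, hu2] using hM.2 u S hu
    refine ⟨hWF, (fun h => by cases h), fun _ hmem => ?_, ?_⟩
    · rcases hP.dom_of_mem_fn hmem with h | h
      · exact h (Env.erase_self _ _)
      · exact h h2
    · refine ih (fun u => ?_) hM1 hnd.2 hfr' hΞ hρ' hm
      by_cases hu : u.1 = s
      · obtain ⟨a, b⟩ := u
        cases hu
        cases b
        · exact .inr h1
        · exact .inr h2
      · rw [Env.erase_of_ne _ (hne u hu).2, Env.set_of_ne _ _ (hne u hu).1]
        exact hdisj u

/-! ### Types of the components and of the propagators -/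

/-- The use of the propagators with a given index: `c_k` carries objects once, or `c^r_k` carries
objects repeatedly, as a linear or as a shared name. -/
inductive Kind
  | once (ps : List MTy)
  | lin (ps : List MTy)
  | shr (ps : List MTy)

/-- The kind of a propagator `c^r_k`. -/
def Kind.ofMode (lin : Bool) (ps : List MTy) : Kind := if lin then .lin ps else .shr ps

/-- The payload of the name `c^r_k`, if it is shared. -/
def Kind.shOf : Kind → Option (List MTy)
  | .shr ps => some ps
  | _ => none

/-- The direction in which an endpoint of a propagator is used. -/
def dirOf (b : Bool) : Dir := if b then .out else .inp

/-- The type of a component of a source name in the context `E`. -/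
def cty (E : Ctx) : TName → MTy
  | (.idx a j, b) => ((STy.G (E (a, b)).2)[j - (E (a, b)).1]?).getD .fin
  | _ => .fin

/-- The types of all names of a breakdown, given the context `E` and the kinds `π` of the
propagators. Unused propagators have type `end`. -/
def ty (E : Ctx) (π : ℕ → Kind) : TName → MTy
  | (.prop j, b) => match π j with
    | .once ps => .once (dirOf b) ps
    | _ => .fin
  | (.rprop j, b) => match π j with
    | .once _ => .fin
    | .lin ps => .loop (dirOf b) ps
    | .shr ps => .sh ps
  | x => cty E x

/-- The index of a propagator. -/
def pidx : TName → Option ℕ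
  | (.prop j, _) => some j
  | (.rprop j, _) => some j
  | _ => none

theorem ty_of_base {E : Ctx} {π : ℕ → Kind} {x : TName} (h : base x ≠ none) :
    ty E π x = cty E x := by
  obtain ⟨_ | _ | _ | _, b⟩ := x <;> simp [base, ty] at *

theorem ty_congr {E E' : Ctx} {π π' : ℕ → Kind} {x : TName} (h : base x = none)
    (hp : ∀ j, pidx x = some j → π j = π' j) : ty E π x = ty E' π' x := by
  obtain ⟨_ | j | j | _, b⟩ := x
  · simp [base] at h
  · simp [ty, hp j rfl]
  · simp [ty, hp j rfl]
  · simp [ty, cty]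

theorem lenv_ty_congr {E E' : Ctx} {π π' : ℕ → Kind} {L : Set TName}
    (h : ∀ x ∈ L, base x = none) (hp : ∀ x ∈ L, ∀ j, pidx x = some j → π j = π' j) :
    lenv (ty E π) L = lenv (ty E' π') L :=
  lenv_congr (fun _ _ => Iff.rfl) fun x hx => by
    have hx : x ∈ L := by simpa using hx
    exact ty_congr (h x hx) (hp x hx)

theorem map_ty {E : Ctx} {π : ℕ → Kind} {xs : List TName} (h : ∀ x ∈ xs, base x ≠ none) :
    xs.map (ty E π) = xs.map (cty E) :=
  List.map_congr_left fun x hx => ty_of_base (h x hx)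

/-- The shared environment `Γ` assigns to the propagators with index in `[k, k + n)` what `π`
says. -/
def PropsOK (Γ : TShEnv) (π : ℕ → Kind) (k n : ℕ) : Prop :=
  ∀ j, k ≤ j → j < k + n → (∀ b, Γ (.prop j, b) = none) ∧ Γ (.rprop j, true) = none ∧
    Γ (.rprop j, false) = (π j).shOf

/-- `Γ'` is `Γ` except for components of source names. -/
def SameProps (Γ Γ' : TShEnv) : Prop := ∀ x, base x = none → Γ' x = Γ x

theorem PropsOK.same {Γ Γ' : TShEnv} {π : ℕ → Kind} {k n : ℕ} (h : PropsOK Γ π k n)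
    (hs : SameProps Γ Γ') : PropsOK Γ' π k n := fun j h1 h2 => by
  rw [hs _ rfl, hs _ rfl]
  refine ⟨fun b => ?_, (h j h1 h2).2⟩
  rw [hs _ rfl]; exact (h j h1 h2).1 b

theorem PropsOK.sub {Γ : TShEnv} {π π' : ℕ → Kind} {k n k' n' : ℕ} (h : PropsOK Γ π k n)
    (hk : k ≤ k') (hn : k' + n' ≤ k + n) (hp : ∀ j, k' ≤ j → j < k' + n' → π j = π' j) :
    PropsOK Γ π' k' n' := fun j h1 h2 => by
  rw [← hp j h1 h2]; exact h j (hk.trans h1) (h2.trans_le hn)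

theorem PropsOK.rprop {Γ : TShEnv} {π : ℕ → Kind} {k n j : ℕ} (h : PropsOK Γ π k n)
    (h1 : k ≤ j) (h2 : j < k + n) : Γ (.rprop j, false) = (π j).shOf := (h j h1 h2).2.2

theorem sameProps_bind {Γ Γ' : TShEnv} {τ : TName → MTy} {xs : List TName}
    (hxs : ∀ x ∈ xs, base x ≠ none)
    (h : ∀ x, Γ' x = if x ∈ xs then (τ x).shOf else Γ x) : SameProps Γ Γ' := fun x hx => by
  rw [h x, if_neg fun h => hxs x h hx]

/-- The propagators with index in `[k, k + n)`. -/
def propsIn (k n : ℕ) : Set TName := {x | ∃ j, pidx x = some j ∧ k ≤ j ∧ j < k + n}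

theorem base_of_mem_propsIn {k n : ℕ} {x : TName} (h : x ∈ propsIn k n) : base x = none := by
  obtain ⟨j, hj, -⟩ := h
  obtain ⟨_ | _ | _ | _, b⟩ := x <;> simp [base, pidx] at *

/-! ### Breakdowns of names -/

theorem mem_names {E : Ctx} {u : Name} {x : TName} :
    x ∈ E.names u ↔ ∃ j < (STy.G (E u).2).length, x = nm u ((E u).1 + j) := by
  simp [Ctx.names, eq_comm]

theorem base_of_mem_names {E : Ctx} {u : Name} {x : TName} (h : x ∈ E.names u) :
    base x = some u := by
  obtain ⟨j, -, rfl⟩ := mem_names.1 h; rfl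

theorem nodup_names (E : Ctx) (u : Name) : (E.names u).Nodup := by
  refine List.Nodup.map (fun i j h => ?_) List.nodup_range
  simpa [nm] using h

theorem cty_nm (E : Ctx) (u : Name) (j : ℕ) :
    cty E (nm u ((E u).1 + j)) = ((STy.G (E u).2)[j]?).getD .fin := by
  simp [cty, nm]

theorem map_cty_names (E : Ctx) (u : Name) : (E.names u).map (cty E) = STy.G (E u).2 := by
  refine List.ext_getElem? fun i => ?_
  simp only [Ctx.names, List.map_map, List.getElem?_map]
  by_cases hi : i < (STy.G (E u).2).length
  · simp [hi, cty_nm]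
  · simp [hi]

theorem names_congr {E E' : Ctx} {u : Name} (h1 : (E u).1 = (E' u).1)
    (h2 : STy.G (E u).2 = STy.G (E' u).2) : E.names u = E'.names u := by
  simp [Ctx.names, h1, h2]

theorem cty_congr {E E' : Ctx} {u : Name} {x : TName} (h1 : (E u).1 = (E' u).1)
    (h2 : STy.G (E u).2 = STy.G (E' u).2) (hx : base x = some u) : cty E x = cty E' x := by
  obtain ⟨_ | _ | _ | _, b⟩ := x <;> simp only [base, Option.some.injEq, reduceCtorEq] at hx
  subst hx
  simp [cty, h1, h2]

/-- The components of a shared name are shared, so a name with a linear component is linear. -/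
theorem isSession_of_cty {E : Ctx} {u : Name} {x : TName} (hx : x ∈ E.names u)
    (hs : (cty E x).isSession = true) : (E u).2.isSession = true := by
  obtain ⟨j, hj, rfl⟩ := mem_names.1 hx
  rw [cty_nm] at hs
  cases h : (E u).2 with
  | sh C =>
    rw [h] at hj hs
    simp [STy.G] at hj
    subst hj
    simp [STy.G, MTy.isSession] at hs
  | _ => simp [STy.isSession]

/-- The type `end` or a shared type: a name of such a type need not be used. -/
def Drop (T : STy) : Prop := T = .fin ∨ ∃ C, T = .sh C

theorem cty_of_drop {E : Ctx} {u : Name} {x : TName} (hx : x ∈ E.names u) (h : Drop (E u).2)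
    (hs : (cty E x).isSession = true) : cty E x = .fin := by
  rcases h with h | ⟨C, h⟩
  · obtain ⟨j, hj, rfl⟩ := mem_names.1 hx
    rw [h] at hj
    simp [STy.G] at hj
    subst hj
    rw [cty_nm, h]; simp [STy.G]
  · have := isSession_of_cty hx hs
    rw [h] at this; cases this

theorem isSession_iff {T : STy} : T.isSession = true ↔ ¬ ∃ C, T = .sh C := by
  cases T <;> simp [STy.isSession]

/-- `xs` lists the components of the names in `U`. -/
def Comp (E : Ctx) (U : Set Name) (xs : List TName) : Prop :=
  xs.Nodup ∧ ∀ x, x ∈ xs ↔ ∃ u ∈ U, x ∈ E.names u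

theorem Comp.base_ne {E : Ctx} {U : Set Name} {xs : List TName} (h : Comp E U xs) :
    ∀ x ∈ xs, base x ≠ none := fun x hx => by
  obtain ⟨u, -, hu⟩ := (h.2 x).1 hx
  simp [base_of_mem_names hu]

theorem Comp.mem {E : Ctx} {U : Set Name} {xs : List TName} (h : Comp E U xs) {x : TName}
    {u : Name} (hb : base x = some u) : x ∈ xs ↔ u ∈ U ∧ x ∈ E.names u := by
  rw [h.2]
  constructor
  · rintro ⟨v, hv, hx⟩
    have := base_of_mem_names hx
    rw [hb] at this; cases this
    exact ⟨hv, hx⟩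
  · rintro ⟨hv, hx⟩; exact ⟨u, hv, hx⟩

theorem Comp.flatMap {E : Ctx} {us : List Name} (h : us.Nodup) :
    Comp E {u | u ∈ us} (us.flatMap E.names) := by
  refine ⟨?_, fun x => by simp⟩
  rw [List.nodup_flatMap]
  refine ⟨fun u _ => nodup_names E u, h.imp fun {a b} hab x hx hx' => hab ?_⟩
  have h1 := base_of_mem_names hx
  rw [base_of_mem_names hx'] at h1
  simpa using h1.symm

/-! ### Actions of a name -/

/-- The next action of `u` is its last one. -/
def Last (E : Ctx) (u : Name) : Prop := ∃ d C, (E u).2.act? = some (d, C, .fin)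

section step

variable {E : Ctx} {u v : Name} {d : Dir} {x : TName}

theorem names_next_of_ne (h : v ≠ u) : (E.next u).names v = E.names v := by
  simp [Ctx.names, next_of_ne E h]

theorem cty_next_of_ne (h : base x ≠ some u) : cty (E.next u) x = cty E x := by
  obtain ⟨_ | _ | _ | _, b⟩ := x
  · simp only [base, ne_eq, Option.some.injEq] at h
    simp [cty, next_of_ne E h]
  all_goals rfl

theorem mem_used : x ∈ E.used u ↔
    x = nm u (E u).1 ∧ (E u).2.isSession = true ∧ (E u).2.tr = false := by
  unfold Ctx.used
  cases (E u).2.isSession <;> cases (E u).2.tr <;> simp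

theorem Acts.cases (h : Acts E u d) :
    (∃ C, (E u).2 = .sh C) ∨
    (∃ C S, (E u).2.act? = some (d, C, S) ∧ (E u).2.tr = true ∧ S.tr = true ∧ (E u).1 = 1 ∧
      STy.G S = STy.G (E u).2 ∧ 0 < (E u).2.f ∧
      (STy.G (E u).2)[(E u).2.f - 1]? = some (.loop d (STy.G C))) ∨
    ∃ C S, (E u).2.act? = some (d, C, S) ∧ (E u).2.tr = false ∧ (E u).2.isSession = true ∧
      STy.G (E u).2 = .once d (STy.G C) :: (if S = .fin then [] else STy.G S) := by
  rcases h with h | ⟨h1, h2, C, S, h3⟩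
  · exact .inl h
  · have hs : (E u).2.isSession = true := by
      cases hE : (E u).2 <;> simp [hE, STy.act?, STy.isSession] at *
    by_cases ht : (E u).2.tr = true
    · obtain ⟨h4, h5, h6, h7⟩ := h1.tr_of_act? ht h3
      exact .inr (.inl ⟨C, S, h3, ht, h4, h2 ht, h5, h6, h7⟩)
    · have ht : (E u).2.tr = false := by simpa using ht
      exact .inr (.inr ⟨C, S, h3, ht, hs,
        (STy.finite_of_act? (h1.finite_of_not_tr hs ht) h3).2.1⟩)

theorem Acts.subj_mem (h : Acts E u d) : E.subj u ∈ E.names u := by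
  rw [mem_names]
  rcases h.cases with ⟨C, h⟩ | ⟨C, S, h1, h2, h3, h4, h5, h6, h7⟩ | ⟨C, S, h1, h2, h3, h4⟩
  · exact ⟨0, by simp [h, STy.G], by simp [Ctx.subj, h, STy.tr]⟩
  · refine ⟨(E u).2.f - 1, ?_, ?_⟩
    · exact (List.getElem?_eq_some_iff.1 h7).1
    · simp only [Ctx.subj, h2, h4, if_true]
      congr 1; omega
  · exact ⟨0, by simp [h4], by simp [Ctx.subj, h2]⟩

theorem Acts.used_mem (h : Acts E u d) (hx : x ∈ E.used u) : x ∈ E.names u := by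
  obtain ⟨rfl, h1, h2⟩ := mem_used.1 hx
  have := h.subj_mem
  simpa [Ctx.subj, h2] using this

theorem Acts.names_of_last (h : Acts E u d) (hl : Last E u) (hx : x ∈ E.names u) :
    x ∈ E.used u := by
  obtain ⟨d', C', hl⟩ := hl
  rcases h.cases with ⟨C, h⟩ | ⟨C, S, h1, h2, h3, h4, h5, h6, h7⟩ | ⟨C, S, h1, h2, h3, h4⟩
  · rw [h] at hl; cases hl
  · rw [h1] at hl; cases hl; simp [STy.tr] at h3
  · rw [h1] at hl; cases hl
    obtain ⟨j, hj, rfl⟩ := mem_names.1 hx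
    rw [h4] at hj
    simp at hj
    subst hj
    exact mem_used.2 ⟨rfl, h3, h2⟩

/-- If the session of `u` goes on, the components of the continuation are those which are not used
up. -/
theorem Acts.mem_names_next (h : Acts E u d) (hl : ¬ Last E u) :
    x ∈ (E.next u).names u ↔ x ∈ E.names u ∧ x ∉ E.used u := by
  rcases h.cases with ⟨C, h⟩ | ⟨C, S, h1, h2, h3, h4, h5, h6, h7⟩ | ⟨C, S, h1, h2, h3, h4⟩
  · rw [next_of_sh h, mem_used]; simp [h, STy.isSession]
  · rw [names_congr (E := E.next u) (E' := E) (u := u), mem_used]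
    · simp [h2]
    · simp [next_of_act? h1, h2]
    · simp [next_of_act? h1, h5]
  · have hS : S ≠ .fin := by rintro rfl; exact hl ⟨d, C, h1⟩
    rw [if_neg hS] at h4
    rw [mem_names, mem_names, mem_used]
    simp only [next_of_act? h1, Function.update_self, h2, h3, h4, List.length_cons]
    constructor
    · rintro ⟨j, hj, rfl⟩
      refine ⟨⟨j + 1, by omega, ?_⟩, ?_⟩
      · simp [nm]; omega
      · simp [nm]; omega
    · rintro ⟨⟨j, hj, rfl⟩, hne⟩
      rcases j with _ | j
      · simp at hne
      · exact ⟨j, by omega, by simp [nm]; omega⟩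

theorem Acts.cty_next (h : Acts E u d) (hx : x ∈ (E.next u).names u) (hl : ¬ Last E u) :
    cty (E.next u) x = cty E x := by
  rcases h.cases with ⟨C, h⟩ | ⟨C, S, h1, h2, h3, h4, h5, h6, h7⟩ | ⟨C, S, h1, h2, h3, h4⟩
  · rw [next_of_sh h]
  · refine cty_congr (u := u) ?_ ?_ (base_of_mem_names hx)
    · simp [next_of_act? h1, h2]
    · simp [next_of_act? h1, h5]
  · have hS : S ≠ .fin := by rintro rfl; exact hl ⟨d, C, h1⟩
    obtain ⟨j, hj, rfl⟩ := mem_names.1 hx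
    rw [cty_nm]
    have e : nm u ((E.next u u).1 + j) = nm u ((E u).1 + (j + 1)) := by
      simp [next_of_act? h1, h2, nm]; omega
    rw [e, cty_nm, h4, if_neg hS]
    simp [next_of_act? h1]

/-- The subject of an action has the type which is needed for this action. -/
theorem Acts.use (h : Acts E u d) {Γ : TShEnv} {π : ℕ → Kind} {A : Set TName}
    (hΓ : Γ (E.subj u) = (cty E (E.subj u)).shOf) (hA : ∀ x ∈ E.used u, x ∉ A)
    (hl : (E u).2.tr = true → E.subj u ∈ A) {τ : TName → MTy}
    (hτ : τ (E.subj u) = ty E π (E.subj u)) :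
    Use Γ τ (E.subj u) d (STy.G (E.payload u)) A {x | x ∈ E.used u} := by
  have hb : base (E.subj u) ≠ none := by simp [Ctx.subj, base, nm]
  unfold Use
  rw [hτ, ty_of_base hb]
  rcases h.cases with ⟨C, h⟩ | ⟨C, S, h1, h2, h3, h4, h5, h6, h7⟩ | ⟨C, S, h1, h2, h3, h4⟩
  · right; right
    refine ⟨?_, ?_⟩
    · rw [hΓ, payload_of_sh h]
      have : E.subj u = nm u ((E u).1 + 0) := by simp [Ctx.subj, h, STy.tr]
      rw [this, cty_nm, h]
      simp [STy.G, MTy.shOf]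
    · ext x; simp [mem_used, h, STy.isSession]
  · right; left
    refine ⟨?_, hl h2, ?_⟩
    · have : E.subj u = nm u ((E u).1 + ((E u).2.f - 1)) := by
        simp only [Ctx.subj, h2, h4, if_true]; congr 1; omega
      rw [this, cty_nm, h7, payload_of_act? h1]; rfl
    · ext x; simp [mem_used, h2]
  · left
    have e : E.subj u = nm u ((E u).1 + 0) := by simp [Ctx.subj, h2]
    have hc : cty E (E.subj u) = .once d (STy.G C) := by rw [e, cty_nm, h4]; rfl
    have hu : E.subj u ∈ E.used u := mem_used.2 ⟨e, h3, h2⟩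
    refine ⟨by rw [hc, payload_of_act? h1], by rw [hΓ, hc]; rfl, hA _ hu, ?_⟩
    ext x
    simp [mem_used, h2, h3, e]

end step

theorem TTyped.weaken_list {Γ : TShEnv} {Ξ : TRecEnv} {τ : TName → MTy} {A L : Set TName}
    {P : TProc} (h : TTyped Γ Ξ (lenv τ A) P) (hAL : ∀ x ∈ A, (τ x).isSession = true → x ∈ L)
    (ws : List TName) (hws : ∀ x ∈ L, x ∉ A → (τ x).isSession = true → x ∈ ws)
    (hw : ∀ x ∈ L, x ∉ A → (τ x).isSession = true → τ x = .fin ∧ Γ x = none) :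
    TTyped Γ Ξ (lenv τ L) P :=
  h.weaken hAL ((ws.toFinset.finite_toSet).subset fun x hx => by
    simpa using hws x hx.1 hx.2.1 hx.2.2) hw

/-! ### Typing of the actions of a trio -/

theorem base_ne_none_of_mem_names {E : Ctx} {u : Name} {x : TName} (h : x ∈ E.names u) :
    base x ≠ none := by simp [base_of_mem_names h]

theorem eq_of_mem_names {E E' : Ctx} {u v : Name} {x : TName} (h : x ∈ E.names u)
    (h' : x ∈ E'.names v) : u = v := by
  have := base_of_mem_names h
  rw [base_of_mem_names h'] at this
  simpa using this.symm

theorem SubjLive.live {ρ : Option (ℕ × List Name)} {E : Ctx} {u : Name} {Q : SProc} {d : Dir}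
    (h : SubjLive ρ E u Q) (ha : Acts E u d) (hl : ¬ Last E u) (hs : (E u).2.isSession = true) :
    Live ρ Q u := by
  rcases ha with ⟨C, hC⟩ | ⟨-, -, C, S, hS⟩
  · rw [hC] at hs; cases hs
  · exact (h _ _ _ hS).2 (by rintro rfl; exact hl ⟨_, _, hS⟩)

theorem Acts.not_last_of_tr {E : Ctx} {u : Name} {d : Dir} (ha : Acts E u d)
    (ht : (E u).2.tr = true) : ¬ Last E u := by
  rintro ⟨d', C', hl⟩
  rcases ha.cases with ⟨C, h⟩ | ⟨C, S, h1, h2, h3, -⟩ | ⟨C, S, h1, h2, -⟩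
  · rw [h] at hl; cases hl
  · rw [h1] at hl; cases hl; simp [STy.tr] at h3
  · rw [ht] at h2; cases h2

theorem Acts.used_of_tr {E : Ctx} {u : Name} (ht : (E u).2.tr = true) (x : TName) :
    x ∉ E.used u := fun h => by
  have := (mem_used.1 h).2.2
  rw [ht] at this; cases this

/-- The components which are passed on after an action of `u` are components before the action,
and they are not used up by it. -/
theorem Comp.of_next {ρ : Option (ℕ × List Name)} {E : Ctx} {u : Name} {Q : SProc} {d : Dir}
    {U V : Set Name} {ys : List TName} (hact : Acts E u d) (hlast : Last E u → ¬ Live ρ Q u)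
    (hys : Comp (E.next u) V ys) (hV : ∀ v, v ∈ V ↔ v ∈ U ∧ Live ρ Q v) {x : TName}
    (hx : x ∈ ys) : (∃ v ∈ U, x ∈ E.names v ∧ Live ρ Q v) ∧ x ∉ E.used u ∧
      cty (E.next u) x = cty E x := by
  obtain ⟨v, hv, hxv⟩ := (hys.2 x).1 hx
  obtain ⟨h1, h2⟩ := (hV v).1 hv
  by_cases hvu : v = u
  · subst hvu
    have hl : ¬ Last E v := fun h => hlast h h2
    have h3 := (hact.mem_names_next hl).1 hxv
    exact ⟨⟨v, h1, h3.1, h2⟩, h3.2, hact.cty_next hxv hl⟩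
  · have hxv' := hxv
    rw [names_next_of_ne hvu] at hxv
    refine ⟨⟨v, h1, hxv, h2⟩, fun h => ?_, cty_next_of_ne ?_⟩
    · exact hvu (eq_of_mem_names hxv (hact.used_mem h))
    · rw [base_of_mem_names hxv]; simpa using hvu

/-- A component which is available before an action of `u` is used up, passed on, or not live
afterwards. -/
theorem Comp.mem_next {ρ : Option (ℕ × List Name)} {E : Ctx} {u v : Name} {Q : SProc} {d : Dir}
    {U V : Set Name} {ys : List TName} (hact : Acts E u d) (hsub : SubjLive ρ E u Q)
    (hys : Comp (E.next u) V ys) (hV : ∀ v, v ∈ V ↔ v ∈ U ∧ Live ρ Q v) {x : TName}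
    (hv : v ∈ U) (hx : x ∈ E.names v) (hs : (E v).2.isSession = true) :
    x ∈ E.used u ∨ x ∈ ys ∨ (v ≠ u ∧ ¬ Live ρ Q v) := by
  by_cases hvu : v = u
  · subst hvu
    by_cases hl : Last E v
    · exact .inl (hact.names_of_last hl hx)
    · by_cases hxu : x ∈ E.used v
      · exact .inl hxu
      · exact .inr (.inl ((hys.2 x).2 ⟨v, (hV v).2 ⟨hv, hsub.live hact hl hs⟩,
          (hact.mem_names_next hl).2 ⟨hx, hxu⟩⟩))
  · by_cases hlv : Live ρ Q v
    · exact .inr (.inl ((hys.2 x).2 ⟨v, (hV v).2 ⟨hv, hlv⟩, by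
        rwa [names_next_of_ne hvu]⟩))
    · exact .inr (.inr ⟨hvu, hlv⟩)

theorem Acts.subj_mem_next {ρ : Option (ℕ × List Name)} {E : Ctx} {u : Name} {Q : SProc} {d : Dir}
    {U V : Set Name} {ys : List TName} (hact : Acts E u d) (hsub : SubjLive ρ E u Q)
    (hys : Comp (E.next u) V ys) (hV : ∀ v, v ∈ V ↔ v ∈ U ∧ Live ρ Q v) (hu : u ∈ U)
    (ht : (E u).2.tr = true) : E.subj u ∈ ys := by
  have hl := hact.not_last_of_tr ht
  exact (hys.2 _).2 ⟨u, (hV u).2 ⟨hu, hsub.live hact hl (STy.isSession_of_tr ht)⟩,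
    (hact.mem_names_next hl).2 ⟨hact.subj_mem, Acts.used_of_tr ht _⟩⟩

/-- An output of a trio. The tail `T` of the trio holds the components in `ys`, of the live names of
`Q`, and the names in `K`. The components in `xs` that are neither used nor passed on have type
`end` or are shared, and are weakened. -/
theorem typed_output {ρ : Option (ℕ × List Name)} {E : Ctx} {u z : Name} {Q : SProc}
    {U V : Set Name} {xs ys : List TName} {K : Set TName} {Γ : TShEnv} {Ξ : TRecEnv}
    {π : ℕ → Kind} {T : TProc}
    (hact : Acts E u .out) (hsub : SubjLive ρ E u Q) (hlast : Last E u → ¬ Live ρ Q u)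
    (hz : STy.G (E z).2 = STy.G (E.payload u))
    (hzl : (E z).2.isSession = true → z ≠ u ∧ ¬ Live ρ Q z)
    (hU : ∀ v ∈ U, ¬ Live ρ (.out u z Q) v → Drop (E v).2)
    (htr : (E u).2.tr = true → u ∈ U) (hxs : Comp E U xs) (hys : Comp (E.next u) V ys)
    (hV : ∀ v, v ∈ V ↔ v ∈ U ∧ Live ρ Q v) (hK : ∀ x ∈ K, base x = none)
    (hΓ : ∀ v, v ∈ U ∨ v = u ∨ v = z → ∀ x ∈ E.names v, Γ x = (cty E x).shOf)
    (hT : TTyped Γ Ξ (lenv (ty E π) ({x | x ∈ ys} ∪ K)) T) :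
    TTyped Γ Ξ (lenv (ty E π) {x | x ∈ xs ∨ x ∈ E.names z ∨ x ∈ E.used u ∨ x ∈ K})
      (.out (E.subj u) (E.names z) T) := by
  have hK' : ∀ {v x}, x ∈ E.names v → x ∉ K := fun hx hxK =>
    base_ne_none_of_mem_names hx (hK _ hxK)
  have hty : ∀ {v x}, x ∈ E.names v → ty E π x = cty E x := fun hx =>
    ty_of_base (base_ne_none_of_mem_names hx)
  have hmap : (E.names z).map (ty E π) = STy.G (E.payload u) := by
    rw [map_ty fun x => base_ne_none_of_mem_names, map_cty_names, hz]
  have hof := fun x => Comp.of_next (x := x) hact hlast hys hV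
  refine TTyped.weaken_list (A := {x | x ∈ E.used u ∨ (x ∈ ys ∨ x ∈ K) ∨ x ∈ E.names z})
    (TTyped.send_use (W := {x | x ∈ E.used u}) hT ?_ (nodup_names E z) ?_ ?_ ?_) ?_ xs ?_ ?_
  · rw [hmap]
    refine hact.use (hΓ u (.inr (.inl rfl)) _ hact.subj_mem) ?_ ?_ rfl
    · rintro x hx (h | h)
      · exact (hof x h).2.1 hx
      · exact hK' (hact.used_mem hx) h
    · exact fun ht => .inl (hact.subj_mem_next hsub hys hV (htr ht) ht)
  · intro x hx
    rw [hΓ z (.inr (.inr rfl)) x hx, hty hx]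
  · intro x hx hs
    rw [hty hx] at hs
    obtain ⟨h1, h2⟩ := hzl (isSession_of_cty hx hs)
    refine ⟨?_, fun h => h1 (eq_of_mem_names hx (hact.used_mem h))⟩
    rintro (h | h)
    · obtain ⟨⟨v, -, hv, hlv⟩, -⟩ := hof x h
      rw [eq_of_mem_names hx hv] at h2
      exact h2 hlv
    · exact hK' hx h
  · intro x _; rfl
  · rintro x (h | (h | h) | h) -
    · exact .inr (.inr (.inl h))
    · obtain ⟨⟨v, hv, hx, -⟩, -⟩ := hof x h
      exact .inl ((hxs.2 x).2 ⟨v, hv, hx⟩)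
    · exact .inr (.inr (.inr h))
    · exact .inr (.inl h)
  · rintro x (h | h | h | h) hA -
    · exact h
    · exact absurd (.inr (.inr h)) hA
    · exact absurd (.inl h) hA
    · exact absurd (.inr (.inl (.inr h))) hA
  -- What is left of `xs` belongs to names which the continuation does not use.
  · rintro x (h | h | h | h) hA hs
    · obtain ⟨v, hv, hx⟩ := (hxs.2 x).1 h
      rw [hty hx] at hs ⊢
      rcases Comp.mem_next hact hsub hys hV hv hx (isSession_of_cty hx hs) with h | h | ⟨h, h'⟩
      · exact absurd (.inl h) hA
      · exact absurd (.inr (.inl (.inl h))) hA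
      · have hvz : v ≠ z := by rintro rfl; exact hA (.inr (.inr hx))
        have hd : Drop (E v).2 := hU v hv (by
          rintro (h1 | h1)
          · simp only [SProc.fn, List.mem_cons, h, hvz, false_or] at h1
            exact h' (.inl h1)
          · exact h' (.inr h1))
        exact ⟨cty_of_drop hx hd hs, by rw [hΓ v (.inl hv) x hx, MTy.shOf_eq_none hs]⟩
    · exact absurd (.inr (.inr h)) hA
    · exact absurd (.inl h) hA
    · exact absurd (.inr (.inl (.inr h))) hA

theorem bind_of_ne (E : Ctx) {y v : Name} (C : STy) (h : v ≠ y) : E.bind y C v = E v := by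
  simp [Ctx.bind, h]

theorem names_bind_of_ne (E : Ctx) {y v : Name} (C : STy) (h : v ≠ y) :
    (E.bind y C).names v = E.names v := by simp [Ctx.names, bind_of_ne E C h]

theorem cty_bind_of_ne (E : Ctx) {y : Name} (C : STy) {x : TName} (h : base x ≠ some y) :
    cty (E.bind y C) x = cty E x := by
  obtain ⟨_ | _ | _ | _, b⟩ := x
  · simp only [base, ne_eq, Option.some.injEq] at h
    simp [cty, bind_of_ne E C h]
  all_goals rfl

theorem next_bind (E : Ctx) {u y : Name} (C : STy) (h : u ≠ y) :
    (E.next u).bind y C = (E.bind y C).next u := by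
  unfold Ctx.next Ctx.bind
  rw [Function.update_of_ne h]
  rcases (E u).2.act? with _ | ⟨d, D, S⟩
  · rfl
  · simp only
    rw [Function.update_comm h]

set_option maxHeartbeats 400000 in
/-- An input of a trio, which binds the components of `y`. The components in `xs` and of `y` that
are neither used nor passed on have type `end` or are shared, and are weakened. The tail `T` is
typed in the context `E` with `y` bound but before the action, so that the assignment of types to
names is the same on both sides of the prefix. -/
theorem typed_input {ρ : Option (ℕ × List Name)} {E : Ctx} {u : Name} {y : ℕ} {Q : SProc}
    {U V : Set Name} {xs ys : List TName} {K : Set TName} {Γ : TShEnv} {Ξ : TRecEnv}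
    {π : ℕ → Kind} {T : TProc}
    (hact : Acts E u .inp) (hsub : SubjLive ρ E u Q) (hlast : Last E u → ¬ Live ρ Q u)
    (hy : (E.payload u).isSession = true → E.payload u ≠ .fin → Live ρ Q (y, false))
    (hU : ∀ v ∈ U, ¬ Live ρ (.inp u y Q) v → Drop (E v).2)
    (hyU : (y, false) ∉ U) (huy : u ≠ (y, false))
    (htr : (E u).2.tr = true → u ∈ U) (hxs : Comp E U xs)
    (hys : Comp ((E.next u).bind (y, false) (E.payload u)) V ys)
    (hV : ∀ v, v ∈ V ↔ (v ∈ U ∨ v = (y, false)) ∧ Live ρ Q v) (hK : ∀ x ∈ K, base x = none)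
    (hΓ : ∀ v, v ∈ U ∨ v = u → ∀ x ∈ E.names v, Γ x = (cty E x).shOf)
    (hT : ∀ Γ', (∀ x, base x ≠ some (y, false) → Γ' x = Γ x) →
      (∀ x ∈ (E.bind (y, false) (E.payload u)).names (y, false),
        Γ' x = (cty (E.bind (y, false) (E.payload u)) x).shOf) →
      TTyped Γ' Ξ (lenv (ty (E.bind (y, false) (E.payload u)) π) ({x | x ∈ ys} ∪ K)) T) :
    TTyped Γ Ξ (lenv (ty E π) {x | x ∈ xs ∨ x ∈ E.used u ∨ x ∈ K})
      (.inp (E.subj u) (((E.next u).bind (y, false) (E.payload u)).names (y, false)) T) := by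
  -- The binding of `y` commutes with the action of `u`; the proof takes place in the context `E₁`
  -- where `y` is bound already.
  rw [next_bind E _ huy] at hys ⊢
  set C := E.payload u with hC
  set E₁ := E.bind (y, false) C with hE₁
  set U₁ : Set Name := {v | v ∈ U ∨ v = (y, false)} with hU₁
  have hE₁v : ∀ {v}, v ≠ (y, false) → E₁ v = E v := fun h => bind_of_ne E C h
  have hnames : ∀ {v}, v ≠ (y, false) → E₁.names v = E.names v := fun h => names_bind_of_ne E C h
  have hUy : ∀ {v}, v ∈ U → v ≠ (y, false) := fun hv h => hyU (h ▸ hv)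
  have hu : E₁ u = E u := hE₁v huy
  have hact₁ : Acts E₁ u .inp := by unfold Acts; rw [hu]; exact hact
  have hsub₁ : SubjLive ρ E₁ u Q := by unfold SubjLive; rw [hu]; exact hsub
  have hlast₁ : Last E₁ u → ¬ Live ρ Q u := by unfold Last; rw [hu]; exact hlast
  have hsubj : E.subj u = E₁.subj u := by unfold Ctx.subj; rw [hu]
  have hused : E.used u = E₁.used u := by unfold Ctx.used; rw [hu]
  have hpay : E₁.payload u = C := by rw [hC]; unfold Ctx.payload; rw [hu]
  have hws : ∀ {x}, x ∈ (E₁.next u).names (y, false) ↔ x ∈ E₁.names (y, false) := by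
    intro x; rw [names_next_of_ne (Ne.symm huy)]
  have hK' : ∀ {v x}, x ∈ E₁.names v → x ∉ K := fun hx hxK =>
    base_ne_none_of_mem_names hx (hK _ hxK)
  have hty : ∀ {v x}, x ∈ E₁.names v → ty E₁ π x = cty E₁ x := fun hx =>
    ty_of_base (base_ne_none_of_mem_names hx)
  have hcty : ∀ {x}, base x ≠ some (y, false) → cty E₁ x = cty E x := fun h =>
    cty_bind_of_ne E C h
  have hV₁ : ∀ v, v ∈ V ↔ v ∈ U₁ ∧ Live ρ Q v := hV
  have hof := fun x => Comp.of_next (x := x) hact₁ hlast₁ hys hV₁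
  have hbx : ∀ {x}, x ∈ xs → ∃ v ∈ U, x ∈ E₁.names v := fun hx => by
    obtain ⟨v, hv, hxv⟩ := (hxs.2 _).1 hx
    exact ⟨v, hv, by rwa [hnames (hUy hv)]⟩
  have hmap : ((E₁.next u).names (y, false)).map (ty E₁ π) = STy.G (E₁.payload u) := by
    rw [names_next_of_ne (Ne.symm huy), map_ty fun x => base_ne_none_of_mem_names,
      map_cty_names, hpay, hE₁]
    simp [Ctx.bind]
  have hyx : ∀ {x}, x ∈ E₁.names (y, false) → x ∉ xs := fun hx hxs => by
    obtain ⟨v, hv, hxv⟩ := hbx hxs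
    exact hUy hv (eq_of_mem_names hxv hx)
  have hswap : lenv (ty E π) {x | x ∈ xs ∨ x ∈ E.used u ∨ x ∈ K} =
      lenv (ty E₁ π) {x | x ∈ xs ∨ x ∈ E₁.used u ∨ x ∈ K} := by
    rw [← hused]
    refine lenv_congr (fun _ _ => Iff.rfl) fun x hx => ?_
    have hx : x ∈ xs ∨ x ∈ E.used u ∨ x ∈ K := by simpa using hx
    by_cases hb : base x = none
    · exact ty_congr hb fun _ _ => rfl
    · rw [ty_of_base hb, ty_of_base hb, hcty]
      rintro hby
      rcases hx with hx | hx | hx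
      · obtain ⟨v, hv, hxv⟩ := (hxs.2 _).1 hx
        rw [base_of_mem_names hxv] at hby; cases hby; exact hyU hv
      · have := base_of_mem_names (hact.used_mem hx)
        rw [this] at hby; cases hby; exact huy rfl
      · exact hb (hK x hx)
  rw [hsubj, hswap]
  refine TTyped.recv_use (A := {x | (x ∈ xs ∧ x ∉ E₁.used u) ∨ x ∈ K})
    (W := {x | x ∈ E₁.used u}) ?_ ?_ (nodup_names _ _) ?_ ?_ ?_
  · intro Γ' hΓ'
    have hΓ1 : ∀ x, base x ≠ some (y, false) → Γ' x = Γ x := fun x hx => by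
      rw [hΓ' x, if_neg]
      intro h; exact hx (base_of_mem_names h)
    have hΓ2 : ∀ x ∈ E₁.names (y, false), Γ' x = (cty E₁ x).shOf := fun x hx => by
      rw [hΓ' x, if_pos (hws.2 hx), hty hx]
    have hΓ3 : ∀ v ∈ U₁, ∀ x ∈ E₁.names v, Γ' x = (cty E₁ x).shOf := by
      intro v hv x hx
      by_cases hvy : v = (y, false)
      · subst hvy; exact hΓ2 x hx
      · have hb : base x ≠ some (y, false) := by
          rw [base_of_mem_names hx]; simpa using hvy
        rw [hΓ1 x hb, hcty hb]
        exact hΓ v (.inl (hv.resolve_right hvy)) x (by rwa [← hnames hvy])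
    refine (hT Γ' hΓ1 hΓ2).weaken_list ?_ (xs ++ (E₁.next u).names (y, false)) ?_ ?_
    · rintro x (h | h) -
      · obtain ⟨⟨v, hv, hx, -⟩, hnu, -⟩ := hof x h
        rcases hv with hv | rfl
        · exact .inl (.inl ⟨(hxs.2 x).2 ⟨v, hv, by rwa [← hnames (hUy hv)]⟩, hnu⟩)
        · exact .inr (hws.2 hx)
      · exact .inl (.inr h)
    · rintro x ((h | h) | h) hA -
      · exact List.mem_append_left _ h.1
      · exact absurd (.inr h) hA
      · exact List.mem_append_right _ h
    · intro x h hA hs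
      have key : ∀ v ∈ U₁, x ∈ E₁.names v → x ∉ E₁.used u →
          ty E₁ π x = .fin ∧ Γ' x = none := by
        intro v hv hx hnu
        rw [hty hx] at hs ⊢
        rcases Comp.mem_next hact₁ hsub₁ hys hV₁ hv hx (isSession_of_cty hx hs) with
          h | h | ⟨h, h'⟩
        · exact absurd h hnu
        · exact absurd (.inl h) hA
        · have hd : Drop (E₁ v).2 := by
            by_cases hvy : v = (y, false)
            · subst hvy
              have e : (E₁ (y, false)).2 = C := by simp [hE₁, Ctx.bind]
              rw [e]
              by_cases hCf : C = .fin
              · exact .inl hCf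
              · refine .inr ?_
                by_contra hn
                exact h' (hy (isSession_iff.2 hn) hCf)
            · rw [hE₁v hvy]
              refine hU v (hv.resolve_right hvy) ?_
              rintro (h1 | h1)
              · simp only [SProc.fn, List.mem_cons, h, false_or, List.mem_filter] at h1
                exact h' (.inl h1.1)
              · exact h' (.inr h1)
          exact ⟨cty_of_drop hx hd hs, by rw [hΓ3 v hv x hx, MTy.shOf_eq_none hs]⟩
      rcases h with (h | h) | h
      · obtain ⟨v, hv, hx⟩ := hbx h.1
        exact key v (.inl hv) hx h.2
      · exact absurd (.inr h) hA
      · have hx := hws.1 h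
        exact key _ (.inr rfl) hx fun hu =>
          huy (eq_of_mem_names (hact₁.used_mem hu) hx)
  · rw [hmap]
    refine hact₁.use ?_ ?_ ?_ rfl
    · rw [← hsubj, hΓ u (.inr rfl) _ hact.subj_mem, hcty]
      rw [base_of_mem_names hact.subj_mem]; simpa using huy
    · rintro x hx (h | h)
      · exact h.2 hx
      · exact hK' (hact₁.used_mem hx) h
    · intro ht
      refine .inl ⟨?_, Acts.used_of_tr ht _⟩
      rw [hu] at ht
      exact (hxs.2 _).2 ⟨u, htr ht, by rw [← hsubj]; exact hact.subj_mem⟩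
  · intro h
    exact huy (eq_of_mem_names hact₁.subj_mem (hws.1 h))
  · rintro x hx - (h | h)
    · exact hyx (hws.1 hx) h.1
    · exact hK' (hws.1 hx) h
  · have aux : ∀ p q r : Prop, (p ∨ q ∨ r) ↔ q ∨ (p ∧ ¬ q) ∨ r := by
      intro p q r; tauto
    exact fun x _ => aux _ _ _

/-! ### Typing of a trio in the body of a recursion -/

/-- The output on the next propagator. In the linear mode it is followed by the recursion variable,
which takes the linear environment `K`; in the shared mode it is followed by inaction, and nothing
in `K` is linear. -/
theorem typed_fwd {Γ : TShEnv} {Ξ : TRecEnv} {τ : TName → MTy} {X : ℕ} {lin : Bool} {k : ℕ}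
    {ys : List TName} {K : Set TName} (hu : Use Γ τ (rOut lin k) .out (ys.map τ) K ∅)
    (hnd : ys.Nodup) (hb : ∀ y ∈ ys, base y ≠ none) (hK : ∀ x ∈ K, base x = none)
    (hΓ : ∀ y ∈ ys, Γ y = (τ y).shOf) (hlin : lin = true → Ξ X = some (lenv τ K))
    (hsh : lin = false → ∀ x ∈ K, ¬ (τ x).isSession = true) :
    TTyped Γ Ξ (lenv τ ({x | x ∈ ys} ∪ K)) (fwd X lin k ys) := by
  refine TTyped.send_use (A := K) (W := ∅) ?_ hu hnd hΓ ?_ ?_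
  · cases lin
    · rw [lenv_eq_empty (hsh rfl)]; exact .nil
    · exact .pvar (hlin rfl)
  · exact fun z hz _ => ⟨fun h => hb z hz (hK z h), fun h => h⟩
  · intro x _
    simp only [Set.mem_union, Set.mem_ofPred_eq, Set.mem_empty_iff_false, false_or]
    tauto

/-- The part of a recursive trio below the recursion; `A` may contain names beyond the environment
`K` of the recursion variable. -/
theorem typed_trio_body {Γ : TShEnv} {Ξ : TRecEnv} {τ : TName → MTy} {X : ℕ} {lin : Bool} {k : ℕ}
    {xs : List TName} {K A : Set TName} {T : TProc}
    (hu : Use Γ τ (rIn k) .inp (xs.map τ) A ∅)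
    (hnd : xs.Nodup) (hb : ∀ x ∈ xs, base x ≠ none) (hA : ∀ x ∈ xs, x ∉ A)
    (hsh : lin = false → ∀ x ∈ K, ¬ (τ x).isSession = true) (hX : Ξ X = some (lenv τ K))
    (hT : ∀ Γ', (∀ x, Γ' x = if x ∈ xs then (τ x).shOf else Γ x) →
      TTyped Γ' Ξ (lenv τ ({x | x ∈ xs} ∪ A)) T) :
    TTyped Γ Ξ (lenv τ A) (.inp (rIn k) xs (if lin then T else .par T (.pvar X))) := by
  refine TTyped.recv_use (A := A) (W := ∅) ?_ hu hnd ?_ ?_ ?_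
  · intro Γ' hΓ'
    have h := hT Γ' hΓ'
    cases lin
    · refine TTyped.par_lenv (A := {x | x ∈ xs} ∪ A) (W := K) h (.pvar hX) ?_ ?_
      · intro x hx
        have := fun h => hsh rfl x h hx
        simp only [Set.mem_union]; tauto
      · intro x hx _ hxK; exact hsh rfl x hxK hx
    · rw [Set.union_comm]; exact h
  · intro h; exact hb _ h rfl
  · exact fun y hy _ h => hA y hy h
  · intro x _; simp

/-- A recursive trio is typable if its action `T` is. The names `xs` that it receives are bound in
each round, hence only the propagators in `K` are in the environment of the recursion variable. -/
theorem typed_trio {Γ : TShEnv} {Ξ : TRecEnv} {τ : TName → MTy} {X : ℕ} {lin : Bool} {k : ℕ}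
    {xs : List TName} {K : Set TName} {T : TProc}
    (hu : Use Γ τ (rIn k) .inp (xs.map τ) K ∅)
    (hnd : xs.Nodup) (hb : ∀ x ∈ xs, base x ≠ none) (hK : ∀ x ∈ K, base x = none)
    (hsh : lin = false → ∀ x ∈ K, ¬ (τ x).isSession = true)
    (hbn : ∀ y ∈ T.bn, base y ≠ none ∧ (y ∉ T.fn ∨ y ∈ xs))
    (hT : ∀ Γ' Ξ', (∀ x, Γ' x = if x ∈ xs then (τ x).shOf else Γ x) →
      Ξ' X = some (lenv τ K) → TTyped Γ' Ξ' (lenv τ ({x | x ∈ xs} ∪ K)) T) :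
    TTyped Γ Ξ (lenv τ K) (trio X lin k xs T) := by
  have hX : (Ξ.set X (lenv τ K)) X = some (lenv τ K) := by simp [Env.set]
  refine TTyped.mu (typed_trio_body hu hnd hb (fun y hy h => hb y hy (hK y h)) hsh hX
    fun Γ' hΓ' => hT Γ' _ hΓ' hX) ?_
  intro y hy
  have hK' : base y ≠ none → lenv τ K y = none := fun h =>
    lenv_of_notMem fun h' => h (hK y h')
  have e : ∀ P : TProc, P = (if lin then T else .par T (.pvar X)) →
      P.bn = T.bn ∧ P.fn = T.fn := by
    rintro P rfl
    cases lin <;> simp [TProc.bn, TProc.fn]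
  obtain ⟨e1, e2⟩ := e _ rfl
  simp only [TProc.bn, e1, List.mem_append] at hy
  have hy1 : base y ≠ none := by
    rcases hy with hy | hy
    · exact hb y hy
    · exact (hbn y hy).1
  refine ⟨fun h => ?_, hK' hy1⟩
  simp only [TProc.fn, e2, List.mem_cons, List.mem_filter, decide_eq_true_eq] at h
  rcases h with rfl | ⟨h1, h2⟩
  · exact hy1 rfl
  · rcases hy with hy | hy
    · exact h2 hy
    · exact (hbn y hy).2.elim (fun h => h h1) h2

/-! ### Propagated names -/

theorem mem_minus {xs ws : List TName} {x : TName} : x ∈ minus xs ws ↔ x ∈ xs ∧ x ∉ ws := by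
  simp [minus]

theorem mem_fnb {Q : SProc} {xs : List TName} {x : TName} :
    x ∈ fnb Q xs ↔ x ∈ xs ∧ ∃ v ∈ Q.fn, base x = some v := by
  simp only [fnb, List.mem_filter, Option.any_eq_true, decide_eq_true_eq]
  constructor
  · rintro ⟨h, v, hv, hv'⟩; exact ⟨h, v, hv', hv⟩
  · rintro ⟨h, v, hv, hv'⟩; exact ⟨h, v, hv', hv⟩

theorem Comp.fnb {E : Ctx} {Q : SProc} {U : Set Name} {xs : List TName} (hnd : xs.Nodup)
    (h : ∀ v ∈ Q.fn, ∀ x, base x = some v → (x ∈ xs ↔ v ∈ U ∧ x ∈ E.names v)) :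
    Comp E {v | v ∈ U ∧ v ∈ Q.fn} (fnb Q xs) := by
  refine ⟨hnd.filter _, fun x => ?_⟩
  rw [mem_fnb]
  constructor
  · rintro ⟨hx, v, hv, hb⟩
    obtain ⟨h1, h2⟩ := (h v hv x hb).1 hx
    exact ⟨v, ⟨h1, hv⟩, h2⟩
  · rintro ⟨v, ⟨h1, hv⟩, hx⟩
    have hb := base_of_mem_names hx
    exact ⟨(h v hv x hb).2 ⟨h1, hx⟩, v, hv, hb⟩

/-- The components of `v` are the same in `E₀` and `E`, and they are not used up by actions. -/
def Stable (E₀ E : Ctx) (v : Name) : Prop :=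
  ((E v).2.tr = true ∨ ∃ C, (E v).2 = .sh C) ∧ (E v).1 = (E₀ v).1 ∧
    STy.G (E v).2 = STy.G (E₀ v).2

theorem Stable.names {E₀ E : Ctx} {v : Name} (h : Stable E₀ E v) : E.names v = E₀.names v :=
  names_congr h.2.1 h.2.2

theorem Stable.of_eq {E₀ E E' : Ctx} {v : Name} (h : Stable E₀ E v) (he : E' v = E v) :
    Stable E₀ E' v := by unfold Stable; rw [he]; exact h

theorem Stable.next {E₀ E : Ctx} {u v : Name} {d : Dir} (h : Stable E₀ E v) (ha : Acts E u d) :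
    Stable E₀ (E.next u) v := by
  by_cases hvu : v = u
  · subst hvu
    rcases ha.cases with ⟨C, h'⟩ | ⟨C, S, h1, h2, h3, h4, h5, h6, h7⟩ | ⟨C, S, h1, h2, h3, h4⟩
    · rw [next_of_sh h']; exact h
    · refine ⟨.inl ?_, ?_, ?_⟩
      · simp [next_of_act? h1, h3]
      · simp only [next_of_act? h1, Function.update_self, h2, if_true]; exact h.2.1
      · simp only [next_of_act? h1, Function.update_self, h5]; exact h.2.2
    · rcases h.1 with h' | ⟨C, h'⟩
      · rw [h'] at h2; cases h2
      · rw [h'] at h3; cases h3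
  · exact h.of_eq (next_of_ne E hvu)

theorem Stable.not_last {E₀ E : Ctx} {v : Name} {d : Dir} (h : Stable E₀ E v)
    (ha : Acts E v d) : ¬ Last E v := by
  rcases h.1 with h | ⟨C, h⟩
  · exact ha.not_last_of_tr h
  · rintro ⟨d, C', hl⟩
    rw [h] at hl; cases hl

theorem isSession_next {E : Ctx} {u v : Name} (h : (E v).2.isSession = false) :
    ((E.next u) v).2.isSession = false := by
  by_cases hvu : v = u
  · subst hvu
    cases hE : (E v).2 <;> simp [hE, STy.isSession] at h
    rw [next_of_sh hE, hE]; rfl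
  · rwa [next_of_ne E hvu]

/-- The propagated names are the components of the live names: those kept by `fnb`, together with
the parameters as long as the recursion variable occurs. As the parameters are stable, their
components `ms` at the start of the recursion are still their components in `E`. -/
theorem Comp.keep {E₀ E : Ctx} {X : ℕ} {M : List Name} {ms : List TName} {Q : SProc}
    {U : Set Name} {xs : List TName} (hms : Comp E₀ {v | v ∈ M} ms) (hnd : xs.Nodup)
    (h : ∀ v ∈ Q.fn, ∀ x, base x = some v → (x ∈ xs ↔ v ∈ U ∧ x ∈ E.names v))
    (hU : ∀ v ∈ Q.fn, v ∈ U) (hM : Q.occ X ≠ 0 → ∀ v ∈ M, Stable E₀ E v) :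
    Comp E {v | Live (some (X, M)) Q v} (keep X ms Q xs) := by
  have hf := Comp.fnb hnd h
  by_cases ho : Q.occ X = 0
  · simp only [MST.keep, ho, if_true]
    convert hf using 1
    ext v
    constructor
    · rintro (hv | ⟨_, _, h1, h2, -⟩)
      · exact ⟨hU v hv, hv⟩
      · cases h1; exact absurd ho h2
    · rintro ⟨-, hv⟩; exact .inl hv
  · simp only [MST.keep, ho, if_false]
    refine ⟨?_, fun x => ?_⟩
    · rw [List.nodup_append]
      refine ⟨hms.1, hf.1.filter _, ?_⟩
      rintro a ha b hb rfl
      exact (mem_minus.1 hb).2 ha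
    · rw [List.mem_append, mem_minus, hms.2]
      constructor
      · rintro (⟨v, hv, hx⟩ | ⟨hx, -⟩)
        · exact ⟨v, .inr ⟨X, M, rfl, ho, hv⟩, by rwa [(hM ho v hv).names]⟩
        · obtain ⟨v, hv, hx⟩ := (hf.2 x).1 hx
          exact ⟨v, .inl hv.2, hx⟩
      · rintro ⟨v, hv | ⟨_, _, h1, -, hv⟩, hx⟩
        · by_cases hxm : ∃ u ∈ {v | v ∈ M}, x ∈ E₀.names u
          · exact .inl hxm
          · exact .inr ⟨(hf.2 x).2 ⟨v, ⟨hU v hv, hv⟩, hx⟩, hxm⟩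
        · cases h1
          exact .inl ⟨v, hv, by rwa [← (hM ho v hv).names]⟩

/-- Removing the components that an action of `u` uses up leaves the components in the context after
this action, for all names but those whose session is over. -/
theorem mem_minus_used {E : Ctx} {u v : Name} {d : Dir} {U : Set Name} {xs : List TName}
    {x : TName} (ha : Acts E u d) (hxs : Comp E U xs) (hl : v = u → ¬ Last E u)
    (hb : base x = some v) :
    x ∈ minus xs (E.used u) ↔ v ∈ U ∧ x ∈ (E.next u).names v := by
  rw [mem_minus, hxs.mem hb]
  by_cases hvu : v = u
  · subst hvu
    rw [ha.mem_names_next (hl rfl), and_assoc]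
  · rw [names_next_of_ne hvu]
    refine and_iff_left fun h => ?_
    have := base_of_mem_names (ha.used_mem h)
    rw [hb] at this; cases this; exact hvu rfl

theorem Comp.append_names {E : Ctx} {U : Set Name} {xs : List TName} {y : Name} {C : STy}
    (hxs : Comp E U xs) (hy : y ∉ U) :
    Comp (E.bind y C) {v | v ∈ U ∨ v = y} (xs ++ (E.bind y C).names y) := by
  have hne : ∀ {v}, v ∈ U → v ≠ y := fun hv h => hy (h ▸ hv)
  refine ⟨?_, fun x => ?_⟩
  · rw [List.nodup_append]
    refine ⟨hxs.1, nodup_names _ _, ?_⟩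
    rintro a ha b hb rfl
    obtain ⟨v, hv, hx⟩ := (hxs.2 a).1 ha
    exact hne hv (eq_of_mem_names hx hb)
  · rw [List.mem_append, hxs.2]
    constructor
    · rintro (⟨v, hv, hx⟩ | hx)
      · exact ⟨v, .inl hv, by rwa [names_bind_of_ne E C (hne hv)]⟩
      · exact ⟨y, .inr rfl, hx⟩
    · rintro ⟨v, hv | rfl, hx⟩
      · exact .inl ⟨v, hv, by rwa [names_bind_of_ne E C (hne hv)] at hx⟩
      · exact .inr hx

/-! ### Restriction of the components of a name -/

/-- Restriction of a list of channels whose endpoints are of dual types. -/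
theorem typed_foldr_res {s : ℕ} {τ : TName → MTy} {Ξ : TRecEnv} {P : TProc}
    (l : List (MTy × ℕ)) (hnd : (l.map Prod.snd).Nodup)
    (hτ : ∀ p ∈ l, τ (.idx s p.2, false) = p.1 ∧ τ (.idx s p.2, true) = p.1.dual) :
    ∀ {Γ : TShEnv} {A : Set TName}, (∀ x ∈ A, ∀ p ∈ l, x.1 ≠ .idx s p.2) →
    (∀ Γ' : TShEnv, (∀ x, (∀ p ∈ l, x.1 ≠ .idx s p.2) → Γ' x = Γ x) →
      (∀ p ∈ l, Γ' (.idx s p.2, false) = p.1.shOf ∧ Γ' (.idx s p.2, true) = none) →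
      TTyped Γ' Ξ (lenv τ (A ∪ {x | ∃ p ∈ l, x.1 = .idx s p.2})) P) →
    TTyped Γ Ξ (lenv τ A) (l.foldr (fun p Q => .res (.idx s p.2) (some p.1) Q) P) := by
  induction l with
  | nil =>
    intro Γ A _ hP
    simpa using hP Γ (fun _ _ => rfl) (by simp)
  | cons p l ih =>
    intro Γ A hA hP
    simp only [List.map_cons, List.nodup_cons] at hnd
    obtain ⟨h1, h2⟩ := hτ p List.mem_cons_self
    have hpl : ∀ q ∈ l, p.2 ≠ q.2 := fun q hq h => hnd.1 (h ▸ List.mem_map_of_mem hq)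
    refine TTyped.res_lenv (L := A ∪ {x | x.1 = .idx s p.2}) (fun Γ' hΓ1 hΓ2 hΓ3 => ?_)
      (by rw [h1, h2]) (.inr (by rw [h1])) (fun x _ => Iff.rfl)
      fun x hx => hA x hx p List.mem_cons_self
    refine ih hnd.2 (fun q hq => hτ q (List.mem_cons_of_mem _ hq)) ?_ ?_
    · rintro x (hx | hx) q hq
      · exact hA x hx q (List.mem_cons_of_mem _ hq)
      · have hx : x.1 = .idx s p.2 := hx
        rw [hx]; simpa using hpl q hq
    · intro Γ'' hΓ4 hΓ5
      convert hP Γ'' ?_ ?_ using 2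
      · ext x
        simp only [Set.mem_union, Set.mem_ofPred_eq, List.mem_cons, exists_eq_or_imp, or_assoc]
      · intro x hx
        rw [hΓ4 x fun q hq => hx q (List.mem_cons_of_mem _ hq),
          hΓ1 x (hx p List.mem_cons_self)]
      · intro q hq
        rcases List.mem_cons.1 hq with rfl | hq
        · rw [hΓ4 _ fun r hr => by simpa using hpl r hr,
            hΓ4 _ fun r hr => by simpa using hpl r hr, hΓ2, hΓ3, h1]
          exact ⟨rfl, rfl⟩
        · exact hΓ5 q hq

theorem mem_zipIdx_one {Ms : List MTy} {p : MTy × ℕ} :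
    p ∈ Ms.zipIdx 1 ↔ ∃ j, Ms[j]? = some p.1 ∧ p.2 = 1 + j := by
  obtain ⟨M, i⟩ := p
  rw [List.mem_zipIdx_iff_le_and_getElem?_sub]
  constructor
  · rintro ⟨h1, h2⟩; exact ⟨i - 1, h2, by simp only at h1 ⊢; omega⟩
  · rintro ⟨j, h1, h2⟩
    simp only at h2 ⊢
    subst h2
    exact ⟨by omega, by simpa using h1⟩

theorem bindRes_false (E : Ctx) (s : ℕ) (C : STy) : E.bindRes s C (s, false) = (1, C) := by
  simp [Ctx.bindRes, Ctx.bind]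

theorem bindRes_true (E : Ctx) (s : ℕ) (C : STy) : E.bindRes s C (s, true) = (1, C.dual) := by
  simp [Ctx.bindRes, Ctx.bind]

theorem bindRes_of_ne (E : Ctx) {s : ℕ} (C : STy) {v : Name} (h : v.1 ≠ s) :
    E.bindRes s C v = E v := by
  have h1 : v ≠ (s, false) := by rintro rfl; exact h rfl
  have h2 : v ≠ (s, true) := by rintro rfl; exact h rfl
  simp [Ctx.bindRes, Ctx.bind, h1, h2]

theorem names_bindRes_of_ne (E : Ctx) {s : ℕ} (C : STy) {v : Name} (h : v.1 ≠ s) :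
    (E.bindRes s C).names v = E.names v := by simp [Ctx.names, bindRes_of_ne E C h]

/-- Restriction of the components of `s`: the components of the two endpoints are of dual types, as
`G` commutes with duality. A shared `s` has one component, whose second endpoint is not used. -/
theorem typed_nus {E : Ctx} {s : ℕ} {C : STy} (hC : C.WF) {π : ℕ → Kind} {Γ : TShEnv}
    {Ξ : TRecEnv} {A : Set TName} {P : TProc} (hA : ∀ x ∈ A, ∀ b, base x ≠ some (s, b))
    (hP : ∀ Γ' : TShEnv, (∀ x, (∀ b, base x ≠ some (s, b)) → Γ' x = Γ x) →
      (∀ b, b = false ∨ C.isSession = true → ∀ x ∈ (E.bindRes s C).names (s, b),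
        Γ' x = (cty (E.bindRes s C) x).shOf) →
      TTyped Γ' Ξ (lenv (ty (E.bindRes s C) π)
        {x | x ∈ A ∨ ∃ b, (b = false ∨ C.isSession = true) ∧
          x ∈ (E.bindRes s C).names (s, b)}) P) :
    TTyped Γ Ξ (lenv (ty (E.bindRes s C) π) A) (nus s C P) := by
  have hmem : ∀ x : TName, (∃ p ∈ (STy.G C).zipIdx 1, x.1 = .idx s p.2) ↔
      ∃ b, x ∈ (E.bindRes s C).names (s, b) := by
    rintro ⟨c, b⟩
    constructor
    · rintro ⟨p, hp, hx⟩
      obtain ⟨j, hj, hpj⟩ := mem_zipIdx_one.1 hp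
      have hj := (List.getElem?_eq_some_iff.1 hj).1
      simp only at hx
      subst hx
      refine ⟨b, mem_names.2 ⟨j, ?_, ?_⟩⟩
      · cases b <;> simp [bindRes_false, bindRes_true, STy.G_dual, hj]
      · cases b <;> simp [bindRes_false, bindRes_true, nm, hpj]
    · rintro ⟨b', hx⟩
      obtain ⟨j, hj, hx⟩ := mem_names.1 hx
      have hj' : j < (STy.G C).length := by
        cases b' <;> simpa [bindRes_false, bindRes_true, STy.G_dual] using hj
      refine ⟨((STy.G C)[j], 1 + j), mem_zipIdx_one.2 ⟨j, by simp [hj'], rfl⟩, ?_⟩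
      cases b' <;> simp [bindRes_false, bindRes_true, nm] at hx <;> simp [hx.1]
  have hτ : ∀ p ∈ (STy.G C).zipIdx 1, cty (E.bindRes s C) (.idx s p.2, false) = p.1 ∧
      cty (E.bindRes s C) (.idx s p.2, true) = p.1.dual := by
    intro p hp
    obtain ⟨j, hj, hpj⟩ := mem_zipIdx_one.1 hp
    simp [cty, bindRes_false, bindRes_true, hpj, STy.G_dual, hj]
  have hses : C.isSession = true → ∀ p ∈ (STy.G C).zipIdx 1, p.1.dual.shOf = none := by
    intro hs p hp
    obtain ⟨j, hj, hpj⟩ := mem_zipIdx_one.1 hp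
    have := hC.isSession_of_mem_G hs p.1 (List.mem_of_getElem? hj)
    cases hp1 : p.1 <;> simp [hp1, MTy.isSession, MTy.dual, MTy.shOf] at *
  refine typed_foldr_res (τ := ty (E.bindRes s C) π) _ ?_ hτ ?_ ?_
  · have : (((STy.G C).zipIdx 1).map Prod.snd) = List.range' 1 (STy.G C).length := by simp
    rw [this]; exact List.nodup_range'
  · rintro x hx p hp he
    obtain ⟨b, hb⟩ := (hmem x).1 ⟨p, hp, he⟩
    exact hA x hx b (base_of_mem_names hb)
  · intro Γ' h1 h2
    convert hP Γ' ?_ ?_ using 1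
    · refine lenv_ext fun x hx => ?_
      simp only [Set.mem_union, Set.mem_ofPred_eq, hmem]
      refine or_congr_right ⟨?_, ?_⟩
      · rintro ⟨b, hb⟩
        refine ⟨b, .inr ?_, hb⟩
        rw [ty_of_base (base_ne_none_of_mem_names hb)] at hx
        have := isSession_of_cty hb hx
        cases b
        · simpa [bindRes_false] using this
        · simpa [bindRes_true, STy.isSession_dual] using this
      · rintro ⟨b, -, hb⟩; exact ⟨b, hb⟩
    · intro x hx
      refine h1 x fun p hp he => ?_
      obtain ⟨b, hb⟩ := (hmem x).1 ⟨p, hp, he⟩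
      exact hx b (base_of_mem_names hb)
    · intro b hb x hx
      obtain ⟨p, hp, he⟩ := (hmem x).2 ⟨b, hx⟩
      have hxb : x = (.idx s p.2, b) := by
        obtain ⟨j, -, rfl⟩ := mem_names.1 hx
        exact Prod.ext he rfl
      subst hxb
      cases b
      · rw [(h2 p hp).1, (hτ p hp).1]
      · have hs : C.isSession = true := hb.resolve_left (by simp)
        rw [(h2 p hp).2, (hτ p hp).2, hses hs p hp]

theorem bn_nus {s : ℕ} {C : STy} {P : TProc} (h : ∀ y ∈ P.bn, y ∉ P.fn ∧ base y ≠ none) :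
    ∀ y ∈ (nus s C P).bn, y ∉ (nus s C P).fn ∧ base y ≠ none := by
  unfold nus
  induction (STy.G C).zipIdx 1 with
  | nil => simpa using h
  | cons p l ih =>
    intro y hy
    simp only [List.foldr_cons, TProc.bn, TProc.fn, List.mem_cons, List.mem_filter,
      decide_eq_true_eq] at hy ⊢
    rcases hy with rfl | rfl | hy
    · simp [base]
    · simp [base]
    · exact ⟨fun h => (ih y hy).1 h.1, (ih y hy).2⟩

/-! ### The breakdown of the body of a recursion -/

/-- The situation in which a part `Q` of the body of the recursion on `X` is broken down: `xs` are
the components of the names in `U` in the context `E`, and `M` are the parameters of the recursion,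
with the types that they have in the context `E₀` of its start. In the linear mode the variable
occurs exactly once in `Q`; in the shared mode the parameters are shared names. -/
structure RecInv (X : ℕ) (M : List Name) (E₀ E : Ctx) (lin : Bool) (U : Set Name)
    (xs : List TName) (Q : SProc) : Prop where
  good : Good (some (X, M)) E Q
  comp : Comp E U xs
  live : ∀ v, Live (some (X, M)) Q v → v ∈ U
  drop : ∀ v ∈ U, ¬ Live (some (X, M)) Q v → Drop (E v).2
  lin_occ : lin = true → Q.occ X = 1
  shared : lin = false → Q.occ X ≠ 0 → ∀ v ∈ M, (E v).2.isSession = false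
  stable : Q.occ X ≠ 0 → ∀ v ∈ M, Stable E₀ E v
  nodup : Q.bound.Nodup
  fresh : ∀ v ∈ U, v.1 ∉ Q.bound

section RecInv

variable {X : ℕ} {M : List Name} {E₀ E : Ctx} {lin : Bool} {U : Set Name} {xs ms : List TName}
  {Q R : SProc} {u z : Name} {y : ℕ}

/-- A name whose session ends is not live afterwards: it is not free in the continuation, and as it
is not stable it is not a parameter of a recursion variable that occurs. -/
theorem not_live_of_last {d : Dir} (ha : Acts E u d)
    (hs : SubjLive (some (X, M)) E u Q) (hst : Q.occ X ≠ 0 → ∀ v ∈ M, Stable E₀ E v)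
    (hl : Last E u) : ¬ Live (some (X, M)) Q u := by
  rintro (h | ⟨_, _, h1, h2, h3⟩)
  · obtain ⟨d', C, hl⟩ := hl
    exact (hs _ _ _ hl).1 rfl h
  · cases h1
    exact (hst h2 u h3).not_last ha hl

theorem RecInv.out (h : RecInv X M E₀ E lin U xs (.out u z Q)) (hms : Comp E₀ {v | v ∈ M} ms) :
    RecInv X M E₀ (E.next u) lin {v | Live (some (X, M)) Q v}
      (keep X ms Q (minus xs (E.used u))) Q := by
  obtain ⟨ha, hs, -, -, hg⟩ := h.good
  have hlv : ∀ v, Live (some (X, M)) Q v → v ∈ U := fun v hv => h.live v (by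
    rcases hv with hv | hv
    · exact .inl (by simp [SProc.fn, hv])
    · exact .inr hv)
  refine ⟨hg, hms.keep (U := U) (h.comp.1.filter _) (fun v hv x hb => ?_)
    (fun v hv => hlv v (.inl hv)) fun ho v hv => (h.stable ho v hv).next ha, fun _ hv => hv,
    fun v hv hv' => absurd hv hv', h.lin_occ, fun hl ho v hv => isSession_next (h.shared hl ho v hv),
    fun ho v hv => (h.stable ho v hv).next ha, h.nodup, fun v hv => h.fresh v (hlv v hv)⟩
  refine mem_minus_used ha h.comp ?_ hb
  rintro rfl hl
  exact not_live_of_last ha hs h.stable hl (.inl hv)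

theorem Live.of_inp (h : Live (some (X, M)) Q u) (hu : u ≠ (y, false)) :
    Live (some (X, M)) (.inp z y Q) u := by
  rcases h with h | h
  · exact .inl (by simp [SProc.fn, h, hu])
  · exact .inr h

theorem RecInv.inp (h : RecInv X M E₀ E lin U xs (.inp u y Q)) (hms : Comp E₀ {v | v ∈ M} ms) :
    let E' := (E.next u).bind (y, false) (E.payload u)
    RecInv X M E₀ E' lin {v | Live (some (X, M)) Q v}
      (keep X ms Q (minus (xs ++ E'.names (y, false)) (E.used u))) Q := by
  intro E'
  obtain ⟨ha, hs, -, hg⟩ := h.good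
  have hnd := List.nodup_cons.1 h.nodup
  have hyU : (y, false) ∉ U := fun hy => h.fresh _ hy List.mem_cons_self
  have huU : u ∈ U := h.live u (.inl (by simp [SProc.fn]))
  have huy : u ≠ (y, false) := by rintro rfl; exact hyU huU
  have hlv : ∀ v, Live (some (X, M)) Q v → v ∈ U ∨ v = (y, false) := fun v hv => by
    by_cases hvy : v = (y, false)
    · exact .inr hvy
    · exact .inl (h.live v (hv.of_inp hvy))
  have hE' : E' = (E.bind (y, false) (E.payload u)).next u := next_bind E _ huy
  have hMy : Q.occ X ≠ 0 → ∀ v ∈ M, v ≠ (y, false) := fun ho v hv => by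
    rintro rfl
    exact hyU (h.live _ (.inr ⟨X, M, rfl, ho, hv⟩))
  have ha₁ : Acts (E.bind (y, false) (E.payload u)) u .inp := by
    unfold Acts; rw [bind_of_ne E _ huy]; exact ha
  have hst : Q.occ X ≠ 0 → ∀ v ∈ M, Stable E₀ E' v := fun ho v hv =>
    ((h.stable ho v hv).next ha).of_eq (bind_of_ne _ _ (hMy ho v hv))
  refine ⟨hg, hms.keep (U := {v | v ∈ U ∨ v = (y, false)}) ?_ (fun v hv x hb => ?_)
    (fun v hv => hlv v (.inl hv)) hst, fun _ hv => hv, fun v hv hv' => absurd hv hv', h.lin_occ,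
    fun hl ho v hv => ?_, hst, hnd.2, fun v hv => ?_⟩
  · refine List.Nodup.filter _ ?_
    rw [hE', names_next_of_ne (Ne.symm huy)]
    exact (h.comp.append_names hyU).1
  · have := mem_minus_used ha₁ (h.comp.append_names (C := E.payload u) hyU) (v := v) (x := x) ?_ hb
    · rw [hE', names_next_of_ne (Ne.symm huy)]
      have e : (E.bind (y, false) (E.payload u)).used u = E.used u := by
        unfold Ctx.used; rw [bind_of_ne E _ huy]
      rwa [e] at this
    · rintro rfl hl
      unfold Last at hl
      rw [bind_of_ne E _ huy] at hl
      exact not_live_of_last ha hs h.stable hl (.inl hv)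
  · rw [show E' v = E.next u v from bind_of_ne _ _ (hMy ho v hv)]
    exact isSession_next (h.shared hl ho v hv)
  · rcases hlv v hv with hv | rfl
    · exact fun hb => h.fresh v hv (List.mem_cons_of_mem _ hb)
    · exact hnd.1

theorem RecInv.of_sub (hl : ∀ v, Live (some (X, M)) Q v → v ∈ U) (hxs : Comp E U xs)
    (hms : Comp E₀ {v | v ∈ M} ms) (hg : Good (some (X, M)) E Q)
    (h1 : lin = true → Q.occ X = 1)
    (h2 : lin = false → Q.occ X ≠ 0 → ∀ v ∈ M, (E v).2.isSession = false)
    (h3 : Q.occ X ≠ 0 → ∀ v ∈ M, Stable E₀ E v) (h4 : Q.bound.Nodup)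
    (h5 : ∀ v ∈ U, v.1 ∉ Q.bound) :
    RecInv X M E₀ E lin {v | Live (some (X, M)) Q v} (keep X ms Q xs) Q :=
  ⟨hg, hms.keep (U := U) hxs.1 (fun _ _ _ hb => hxs.mem hb) (fun v hv => hl v (.inl hv)) h3,
    fun _ hv => hv, fun _ hv hv' => absurd hv hv', h1, h2, h3, h4, fun v hv => h5 v (hl v hv)⟩

theorem Live.par_left (h : Live (some (X, M)) Q u) : Live (some (X, M)) (.par Q R) u := by
  rcases h with h | ⟨X', M', h1, h2, h3⟩
  · exact .inl (List.mem_append_left _ h)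
  · exact .inr ⟨X', M', h1, by simp only [SProc.occ]; omega, h3⟩

theorem Live.par_right (h : Live (some (X, M)) R u) : Live (some (X, M)) (.par Q R) u := by
  rcases h with h | ⟨X', M', h1, h2, h3⟩
  · exact .inl (List.mem_append_right _ h)
  · exact .inr ⟨X', M', h1, by simp only [SProc.occ]; omega, h3⟩

theorem Live.of_par (h : Live (some (X, M)) (.par Q R) u) :
    Live (some (X, M)) Q u ∨ Live (some (X, M)) R u := by
  rcases h with h | ⟨X', M', h1, h2, h3⟩
  · exact (List.mem_append.1 h).imp .inl .inl
  · cases h1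
    simp only [SProc.occ] at h2
    by_cases h4 : Q.occ X = 0
    · exact .inr (.inr ⟨X, M, rfl, by omega, h3⟩)
    · exact .inl (.inr ⟨X, M, rfl, h4, h3⟩)

/-- If the recursion is in the linear mode, its variable occurs in exactly one of the two parts,
which inherits this mode. -/
theorem RecInv.par (h : RecInv X M E₀ E lin U xs (.par Q R)) (hms : Comp E₀ {v | v ∈ M} ms) :
    RecInv X M E₀ E (lin && decide (Q.occ X ≠ 0)) {v | Live (some (X, M)) Q v}
      (keep X ms Q xs) Q ∧
    RecInv X M E₀ E (lin && decide (R.occ X ≠ 0)) {v | Live (some (X, M)) R v}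
      (keep X ms R xs) R := by
  obtain ⟨-, hQ, hR⟩ := h.good
  have hnd := List.nodup_append.1 h.nodup
  have hocc : (SProc.par Q R).occ X = Q.occ X + R.occ X := rfl
  refine ⟨.of_sub (fun v hv => h.live v hv.par_left) h.comp hms hQ ?_ ?_ ?_ hnd.1 ?_,
    .of_sub (fun v hv => h.live v hv.par_right) h.comp hms hR ?_ ?_ ?_ hnd.2.1 ?_⟩
  · intro hl
    simp only [Bool.and_eq_true, decide_eq_true_eq] at hl
    have := h.lin_occ hl.1
    omega
  · intro hl ho
    simp only [ho, ne_eq, not_false_eq_true, decide_true, Bool.and_true] at hl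
    exact h.shared hl (by omega)
  · intro ho; exact h.stable (by omega)
  · exact fun v hv hb => h.fresh v hv (List.mem_append_left _ hb)
  · intro hl
    simp only [Bool.and_eq_true, decide_eq_true_eq] at hl
    have := h.lin_occ hl.1
    omega
  · intro hl ho
    simp only [ho, ne_eq, not_false_eq_true, decide_true, Bool.and_true] at hl
    exact h.shared hl (by omega)
  · intro ho; exact h.stable (by omega)
  · exact fun v hv hb => h.fresh v hv (List.mem_append_right _ hb)

/-- The names bound by a restriction which are propagated: both endpoints of a session name, and
one endpoint of a shared name. -/
def resNames (E : Ctx) (s : ℕ) (C : STy) : List TName :=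
  if C.isSession then (E.bindRes s C).names (s, false) ++ (E.bindRes s C).names (s, true)
    else (E.bindRes s C).names (s, false)

theorem mem_resNames {s : ℕ} {C : STy} {x : TName} :
    x ∈ resNames E s C ↔
      ∃ b, (b = false ∨ C.isSession = true) ∧ x ∈ (E.bindRes s C).names (s, b) := by
  unfold resNames
  cases C.isSession <;> simp

theorem Comp.append_resNames {s : ℕ} {C : STy} (hxs : Comp E U xs) (hs : ∀ v ∈ U, v.1 ≠ s) :
    Comp (E.bindRes s C) {v | v ∈ U ∨ ∃ b, (b = false ∨ C.isSession = true) ∧ v = (s, b)}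
      (xs ++ resNames E s C) := by
  have hne : ∀ b, (s, b) ∉ U := fun b h => hs _ h rfl
  refine ⟨?_, fun x => ?_⟩
  · rw [List.nodup_append]
    refine ⟨hxs.1, ?_, ?_⟩
    · unfold resNames
      split_ifs
      · rw [List.nodup_append]
        refine ⟨nodup_names _ _, nodup_names _ _, ?_⟩
        rintro a ha b hb rfl
        have := eq_of_mem_names ha hb
        simp at this
      · exact nodup_names _ _
    · rintro a ha b hb rfl
      obtain ⟨v, hv, hx⟩ := (hxs.2 a).1 ha
      obtain ⟨b, -, hb⟩ := mem_resNames.1 hb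
      have := eq_of_mem_names hx hb
      subst this
      exact hne _ hv
  · rw [List.mem_append, hxs.2, mem_resNames]
    constructor
    · rintro (⟨v, hv, hx⟩ | ⟨b, hb, hx⟩)
      · exact ⟨v, .inl hv, by rwa [names_bindRes_of_ne E C (hs v hv)]⟩
      · exact ⟨_, .inr ⟨b, hb, rfl⟩, hx⟩
    · rintro ⟨v, hv | ⟨b, hb, rfl⟩, hx⟩
      · exact .inl ⟨v, hv, by rwa [names_bindRes_of_ne E C (hs v hv)] at hx⟩
      · exact .inr ⟨b, hb, hx⟩

theorem Live.of_res {ρ : Option (ℕ × List Name)} {s : ℕ} {C : STy} (h : Live ρ Q u)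
    (hu : u.1 ≠ s) : Live ρ (.res s C Q) u := by
  rcases h with h | h
  · exact .inl (by simp [SProc.fn, h, hu])
  · exact .inr h

theorem RecInv.res {s : ℕ} {C : STy} (h : RecInv X M E₀ E lin U xs (.res s C Q)) :
    RecInv X M E₀ (E.bindRes s C) lin
      {v | v ∈ U ∨ ∃ b, (b = false ∨ C.isSession = true) ∧ v = (s, b)}
      (xs ++ resNames E s C) Q := by
  obtain ⟨hC, h1, h2, hg⟩ := h.good
  have hnd := List.nodup_cons.1 h.nodup
  have hs : ∀ v ∈ U, v.1 ≠ s := fun v hv hv' => h.fresh v hv (by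
    rw [hv']; exact List.mem_cons_self)
  have hMs : Q.occ X ≠ 0 → ∀ v ∈ M, v.1 ≠ s := fun ho v hv =>
    hs v (h.live v (.inr ⟨X, M, rfl, ho, hv⟩))
  refine ⟨hg, h.comp.append_resNames hs, fun v hv => ?_, ?_, h.lin_occ, fun hl ho v hv => ?_,
    fun ho v hv => (h.stable ho v hv).of_eq (bindRes_of_ne E C (hMs ho v hv)), hnd.2, ?_⟩
  · by_cases hvs : v.1 = s
    · obtain ⟨a, b⟩ := v
      simp only at hvs
      subst hvs
      refine .inr ⟨b, ?_, rfl⟩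
      by_contra hb
      simp only [not_or, Bool.not_eq_false, Bool.not_eq_true] at hb
      obtain ⟨rfl, hb⟩ := hb
      rcases hv with hv | ⟨_, _, h3, h4, h5⟩
      · exact h2 hb hv
      · cases h3; exact hMs h4 _ h5 rfl
    · exact .inl (h.live v (hv.of_res hvs))
  · rintro v (hv | ⟨b, -, rfl⟩) hl
    · rw [bindRes_of_ne E C (hs v hv)]
      refine h.drop v hv fun h' => hl ?_
      rcases h' with h' | h'
      · exact .inl (List.mem_filter.1 h').1
      · exact .inr h'
    · have key : Drop C := by
        by_cases hf : C = .fin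
        · exact .inl hf
        · refine .inr ?_
          by_contra hn
          exact hl (h1 (isSession_iff.2 hn) hf b)
      cases b
      · rw [bindRes_false]; exact key
      · rw [bindRes_true]
        rcases key with rfl | ⟨D, rfl⟩
        · exact .inl rfl
        · exact .inr ⟨D, rfl⟩
  · rw [bindRes_of_ne E C (hMs ho v hv)]; exact h.shared hl ho v hv
  · rintro v (hv | ⟨b, -, rfl⟩) hb
    · exact h.fresh v hv (List.mem_cons_of_mem _ hb)
    · exact hnd.1 hb

end RecInv

theorem deg_pos (r : Bool) (P : SProc) : 0 < deg r P := by
  induction P generalizing r with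
  | res s C P ih => unfold deg; split_ifs <;> [omega; exact ih r]
  | _ => simp [deg]

/-- The propagators of a breakdown of degree `n` with index from `k` in the body of a recursion.
The output endpoint of `c^r_k` belongs to the context. -/
def recProps (k n : ℕ) : Set TName := {x | x ∈ propsIn k n ∧ x ≠ (.rprop k, true)}

theorem base_of_mem_recProps {k n : ℕ} {x : TName} (h : x ∈ recProps k n) : base x = none :=
  base_of_mem_propsIn h.1

theorem use_rIn {Γ : TShEnv} {π : ℕ → Kind} {E : Ctx} {lin : Bool} {k n : ℕ} {ps : List MTy}
    {A : Set TName} (hπ : π k = .ofMode lin ps) (hΓ : PropsOK Γ π k n) (hn : 0 < n)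
    (hA : rIn k ∈ A) : Use Γ (ty E π) (rIn k) .inp ps A ∅ := by
  cases lin
  · exact .inr (.inr ⟨by rw [rIn, hΓ.rprop le_rfl (by omega), hπ]; rfl, rfl⟩)
  · exact .inr (.inl ⟨by simp [rIn, ty, hπ, Kind.ofMode, dirOf], hA, rfl⟩)

theorem use_rOut {Γ : TShEnv} {π : ℕ → Kind} {E : Ctx} {lin : Bool} {k k' n : ℕ} {ps : List MTy}
    {A : Set TName} (hπ : π k' = .ofMode lin ps) (hΓ : PropsOK Γ π k n) (hk : k ≤ k')
    (hn : k' < k + n) (hA : lin = true → (.rprop k', true) ∈ A) :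
    Use Γ (ty E π) (rOut lin k') .out ps A ∅ := by
  cases lin
  · exact .inr (.inr ⟨by rw [rOut, hΓ.rprop hk hn, hπ]; rfl, rfl⟩)
  · exact .inr (.inl ⟨by simp [rOut, ty, hπ, Kind.ofMode, dirOf], hA rfl, rfl⟩)

theorem not_isSession_rprop {π : ℕ → Kind} {E : Ctx} {k : ℕ} {b : Bool} {ps : List MTy}
    (hπ : π k = .ofMode false ps) : ¬ (ty E π (.rprop k, b)).isSession = true := by
  simp [ty, hπ, Kind.ofMode, MTy.isSession]

/-- The unused propagator `c_k` is added to the linear environment. -/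
theorem typed_add_prop {Γ : TShEnv} {Ξ : TRecEnv} {π : ℕ → Kind} {E : Ctx} {lin : Bool}
    {k n : ℕ} {ps : List MTy} {K : Set TName} {P : TProc} (hπ : π k = .ofMode lin ps)
    (hΓ : PropsOK Γ π k n) (hn : 0 < n) (hP : TTyped Γ Ξ (lenv (ty E π) K) P) :
    TTyped Γ Ξ (lenv (ty E π) {x | x ∈ K ∨ ∃ b, x = (.prop k, b)}) P := by
  refine hP.weaken_list (fun x hx _ => .inl hx) [(.prop k, false), (.prop k, true)] ?_ ?_
  · rintro x (hx | ⟨b, rfl⟩) hxK _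
    · exact absurd hx hxK
    · cases b <;> simp
  · rintro x (hx | ⟨b, rfl⟩) hxK _
    · exact absurd hx hxK
    · refine ⟨?_, (hΓ k le_rfl (by omega)).1 b⟩
      cases lin <;> simp [ty, hπ, Kind.ofMode]

theorem bn_fwd (X : ℕ) (lin : Bool) (k : ℕ) (ys : List TName) : (fwd X lin k ys).bn = [] := by
  cases lin <;> simp [fwd, TProc.bn]

section Brec

variable {X : ℕ} {M : List Name} {ms : List TName} {E₀ : Ctx}

/-- The statement that the breakdown of the part `Q` of the body of a recursion is typable, with
suitable kinds of propagators: all names are received through the propagators, so that only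
propagators are in the linear environment. -/
def BrecTyped (X : ℕ) (ms : List TName) (E₀ E : Ctx) (lin : Bool) (k : ℕ) (xs : List TName)
    (Q : SProc) : Prop :=
  ∃ π : ℕ → Kind, π k = .ofMode lin (xs.map (cty E)) ∧
    ∀ Γ Ξ, PropsOK Γ π k (deg true Q) → Γ (rX X) = some (ms.map (cty E₀)) →
      TTyped Γ Ξ (lenv (ty E π) (recProps k (deg true Q))) (Brec X ms E lin k xs Q)

theorem covers_of_bind {E : Ctx} {π : ℕ → Kind} {U : Set Name} {xs : List TName} {Γ Γ' : TShEnv}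
    (hxs : Comp E U xs) (h : ∀ x, Γ' x = if x ∈ xs then (ty E π x).shOf else Γ x) :
    ∀ v ∈ U, ∀ x ∈ E.names v, Γ' x = (cty E x).shOf := fun v hv x hx => by
  rw [h x, if_pos ((hxs.2 x).2 ⟨v, hv, hx⟩), ty_of_base (base_ne_none_of_mem_names hx)]

/-- Inaction is in the shared mode, since the recursion variable does not occur in it. -/
theorem brec_nil {E : Ctx} {lin : Bool} {k : ℕ} {U : Set Name} {xs : List TName}
    (h : RecInv X M E₀ E lin U xs .nil) : BrecTyped X ms E₀ E lin k xs .nil := by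
  -- The recursion variable does not occur, so the mode is the shared one.
  have hl : lin = false := by
    by_contra hl
    have := h.lin_occ (by simpa using hl)
    simp [SProc.occ] at this
  subst hl
  refine ⟨fun _ => .ofMode false (xs.map (cty E)), rfl, fun Γ Ξ hΓ hX => ?_⟩
  set π : ℕ → Kind := fun _ => .ofMode false (xs.map (cty E)) with hπ
  have hK : ∀ x ∈ ({rIn k} : Set TName), base x = none := by rintro x rfl; rfl
  have hmap : xs.map (ty E π) = xs.map (cty E) := map_ty h.comp.base_ne
  have ht : TTyped Γ Ξ (lenv (ty E π) {rIn k}) (Brec X ms E false k xs .nil) := by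
    refine typed_trio ?_ h.comp.1 h.comp.base_ne hK ?_ (by simp [TProc.bn]) ?_
    · rw [hmap]; exact use_rIn rfl hΓ (deg_pos _ _) rfl
    · rintro _ x rfl; exact not_isSession_rprop rfl
    · intro Γ' Ξ' hΓ' _
      have h0 : TTyped Γ' Ξ' (lenv (ty E π) ∅) .nil := by
        rw [lenv_eq_empty (by simp)]; exact .nil
      have hx : ∀ x ∈ {x | x ∈ xs} ∪ ({rIn k} : Set TName), (ty E π x).isSession = true →
          x ∈ xs := by
        rintro x (hx | rfl) hs
        · exact hx
        · exact absurd hs (not_isSession_rprop rfl)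
      refine h0.weaken_list (by simp) xs (fun x h1 _ h2 => hx x h1 h2) fun x h1 _ hs => ?_
      obtain ⟨v, hv, hxv⟩ := (h.comp.2 x).1 (hx x h1 hs)
      have hcov := covers_of_bind h.comp hΓ' v hv x hxv
      rw [ty_of_base (base_ne_none_of_mem_names hxv)] at hs ⊢
      refine ⟨cty_of_drop hxv (h.drop v hv ?_) hs, by rw [hcov, MTy.shOf_eq_none hs]⟩
      rintro (h' | ⟨_, _, -, h', -⟩)
      · simp [SProc.fn] at h'
      · simp [SProc.occ] at h'
  convert typed_add_prop rfl hΓ (deg_pos _ _) ht using 1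
  refine lenv_ext fun x hx => ?_
  obtain ⟨_ | j | j | j, b⟩ := x <;> cases b <;>
    simp [recProps, propsIn, pidx, deg, rIn] <;> omega

/-- The trio of the recursion variable returns the parameters to the loop on `c^r_X`. They have the
same components and types as at the start of the recursion, since they are stable. -/
theorem brec_pvar {E : Ctx} {lin : Bool} {k : ℕ} {U : Set Name} {xs : List TName}
    (hms : Comp E₀ {v | v ∈ M} ms)
    (h : RecInv X M E₀ E lin U xs (.pvar X)) : BrecTyped X ms E₀ E lin k xs (.pvar X) := by
  have ho : (SProc.pvar X).occ X ≠ 0 := by simp [SProc.occ]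
  refine ⟨fun _ => .ofMode lin (xs.map (cty E)), rfl, fun Γ Ξ hΓ hX => ?_⟩
  set π : ℕ → Kind := fun _ => .ofMode lin (xs.map (cty E)) with hπ
  have hK : ∀ x ∈ ({rIn k} : Set TName), base x = none := by rintro x rfl; rfl
  have hmap : xs.map (ty E π) = xs.map (cty E) := map_ty h.comp.base_ne
  have hst := h.stable ho
  have hMU : ∀ v ∈ M, v ∈ U := fun v hv => h.live v (.inr ⟨X, M, rfl, ho, hv⟩)
  have hmsx : ∀ x ∈ ms, ∃ v ∈ M, x ∈ E.names v ∧ cty E x = cty E₀ x := fun x hx => by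
    obtain ⟨v, hv, hxv⟩ := (hms.2 x).1 hx
    exact ⟨v, hv, by rwa [(hst v hv).names],
      cty_congr (hst v hv).2.1 (hst v hv).2.2 (base_of_mem_names hxv)⟩
  have hmsmap : ms.map (ty E π) = ms.map (cty E₀) := by
    rw [map_ty hms.base_ne]
    exact List.map_congr_left fun x hx => by obtain ⟨v, -, -, h⟩ := hmsx x hx; exact h
  have ht : TTyped Γ Ξ (lenv (ty E π) {rIn k}) (Brec X ms E lin k xs (.pvar X)) := by
    refine typed_trio ?_ h.comp.1 h.comp.base_ne hK ?_ ?_ ?_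
    · rw [hmap]; exact use_rIn rfl hΓ (deg_pos _ _) rfl
    · rintro rfl x rfl; exact not_isSession_rprop rfl
    · cases lin <;> simp [TProc.bn]
    · intro Γ' Ξ' hΓ' hX'
      have hcov := covers_of_bind h.comp hΓ'
      have h1 : TTyped Γ' Ξ' (lenv (ty E π) {rIn k}) (if lin then .pvar X else .nil) := by
        cases hlin : lin
        · rw [lenv_eq_empty]
          · exact .nil
          · rintro x rfl; subst hlin; exact not_isSession_rprop rfl
        · exact .pvar hX'
      have h2 : TTyped Γ' Ξ' (lenv (ty E π) {x | x ∈ ms ∨ x = rIn k})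
          (.out (rX X) ms (if lin then .pvar X else .nil)) := by
        refine TTyped.send_use (W := ∅) h1 (.inr (.inr ⟨?_, rfl⟩)) hms.1 ?_ ?_ ?_
        · rw [hmsmap, ← hX]
          exact sameProps_bind h.comp.base_ne hΓ' _ rfl
        · intro x hx
          obtain ⟨v, hv, hxv, -⟩ := hmsx x hx
          rw [hcov v (hMU v hv) x hxv, ty_of_base (base_ne_none_of_mem_names hxv)]
        · intro x hx _
          exact ⟨fun h' => hms.base_ne x hx (hK x h'), fun h' => h'⟩
        · intro x _
          simp only [Set.mem_ofPred_eq, Set.mem_empty_iff_false, false_or, Set.mem_singleton_iff]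
          exact or_comm
      refine h2.weaken_list ?_ xs ?_ ?_
      · rintro x (hx | rfl) _
        · obtain ⟨v, hv, hxv, -⟩ := hmsx x hx
          exact .inl ((h.comp.2 x).2 ⟨v, hMU v hv, hxv⟩)
        · exact .inr rfl
      · rintro x (hx | hx) hA _
        · exact hx
        · exact absurd (.inr hx) hA
      · rintro x (hx | hx) hA hs
        · obtain ⟨v, hv, hxv⟩ := (h.comp.2 x).1 hx
          rw [ty_of_base (base_ne_none_of_mem_names hxv)] at hs ⊢
          refine ⟨cty_of_drop hxv (h.drop v hv ?_) hs, by
            rw [hcov v hv x hxv, MTy.shOf_eq_none hs]⟩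
          rintro (h' | ⟨_, _, h3, -, h'⟩)
          · simp [SProc.fn] at h'
          · cases h3
            exact hA (.inl ((hms.2 x).2 ⟨v, h', by rwa [← (hst v h').names]⟩))
        · exact absurd (.inr hx) hA
  convert typed_add_prop rfl hΓ (deg_pos _ _) ht using 1
  refine lenv_ext fun x hx => ?_
  obtain ⟨_ | j | j | j, b⟩ := x <;> cases b <;>
    simp [recProps, propsIn, pidx, deg, rIn] <;> omega

/-- The endpoints of propagators which a trio with one successor uses. -/
def trioProps (k : ℕ) : Set TName := {x | x = rIn k ∨ x = (.rprop (k + 1), true)}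

theorem base_of_mem_trioProps {k : ℕ} {x : TName} (h : x ∈ trioProps k) : base x = none := by
  rcases h with rfl | rfl <;> rfl

/-- The breakdown of a process with one continuation is typable if its first trio and the
breakdown of the continuation are. -/
theorem brec_step {E E' : Ctx} {lin : Bool} {k : ℕ} {xs ys : List TName} {P Q : SProc}
    {T : TProc} (hdeg : deg true P = deg true Q + 1)
    (hB : Brec X ms E lin k xs P = .par T (Brec X ms E' lin (k + 1) ys Q))
    (ih : BrecTyped X ms E₀ E' lin (k + 1) ys Q)
    (hT : ∀ (π : ℕ → Kind) Γ Ξ, π k = .ofMode lin (xs.map (cty E)) →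
      π (k + 1) = .ofMode lin (ys.map (cty E')) → PropsOK Γ π k (deg true P) →
      TTyped Γ Ξ (lenv (ty E π) (trioProps k)) T) :
    BrecTyped X ms E₀ E lin k xs P := by
  obtain ⟨π₁, h1, h2⟩ := ih
  have hpos := deg_pos true Q
  refine ⟨fun j => if j = k then .ofMode lin (xs.map (cty E)) else π₁ j, by simp,
    fun Γ Ξ hΓ hX => ?_⟩
  set π : ℕ → Kind := fun j => if j = k then .ofMode lin (xs.map (cty E)) else π₁ j with hπ
  have hπk : π k = .ofMode lin (xs.map (cty E)) := by simp [hπ]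
  have hπ₁ : ∀ j, k + 1 ≤ j → π j = π₁ j := fun j hj => by
    rw [hπ]; simp only; rw [if_neg (by omega)]
  have hrest := h2 Γ Ξ (hΓ.sub (by omega) (by omega) fun j hj _ => hπ₁ j hj) hX
  rw [lenv_ty_congr (E' := E) (π' := π) (fun x => base_of_mem_recProps) (fun x hx j hj => by
    obtain ⟨⟨i, hi, h3, -⟩, -⟩ := hx
    rw [hj] at hi; cases hi
    exact (hπ₁ j h3).symm)] at hrest
  have htrio := typed_add_prop hπk hΓ (by omega)
    (hT π Γ Ξ hπk (by rw [hπ₁ _ le_rfl, h1]) hΓ)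
  rw [hB]
  refine htrio.par_lenv hrest (fun x _ => ?_) (fun x _ => ?_)
  · rw [hdeg]
    obtain ⟨_ | j | j | j, b⟩ := x <;> cases b <;>
      simp [recProps, propsIn, pidx, rIn, trioProps] <;> omega
  · obtain ⟨_ | j | j | j, b⟩ := x <;> cases b <;>
      simp [recProps, propsIn, pidx, rIn, trioProps] <;> omega

theorem not_isSession_trioProps {E : Ctx} {π : ℕ → Kind} {k : ℕ} {ps qs : List MTy} {lin : Bool}
    (h1 : π k = .ofMode lin ps) (h2 : π (k + 1) = .ofMode lin qs) (hl : lin = false) :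
    ∀ x ∈ trioProps k, ¬ (ty E π x).isSession = true := by
  subst hl
  rintro x (rfl | rfl)
  · exact not_isSession_rprop h1
  · exact not_isSession_rprop h2

theorem brec_out {E : Ctx} {lin : Bool} {k : ℕ} {U : Set Name} {xs : List TName}
    {u z : Name} {Q : SProc} (hms : Comp E₀ {v | v ∈ M} ms)
    (h : RecInv X M E₀ E lin U xs (.out u z Q))
    (ih : BrecTyped X ms E₀ (E.next u) lin (k + 1) (keep X ms Q (minus xs (E.used u))) Q) :
    BrecTyped X ms E₀ E lin k xs (.out u z Q) := by
  refine brec_step (P := .out u z Q) rfl rfl ih fun π Γ Ξ hπ hπ' hΓ => ?_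
  obtain ⟨ha, hs, hz, hzl, -⟩ := h.good
  have hQ := h.out hms
  set ys := keep X ms Q (minus xs (E.used u)) with hys
  have hu : u ∈ U := h.live u (.inl (by simp [SProc.fn]))
  have hzU : z ∈ U := h.live z (.inl (by simp [SProc.fn]))
  have hlast := not_live_of_last ha hs h.stable
  have hV : ∀ v, v ∈ {v | Live (some (X, M)) Q v} ↔ v ∈ U ∧ Live (some (X, M)) Q v := by
    intro v
    refine ⟨fun hv => ⟨h.live v ?_, hv⟩, fun hv => hv.2⟩
    rcases hv with hv | hv
    · exact .inl (by simp [SProc.fn, hv])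
    · exact .inr hv
  have hof := fun x => Comp.of_next (x := x) ha hlast hQ.comp hV
  refine typed_trio ?_ h.comp.1 h.comp.base_ne (fun x => base_of_mem_trioProps) ?_ ?_ ?_
  · rw [map_ty h.comp.base_ne]; exact use_rIn hπ hΓ (deg_pos _ _) (.inl rfl)
  · exact not_isSession_trioProps hπ hπ'
  · simp [TProc.bn, bn_fwd]
  · intro Γ' Ξ' hΓ' hX'
    have hcov := covers_of_bind h.comp hΓ'
    have hmapy : ys.map (ty E π) = ys.map (cty (E.next u)) := by
      rw [map_ty hQ.comp.base_ne]
      exact List.map_congr_left fun x hx => (hof x hx).2.2.symm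
    have htail : TTyped Γ' Ξ' (lenv (ty E π) ({x | x ∈ ys} ∪ trioProps k))
        (fwd X lin (k + 1) ys) := by
      refine typed_fwd ?_ hQ.comp.1 hQ.comp.base_ne (fun x => base_of_mem_trioProps) ?_
        (fun _ => hX') (not_isSession_trioProps hπ hπ')
      · rw [hmapy]
        exact use_rOut hπ' (hΓ.same (sameProps_bind h.comp.base_ne hΓ')) (by omega)
          (by have := deg_pos true Q; simp only [deg]; omega) fun _ => .inr rfl
      · intro x hx
        obtain ⟨⟨v, hv, hxv, -⟩, -⟩ := hof x hx
        rw [hcov v hv x hxv, ty_of_base (base_ne_none_of_mem_names hxv)]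
    have := typed_output ha hs hlast hz hzl h.drop (fun _ => hu) h.comp hQ.comp hV
      (fun x => base_of_mem_trioProps) (fun v hv => hcov v (by
        rcases hv with hv | rfl | rfl
        · exact hv
        · exact hu
        · exact hzU)) htail
    convert this using 1
    refine lenv_ext fun x _ => ?_
    constructor
    · rintro (hx | hx)
      · exact .inl hx
      · exact .inr (.inr (.inr hx))
    · rintro (hx | hx | hx | hx)
      · exact .inl hx
      · exact .inl ((h.comp.2 x).2 ⟨z, hzU, hx⟩)
      · exact .inl ((h.comp.2 x).2 ⟨u, hu, ha.used_mem hx⟩)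
      · exact .inr hx

theorem brec_inp {E : Ctx} {lin : Bool} {k : ℕ} {U : Set Name} {xs : List TName}
    {u : Name} {y : ℕ} {Q : SProc} (hms : Comp E₀ {v | v ∈ M} ms)
    (h : RecInv X M E₀ E lin U xs (.inp u y Q))
    (ih : BrecTyped X ms E₀ ((E.next u).bind (y, false) (E.payload u)) lin (k + 1)
      (keep X ms Q (minus (xs ++ ((E.next u).bind (y, false) (E.payload u)).names (y, false))
        (E.used u))) Q) :
    BrecTyped X ms E₀ E lin k xs (.inp u y Q) := by
  refine brec_step (P := .inp u y Q) rfl rfl ih fun π Γ Ξ hπ hπ' hΓ => ?_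
  obtain ⟨ha, hs, hy, -⟩ := h.good
  have hQ := h.inp hms
  simp only at hQ
  set E' := (E.next u).bind (y, false) (E.payload u) with hE'
  set ys := keep X ms Q (minus (xs ++ E'.names (y, false)) (E.used u)) with hys
  have hu : u ∈ U := h.live u (.inl (by simp [SProc.fn]))
  have hyU : (y, false) ∉ U := fun hy => h.fresh _ hy List.mem_cons_self
  have huy : u ≠ (y, false) := by rintro rfl; exact hyU hu
  have hlast := not_live_of_last ha hs h.stable
  have hV : ∀ v, v ∈ {v | Live (some (X, M)) Q v} ↔
      (v ∈ U ∨ v = (y, false)) ∧ Live (some (X, M)) Q v := by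
    intro v
    refine ⟨fun hv => ⟨?_, hv⟩, fun hv => hv.2⟩
    by_cases hvy : v = (y, false)
    · exact .inr hvy
    · exact .inl (h.live v (Live.of_inp hv hvy))
  set E₁ := E.bind (y, false) (E.payload u) with hE₁
  have hEE : E' = E₁.next u := next_bind E _ huy
  have ha₁ : Acts E₁ u .inp := by unfold Acts; rw [hE₁, bind_of_ne E _ huy]; exact ha
  have hlast₁ : Last E₁ u → ¬ Live (some (X, M)) Q u := by
    unfold Last; rw [hE₁, bind_of_ne E _ huy]; exact hlast
  have hcomp₁ : Comp (E₁.next u) {v | Live (some (X, M)) Q v} ys := by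
    rw [← hEE]; exact hQ.comp
  have hof := fun x => Comp.of_next (x := x) (U := {v | v ∈ U ∨ v = (y, false)}) ha₁ hlast₁
    hcomp₁ hV
  refine typed_trio ?_ h.comp.1 h.comp.base_ne (fun x => base_of_mem_trioProps) ?_ ?_ ?_
  · rw [map_ty h.comp.base_ne]; exact use_rIn hπ hΓ (deg_pos _ _) (.inl rfl)
  · exact not_isSession_trioProps hπ hπ'
  · intro x hx
    simp only [TProc.bn, bn_fwd, List.append_nil] at hx
    refine ⟨base_ne_none_of_mem_names hx, ?_⟩
    by_cases hxu : x = E.subj u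
    · exact .inr ((h.comp.2 x).2 ⟨u, hu, by rw [hxu]; exact ha.subj_mem⟩)
    · left
      simp only [TProc.fn, List.mem_cons, hxu, false_or, List.mem_filter, decide_eq_true_eq]
      exact fun h => h.2 hx
  · intro Γ' Ξ' hΓ' hX'
    have hcov := covers_of_bind h.comp hΓ'
    have hsame := sameProps_bind h.comp.base_ne hΓ'
    have hmapy : ys.map (ty E₁ π) = ys.map (cty E') := by
      rw [map_ty hQ.comp.base_ne, hEE]
      exact List.map_congr_left fun x hx => (hof x hx).2.2.symm
    have hlenv : lenv (ty E π) (trioProps k) = lenv (ty E₁ π) (trioProps k) :=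
      lenv_ty_congr (fun x => base_of_mem_trioProps) fun _ _ _ _ => rfl
    have htail : ∀ Γ₂ : TShEnv, (∀ x, base x ≠ some (y, false) → Γ₂ x = Γ' x) →
        (∀ x ∈ E₁.names (y, false), Γ₂ x = (cty E₁ x).shOf) →
        TTyped Γ₂ Ξ' (lenv (ty E₁ π) ({x | x ∈ ys} ∪ trioProps k)) (fwd X lin (k + 1) ys) := by
      intro Γ₂ hΓ₂ hΓ₂y
      refine typed_fwd ?_ hQ.comp.1 hQ.comp.base_ne (fun x => base_of_mem_trioProps) ?_
        (fun _ => by rw [← hlenv]; exact hX') (not_isSession_trioProps hπ hπ')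
      · rw [hmapy]
        exact use_rOut hπ' ((hΓ.same hsame).same fun x hx => hΓ₂ x (by simp [hx])) (by omega)
          (by have := deg_pos true Q; simp only [deg]; omega) fun _ => .inr rfl
      · intro x hx
        obtain ⟨⟨v, hv, hxv, -⟩, -⟩ := hof x hx
        rw [ty_of_base (base_ne_none_of_mem_names hxv)]
        by_cases hvy : v = (y, false)
        · subst hvy; exact hΓ₂y x hxv
        · have hb : base x ≠ some (y, false) := by
            rw [base_of_mem_names hxv]; simpa using hvy
          rw [hΓ₂ x hb, hE₁, cty_bind_of_ne E _ hb]
          exact hcov v (hv.resolve_right hvy) x (by rwa [hE₁, names_bind_of_ne E _ hvy] at hxv)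
    have := typed_input (xs := xs) ha hs hlast hy h.drop hyU huy (fun _ => hu) h.comp hQ.comp hV
      (fun x => base_of_mem_trioProps) (fun v hv => hcov v (by
        rcases hv with hv | rfl
        · exact hv
        · exact hu)) htail
    convert this using 1
    refine lenv_ext fun x _ => ?_
    constructor
    · rintro (hx | hx)
      · exact .inl hx
      · exact .inr (.inr hx)
    · rintro (hx | hx | hx)
      · exact .inl hx
      · exact .inl ((h.comp.2 x).2 ⟨u, hu, ha.used_mem hx⟩)
      · exact .inr hx

/-- The restriction is inside the recursion of its trio: each round has fresh names. -/
theorem brec_res {E : Ctx} {lin : Bool} {k : ℕ} {U : Set Name} {xs : List TName}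
    {s : ℕ} {C : STy} {Q : SProc} (h : RecInv X M E₀ E lin U xs (.res s C Q))
    (ih : BrecTyped X ms E₀ (E.bindRes s C) lin (k + 1) (xs ++ resNames E s C) Q) :
    BrecTyped X ms E₀ E lin k xs (.res s C Q) := by
  refine brec_step (P := .res s C Q) (by simp [deg]) rfl ih fun π Γ Ξ hπ hπ' hΓ => ?_
  obtain ⟨hC, -⟩ := h.good
  have hQ := h.res
  have hs : ∀ v ∈ U, v.1 ≠ s := fun v hv hv' => h.fresh v hv (by
    rw [hv']; exact List.mem_cons_self)
  change TTyped Γ Ξ _ (.mu X (nus s C (.inp (rIn k) xs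
    (if lin then fwd X lin (k + 1) (xs ++ resNames E s C)
      else .par (fwd X lin (k + 1) (xs ++ resNames E s C)) (.pvar X)))))
  set ys := xs ++ resNames E s C with hys
  set E' := E.bindRes s C with hE'
  have hxb : ∀ x ∈ xs, ∀ b, base x ≠ some (s, b) := fun x hx b hb => by
    obtain ⟨v, hv, hxv⟩ := (h.comp.2 x).1 hx
    rw [base_of_mem_names hxv] at hb
    cases hb; exact hs _ hv rfl
  have hcty : ∀ x ∈ xs, cty E' x = cty E x := fun x hx => by
    have h1 := hxb x hx
    rw [hE', Ctx.bindRes, cty_bind_of_ne _ _ (h1 true), cty_bind_of_ne _ _ (h1 false)]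
  have hlenv : lenv (ty E π) (trioProps k) = lenv (ty E' π) (trioProps k) :=
    lenv_ty_congr (fun x => base_of_mem_trioProps) fun _ _ _ _ => rfl
  rw [hlenv]
  have hX' : (Ξ.set X (lenv (ty E' π) (trioProps k))) X =
      some (lenv (ty E' π) (trioProps k)) := by simp [Env.set]
  have hmapx : xs.map (ty E' π) = xs.map (cty E) := by
    rw [map_ty h.comp.base_ne]; exact List.map_congr_left hcty
  refine TTyped.mu (typed_nus hC (fun x hx b => by simp [base_of_mem_trioProps hx]) ?_) ?_
  · intro Γ₁ hΓ₁ hΓ₁s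
    have hsame₁ : SameProps Γ Γ₁ := fun x hx => hΓ₁ x fun b => by simp [hx]
    refine typed_trio_body (K := trioProps k) ?_ h.comp.1 h.comp.base_ne ?_
      (not_isSession_trioProps hπ hπ') hX' ?_
    · rw [hmapx]
      exact use_rIn hπ (hΓ.same hsame₁) (deg_pos _ _) (.inl (.inl rfl))
    · rintro x hx (h1 | ⟨b, -, h1⟩)
      · exact h.comp.base_ne x hx (base_of_mem_trioProps h1)
      · exact hxb x hx b (base_of_mem_names h1)
    · intro Γ₂ hΓ₂
      have hsame₂ := sameProps_bind h.comp.base_ne hΓ₂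
      have := typed_fwd (Γ := Γ₂) (Ξ := Ξ.set X (lenv (ty E' π) (trioProps k))) (X := X)
        (lin := lin) (k := k + 1) (ys := ys) (τ := ty E' π) (K := trioProps k) ?_ hQ.comp.1
        hQ.comp.base_ne (fun x => base_of_mem_trioProps) ?_ (fun _ => hX')
        (not_isSession_trioProps hπ hπ')
      · convert this using 1
        refine lenv_ext fun x _ => ?_
        simp only [hys, Set.mem_union, Set.mem_ofPred_eq, List.mem_append, mem_resNames, or_assoc]
        exact or_congr_right or_comm
      · rw [map_ty hQ.comp.base_ne]
        exact use_rOut hπ' ((hΓ.same hsame₁).same hsame₂) (by omega)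
          (by have := deg_pos true Q; simp [deg]; omega) fun _ => .inr rfl
      · intro x hx
        rw [hΓ₂ x]
        split_ifs with hxs
        · rfl
        · have hx := (List.mem_append.1 hx).resolve_left hxs
          obtain ⟨b, hb, hxb⟩ := mem_resNames.1 hx
          rw [ty_of_base (base_ne_none_of_mem_names hxb)]
          exact hΓ₁s b hb x hxb
  · intro y hy
    have key := bn_nus (s := s) (C := C) (P := .inp (rIn k) xs
      (if lin then fwd X lin (k + 1) ys else .par (fwd X lin (k + 1) ys) (.pvar X))) ?_ y hy
    · exact ⟨key.1, lenv_of_notMem fun h' => key.2 (base_of_mem_trioProps h')⟩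
    · intro x hx
      have hx : x ∈ xs := by
        cases lin <;> simpa [TProc.bn, bn_fwd] using hx
      refine ⟨?_, h.comp.base_ne x hx⟩
      simp only [TProc.fn, List.mem_cons, List.mem_filter, decide_eq_true_eq]
      rintro (rfl | ⟨-, h'⟩)
      · exact h.comp.base_ne _ hx rfl
      · exact h' hx

/-- The endpoints of propagators which a trio with two successors uses. -/
def forkProps (k l : ℕ) : Set TName :=
  {x | x = rIn k ∨ x = (.rprop (k + 1), true) ∨ x = (.rprop (k + l + 1), true)}

theorem base_of_mem_forkProps {k l : ℕ} {x : TName} (h : x ∈ forkProps k l) : base x = none := by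
  rcases h with rfl | rfl | rfl <;> rfl

/-- The trio with two successors. The received components of linear names are divided between the
two parts, as no linear name is live in both. -/
theorem typed_fork {E : Ctx} {π : ℕ → Kind} {Γ : TShEnv} {Ξ : TRecEnv} {lin lQ lR : Bool}
    {k l n : ℕ} {U : Set Name} {xs ys zs : List TName} {Q R : SProc} (hl : l + 1 < n)
    (hmode : (lQ = lin ∧ lR = false) ∨ (lQ = false ∧ lR = lin))
    (h : RecInv X M E₀ E lin U xs (.par Q R))
    (hQ : Comp E {v | Live (some (X, M)) Q v} ys) (hR : Comp E {v | Live (some (X, M)) R v} zs)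
    (hπk : π k = .ofMode lin (xs.map (cty E))) (hπQ : π (k + 1) = .ofMode lQ (ys.map (cty E)))
    (hπR : π (k + l + 1) = .ofMode lR (zs.map (cty E))) (hΓ : PropsOK Γ π k n) :
    TTyped Γ Ξ (lenv (ty E π) (forkProps k l))
      (trio X lin k xs (.par (fwd X lQ (k + 1) ys) (fwd X lR (k + l + 1) zs))) := by
  obtain ⟨hd, -, -⟩ := h.good
  -- The part in the linear mode gets the linear propagators.
  have hsplit : ∃ K₁ K₂ : Set TName, (∀ x, x ∈ forkProps k l ↔ x ∈ K₁ ∨ x ∈ K₂) ∧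
      (∀ x ∈ K₁, x ∉ K₂) ∧
      (lQ = true → K₁ = forkProps k l) ∧ (lR = true → K₂ = forkProps k l) ∧
      (lQ = false → ∀ x ∈ K₁, ¬ (ty E π x).isSession = true) ∧
      (lR = false → ∀ x ∈ K₂, ¬ (ty E π x).isSession = true) := by
    have hns : lin = false → ∀ x ∈ forkProps k l, ¬ (ty E π x).isSession = true := by
      intro hl
      have hQR : lQ = false ∧ lR = false := by
        subst hl; rcases hmode with h | h <;> exact h
      obtain ⟨rfl, rfl⟩ := hQR
      subst hl
      rintro x (rfl | rfl | rfl)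
      · exact not_isSession_rprop hπk
      · exact not_isSession_rprop hπQ
      · exact not_isSession_rprop hπR
    rcases hmode with ⟨h, h'⟩ | ⟨h, h'⟩
    · exact ⟨forkProps k l, ∅, by simp, by simp, fun _ => rfl, fun h'' => by simp [h'] at h'',
        fun h'' => hns (by rw [← h, h'']), by simp⟩
    · exact ⟨∅, forkProps k l, by simp, by simp, fun h'' => by simp [h] at h'', fun _ => rfl,
        by simp, fun h'' => hns (by rw [← h', h''])⟩
  obtain ⟨K₁, K₂, hK, hK12, hQ1, hR1, hQ2, hR2⟩ := hsplit
  have hb1 : ∀ x ∈ K₁, base x = none := fun x hx => base_of_mem_forkProps ((hK x).2 (.inl hx))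
  have hb2 : ∀ x ∈ K₂, base x = none := fun x hx => base_of_mem_forkProps ((hK x).2 (.inr hx))
  have hsub1 : ∀ x ∈ ys, x ∈ xs := fun x hx => by
    obtain ⟨v, hv, hxv⟩ := (hQ.2 x).1 hx
    exact (h.comp.2 x).2 ⟨v, h.live v hv.par_left, hxv⟩
  have hsub2 : ∀ x ∈ zs, x ∈ xs := fun x hx => by
    obtain ⟨v, hv, hxv⟩ := (hR.2 x).1 hx
    exact (h.comp.2 x).2 ⟨v, h.live v hv.par_right, hxv⟩
  refine typed_trio ?_ h.comp.1 h.comp.base_ne (fun x => base_of_mem_forkProps) ?_ ?_ ?_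
  · rw [map_ty h.comp.base_ne]; exact use_rIn hπk hΓ (by omega) (.inl rfl)
  · intro hl x hx
    have hQR : lQ = false ∧ lR = false := by
      subst hl; rcases hmode with h | h <;> exact h
    rcases (hK x).1 hx with hx | hx
    · exact hQ2 hQR.1 x hx
    · exact hR2 hQR.2 x hx
  · simp [TProc.bn, bn_fwd]
  · intro Γ' Ξ' hΓ' hX'
    have hΓp := hΓ.same (sameProps_bind h.comp.base_ne hΓ')
    have hcov : ∀ x ∈ xs, Γ' x = (ty E π x).shOf := fun x hx => by rw [hΓ' x, if_pos hx]
    have t1 := typed_fwd (Ξ := Ξ') (X := X) (τ := ty E π) (K := K₁) (lin := lQ) (k := k + 1)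
      (by rw [map_ty hQ.base_ne]
          exact use_rOut hπQ hΓp (by omega) (by omega) fun hq => by
            rw [hQ1 hq]; exact .inr (.inl rfl))
      hQ.1 hQ.base_ne hb1 (fun y hy => hcov y (hsub1 y hy))
      (fun hq => by rw [hX', hQ1 hq]) hQ2
    have t2 := typed_fwd (Ξ := Ξ') (X := X) (τ := ty E π) (K := K₂) (lin := lR)
      (k := k + l + 1)
      (by rw [map_ty hR.base_ne]
          exact use_rOut hπR hΓp (by omega) (by omega) fun hq => by
            rw [hR1 hq]; exact .inr (.inr rfl))
      hR.1 hR.base_ne hb2 (fun y hy => hcov y (hsub2 y hy))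
      (fun hq => by rw [hX', hR1 hq]) hR2
    have t := t1.par_lenv t2 (L := {x | (x ∈ ys ∨ x ∈ zs) ∨ x ∈ forkProps k l})
      (fun x _ => by
        simp only [Set.mem_ofPred_eq, Set.mem_union, hK x]
        exact or_or_or_comm) ?_
    · refine t.weaken_list ?_ xs ?_ ?_
      · rintro x ((hx | hx) | hx) _
        · exact .inl (hsub1 x hx)
        · exact .inl (hsub2 x hx)
        · exact .inr hx
      · rintro x (hx | hx) hA _
        · exact hx
        · exact absurd (.inr hx) hA
      · rintro x (hx | hx) hA hs
        · obtain ⟨v, hv, hxv⟩ := (h.comp.2 x).1 hx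
          rw [hcov x hx, MTy.shOf_eq_none hs]
          rw [ty_of_base (base_ne_none_of_mem_names hxv)] at hs ⊢
          refine ⟨cty_of_drop hxv (h.drop v hv fun hlv => hA (.inl ?_)) hs, rfl⟩
          rcases hlv.of_par with hlv | hlv
          · exact .inl ((hQ.2 x).2 ⟨v, hlv, hxv⟩)
          · exact .inr ((hR.2 x).2 ⟨v, hlv, hxv⟩)
        · exact absurd (.inr hx) hA
    · intro x hs hx hx'
      rw [Set.mem_union, Set.mem_ofPred_eq] at hx hx'
      rcases hx with hx | hx <;> rcases hx' with hx' | hx'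
      · obtain ⟨v, hv, hxv⟩ := (hQ.2 x).1 hx
        obtain ⟨w, hw, hxw⟩ := (hR.2 x).1 hx'
        obtain rfl := eq_of_mem_names hxv hxw
        rw [ty_of_base (base_ne_none_of_mem_names hxv)] at hs
        exact hd v (isSession_of_cty hxv hs) hv hw
      · exact hQ.base_ne x hx (hb2 x hx')
      · exact hR.base_ne x hx' (hb1 x hx)
      · exact hK12 x hx hx'

theorem brec_par {E : Ctx} {lin : Bool} {k : ℕ} {U : Set Name} {xs : List TName}
    {Q R : SProc} (hms : Comp E₀ {v | v ∈ M} ms)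
    (h : RecInv X M E₀ E lin U xs (.par Q R))
    (ihQ : BrecTyped X ms E₀ E (lin && decide (Q.occ X ≠ 0)) (k + 1) (keep X ms Q xs) Q)
    (ihR : BrecTyped X ms E₀ E (lin && decide (R.occ X ≠ 0)) (k + deg true Q + 1)
      (keep X ms R xs) R) :
    BrecTyped X ms E₀ E lin k xs (.par Q R) := by
  obtain ⟨hQ, hR⟩ := h.par hms
  have hocc : (SProc.par Q R).occ X = Q.occ X + R.occ X := rfl
  -- At most one of the two parts is in the linear mode, and it is the one with the variable.
  have hmode : ((lin && decide (Q.occ X ≠ 0)) = lin ∧ (lin && decide (R.occ X ≠ 0)) = false) ∨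
      ((lin && decide (Q.occ X ≠ 0)) = false ∧ (lin && decide (R.occ X ≠ 0)) = lin) := by
    cases hl : lin
    · simp
    · have := h.lin_occ hl
      rw [hocc] at this
      by_cases h0 : Q.occ X = 0
      · right; simp [h0]; omega
      · left; simp [h0]; omega
  have hB : Brec X ms E lin k xs (.par Q R) = .par
      (trio X lin k xs (.par (fwd X (lin && decide (Q.occ X ≠ 0)) (k + 1) (keep X ms Q xs))
        (fwd X (lin && decide (R.occ X ≠ 0)) (k + deg true Q + 1) (keep X ms R xs))))
      (.par (Brec X ms E (lin && decide (Q.occ X ≠ 0)) (k + 1) (keep X ms Q xs) Q)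
        (Brec X ms E (lin && decide (R.occ X ≠ 0)) (k + deg true Q + 1) (keep X ms R xs) R)) :=
    rfl
  unfold BrecTyped
  rw [hB]
  generalize (lin && decide (Q.occ X ≠ 0)) = lQ at *
  generalize (lin && decide (R.occ X ≠ 0)) = lR at *
  generalize hys : keep X ms Q xs = ys at *
  generalize hzs : keep X ms R xs = zs at *
  obtain ⟨π₁, h1, h1'⟩ := ihQ
  obtain ⟨π₂, h2, h2'⟩ := ihR
  have hposQ := deg_pos true Q
  have hposR := deg_pos true R
  have hdeg : deg true (.par Q R) = deg true Q + deg true R + 1 := rfl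
  refine ⟨fun j => if j = k then .ofMode lin (xs.map (cty E)) else
    if j < k + deg true Q + 1 then π₁ j else π₂ j, by simp, fun Γ Ξ hΓ hX => ?_⟩
  set π : ℕ → Kind := fun j => if j = k then .ofMode lin (xs.map (cty E)) else
    if j < k + deg true Q + 1 then π₁ j else π₂ j with hπ
  rw [hdeg] at hΓ ⊢
  set l := deg true Q with hl
  have hπk : π k = .ofMode lin (xs.map (cty E)) := by simp [hπ]
  have hπ₁ : ∀ j, k + 1 ≤ j → j < k + 1 + l → π j = π₁ j := fun j hj hj' => by
    rw [hπ]; simp only; rw [if_neg (by omega), if_pos (by omega)]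
  have hπ₂ : ∀ j, k + l + 1 ≤ j → π j = π₂ j := fun j hj => by
    rw [hπ]; simp only; rw [if_neg (by omega), if_neg (by omega)]
  have hπQ : π (k + 1) = .ofMode lQ (ys.map (cty E)) := by
    rw [hπ₁ _ le_rfl (by omega), h1]
  have hπR : π (k + l + 1) = .ofMode lR (zs.map (cty E)) := by rw [hπ₂ _ le_rfl, h2]
  have hrestQ := h1' Γ Ξ (hΓ.sub (by omega) (by omega) hπ₁) hX
  rw [lenv_ty_congr (E' := E) (π' := π) (fun x => base_of_mem_recProps) (fun x hx j hj => by
    obtain ⟨⟨i, hi, h3, h4⟩, -⟩ := hx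
    rw [hj] at hi; cases hi
    exact (hπ₁ j h3 h4).symm)] at hrestQ
  have hrestR := h2' Γ Ξ (hΓ.sub (by omega) (by omega) fun j hj _ => hπ₂ j hj) hX
  rw [lenv_ty_congr (E' := E) (π' := π) (fun x => base_of_mem_recProps) (fun x hx j hj => by
    obtain ⟨⟨i, hi, h3, -⟩, -⟩ := hx
    rw [hj] at hi; cases hi
    exact (hπ₂ j h3).symm)] at hrestR
  have htrio := typed_fork (Ξ := Ξ) (by omega) hmode h hQ.comp hR.comp hπk hπQ hπR hΓ
  refine (typed_add_prop hπk hΓ (by omega) htrio).par_lenv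
    (hrestQ.par_lenv hrestR (L := {x | x ∈ recProps (k + 1) l ∨
      x ∈ recProps (k + l + 1) (deg true R)}) (fun _ _ => Iff.rfl) fun x _ => ?_)
    (fun x _ => ?_) (fun x _ => ?_)
  · obtain ⟨_ | j | j | j, b⟩ := x <;> cases b <;>
      simp [recProps, propsIn, pidx] <;> omega
  · obtain ⟨_ | j | j | j, b⟩ := x <;> cases b <;>
      simp [recProps, propsIn, pidx, rIn, forkProps] <;> omega
  · obtain ⟨_ | j | j | j, b⟩ := x <;> cases b <;>
      simp [recProps, propsIn, pidx, rIn, forkProps] <;> omega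

/-- The breakdown of a part of the body of a recursion is typable. -/
theorem brec_typed (hms : Comp E₀ {v | v ∈ M} ms) (Q : SProc) :
    ∀ {E : Ctx} {lin : Bool} {k : ℕ} {U : Set Name} {xs : List TName},
      RecInv X M E₀ E lin U xs Q → BrecTyped X ms E₀ E lin k xs Q := by
  induction Q with
  | nil => exact brec_nil
  | out u z Q ih => exact fun h => brec_out hms h (ih (h.out hms))
  | inp u y Q ih => exact fun h => brec_inp hms h (ih (h.inp hms))
  | par Q R ihQ ihR => exact fun h => brec_par hms h (ihQ (h.par hms).1) (ihR (h.par hms).2)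
  | res s C Q ih => exact fun h => brec_res h (ih h.res)
  | pvar Y =>
    intro E lin k U xs h
    obtain ⟨M', h'⟩ := h.good
    cases h'
    exact brec_pvar hms h
  | mu Y Q ih => exact fun h => by cases h.good.1

end Brec

/-! ### The breakdown of a process outside recursions -/

/-- The components of the free names of `P` that are not received through a propagator. -/
def direct (E : Ctx) (U : Set Name) (P : SProc) : Set TName :=
  {x | ∃ u ∈ P.fn, u ∉ U ∧ x ∈ E.names u}

theorem base_of_mem_direct {E : Ctx} {U : Set Name} {P : SProc} {x : TName}
    (h : x ∈ direct E U P) : base x ≠ none := by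
  obtain ⟨u, -, -, hx⟩ := h
  exact base_ne_none_of_mem_names hx

/-- The propagators of a breakdown of degree `n` with index from `k`. The output endpoint of `c_k`
belongs to the context. -/
def dirProps (k n : ℕ) : Set TName := {x | x ∈ propsIn k n ∧ x ≠ cOut k}

/-- The situation in which a part `P` outside recursions is broken down: `xs` are the components
of the names in `U`, among which are all tail-recursive free names of `P`. -/
structure BInv (E : Ctx) (U : Set Name) (xs : List TName) (P : SProc) : Prop where
  good : Good none E P
  comp : Comp E U xs
  drop : ∀ v ∈ U, v ∉ P.fn → Drop (E v).2
  tr_mem : ∀ v ∈ P.fn, (E v).2.tr = true → v ∈ U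
  nodup : P.bound.Nodup
  fresh : ∀ v, v ∈ U ∨ v ∈ P.fn → v.1 ∉ P.bound

/-- The statement that the breakdown of `P` is typable, with suitable kinds of propagators. -/
def BTyped (E : Ctx) (k : ℕ) (U : Set Name) (xs : List TName) (P : SProc) : Prop :=
  ∃ π : ℕ → Kind, π k = .once (xs.map (cty E)) ∧
    ∀ Γ Ξ, PropsOK Γ π k (deg false P) →
      (∀ u ∈ P.fn, u ∉ U → ∀ x ∈ E.names u, Γ x = (cty E x).shOf) →
      TTyped Γ Ξ (lenv (ty E π) {x | x ∈ direct E U P ∨ x ∈ dirProps k (deg false P)})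
        (B E k xs P)

theorem live_none {Q : SProc} {v : Name} : Live none Q v ↔ v ∈ Q.fn := by
  unfold Live; simp

theorem exists_kind_cons (π : ℕ → Kind) (k : ℕ) (K : Kind) :
    ∃ π' : ℕ → Kind, π' k = K ∧ ∀ j, k + 1 ≤ j → π' j = π j :=
  ⟨fun j => if j = k then K else π j, by simp, fun j hj => if_neg (by omega)⟩

theorem lenv_direct_congr {E E' : Ctx} {π π' : ℕ → Kind} {A : Set TName} {k n : ℕ}
    (hA : ∀ x ∈ A, base x ≠ none ∧ cty E x = cty E' x)
    (hπ : ∀ j, k ≤ j → j < k + n → π j = π' j) :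
    lenv (ty E π) {x | x ∈ A ∨ x ∈ dirProps k n} =
      lenv (ty E' π') {x | x ∈ A ∨ x ∈ dirProps k n} :=
  lenv_congr (fun _ _ => Iff.rfl) fun x hx => by
    have hx : x ∈ A ∨ x ∈ dirProps k n := by simpa using hx
    rcases hx with hx | hx
    · rw [ty_of_base (hA x hx).1, ty_of_base (hA x hx).1, (hA x hx).2]
    · refine ty_congr (base_of_mem_propsIn hx.1) fun j hj => ?_
      obtain ⟨⟨i, hi, h3, h4⟩, -⟩ := hx
      rw [hj] at hi; cases hi
      exact hπ j h3 h4

/-- The prefix of a trio outside recursions; the unused propagator `c^r_k` is added to the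
environment. -/
theorem typed_prefix {E : Ctx} {π : ℕ → Kind} {Γ : TShEnv} {Ξ : TRecEnv} {k n : ℕ}
    {xs : List TName} {A : Set TName} {T : TProc} (hn : 0 < n)
    (hπ : π k = .once (xs.map (cty E))) (hΓ : PropsOK Γ π k n) (hnd : xs.Nodup)
    (hb : ∀ x ∈ xs, base x ≠ none) (hA : ∀ x ∈ xs, x ∉ A) (hk : cIn k ∉ A)
    (hT : ∀ Γ', (∀ x, Γ' x = if x ∈ xs then (ty E π x).shOf else Γ x) →
      TTyped Γ' Ξ (lenv (ty E π) {x | x ∈ xs ∨ x ∈ A}) T) :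
    TTyped Γ Ξ (lenv (ty E π) {x | x ∈ A ∨ x = cIn k ∨ ∃ b, x = (.rprop k, b)})
      (.inp (cIn k) xs T) := by
  obtain ⟨h1, h2, h3⟩ := hΓ k le_rfl (by omega)
  have h : TTyped Γ Ξ (lenv (ty E π) {x | x ∈ A ∨ x = cIn k}) (.inp (cIn k) xs T) := by
    refine TTyped.recv_use (A := A) (W := {cIn k}) (fun Γ' hΓ' => ?_) (.inl ⟨?_, h1 false, hk, rfl⟩)
      hnd (fun h => hb _ h rfl) (fun y hy _ => hA y hy) fun x _ => or_comm
    · rw [Set.union_comm]; exact hT Γ' hΓ'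
    · rw [map_ty hb]; simp [cIn, ty, hπ, dirOf]
  refine h.weaken_list ?_ [(.rprop k, false), (.rprop k, true)] ?_ ?_
  · rintro x (hx | hx) _
    · exact .inl hx
    · exact .inr (.inl hx)
  · rintro x (hx | hx | ⟨b, rfl⟩) hxA _
    · exact absurd (.inl hx) hxA
    · exact absurd (.inr hx) hxA
    · cases b <;> simp
  · rintro x (hx | hx | ⟨b, rfl⟩) hxA _
    · exact absurd (.inl hx) hxA
    · exact absurd (.inr hx) hxA
    · refine ⟨by simp [ty, hπ], ?_⟩
      cases b
      · rw [h3, hπ]; rfl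
      · exact h2

/-- Parallel composition over a union of components and a union of propagators. -/
theorem typed_par {Γ : TShEnv} {Ξ : TRecEnv} {τ : TName → MTy} {A A₁ A₂ N N₁ N₂ : Set TName}
    {P Q : TProc} (hP : TTyped Γ Ξ (lenv τ {x | x ∈ A₁ ∨ x ∈ N₁}) P)
    (hQ : TTyped Γ Ξ (lenv τ {x | x ∈ A₂ ∨ x ∈ N₂}) Q)
    (hA₁ : ∀ x ∈ A₁, base x ≠ none) (hA₂ : ∀ x ∈ A₂, base x ≠ none)
    (hN : ∀ x, base x = none → (x ∈ N ↔ x ∈ N₁ ∨ x ∈ N₂) ∧ ¬ (x ∈ N₁ ∧ x ∈ N₂))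
    (hNb : ∀ x, x ∈ N ∨ x ∈ N₁ ∨ x ∈ N₂ → base x = none)
    (hA : ∀ x, (τ x).isSession = true → (x ∈ A ↔ x ∈ A₁ ∨ x ∈ A₂) ∧ ¬ (x ∈ A₁ ∧ x ∈ A₂)) :
    TTyped Γ Ξ (lenv τ {x | x ∈ A ∨ x ∈ N}) (.par P Q) := by
  refine hP.par_lenv hQ (fun x hs => ?_) fun x hs => ?_
  · have h1 := (hA x hs).1
    simp only [Set.mem_ofPred_eq, h1]
    by_cases hb : base x = none
    · rw [(hN x hb).1]; tauto
    · have := mt (hNb x) hb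
      tauto
  · have h1 := (hA x hs).2
    rintro (h | h) (h' | h')
    · exact h1 ⟨h, h'⟩
    · exact hA₁ x h (hNb x (.inr (.inr h')))
    · exact hA₂ x h' (hNb x (.inr (.inl h)))
    · exact (hN x (hNb x (.inr (.inl h)))).2 ⟨h, h'⟩

/-- An output on propagator `c_k`. -/
theorem typed_cOut {E : Ctx} {π : ℕ → Kind} {Γ : TShEnv} {Ξ : TRecEnv} {k : ℕ}
    {ys : List TName} {A : Set TName} {T : TProc} (hT : TTyped Γ Ξ (lenv (ty E π) A) T)
    (hπ : π k = .once (ys.map (cty E))) (hΓ : Γ (cOut k) = none) (hnd : ys.Nodup)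
    (hb : ∀ y ∈ ys, base y ≠ none) (hΓy : ∀ y ∈ ys, Γ y = (cty E y).shOf)
    (hA : ∀ y ∈ ys, (cty E y).isSession = true → y ∉ A) (hk : cOut k ∉ A) :
    TTyped Γ Ξ (lenv (ty E π) {x | x ∈ ys ∨ x ∈ A ∨ x = cOut k}) (.out (cOut k) ys T) := by
  refine TTyped.send_use (W := {cOut k}) hT (.inl ⟨?_, hΓ, hk, rfl⟩) hnd (fun z hz => ?_)
    (fun z hz hs => ?_) fun x _ => ?_
  · rw [map_ty hb]; simp [cOut, ty, hπ, dirOf]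
  · rw [ty_of_base (hb z hz), hΓy z hz]
  · rw [ty_of_base (hb z hz)] at hs
    exact ⟨hA z hz hs, fun h => hb z hz (by rw [Set.mem_singleton_iff.1 h]; rfl)⟩
  · simp only [Set.mem_ofPred_eq, Set.mem_singleton_iff]
    tauto

theorem b_nil {E : Ctx} {k : ℕ} {U : Set Name} {xs : List TName} (h : BInv E U xs .nil) :
    BTyped E k U xs .nil := by
  refine ⟨fun _ => .once (xs.map (cty E)), rfl, fun Γ Ξ hΓ _ => ?_⟩
  set π : ℕ → Kind := fun _ => .once (xs.map (cty E)) with hπ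
  have ht : TTyped Γ Ξ _ (B E k xs .nil) :=
    typed_prefix (A := ∅) (deg_pos false .nil) rfl hΓ h.comp.1 h.comp.base_ne (by simp) (by simp)
      (T := .nil) (E := E) fun Γ' hΓ' => by
      have h0 : TTyped Γ' Ξ (lenv (ty E π) ∅) .nil := by
        rw [lenv_eq_empty (by simp)]; exact .nil
      refine h0.weaken_list (by simp) xs (fun x h1 _ _ => by simpa using h1) fun x h1 _ hs => ?_
      have hx : x ∈ xs := by simpa using h1
      obtain ⟨v, hv, hxv⟩ := (h.comp.2 x).1 hx
      rw [hΓ' x, if_pos hx, MTy.shOf_eq_none hs]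
      rw [ty_of_base (base_ne_none_of_mem_names hxv)] at hs ⊢
      exact ⟨cty_of_drop hxv (h.drop v hv (by simp [SProc.fn])) hs, rfl⟩
  convert ht using 1
  refine lenv_ext fun x _ => ?_
  obtain ⟨_ | j | j | j, b⟩ := x <;> cases b <;>
    simp [direct, SProc.fn, dirProps, propsIn, pidx, deg, cIn, cOut] <;> omega

section Direct

variable {E : Ctx} {k : ℕ} {U : Set Name} {xs : List TName} {u z : Name} {Q R : SProc}

theorem tr_of_tr_next {v : Name} {d : Dir} (ha : Acts E u d) (ht : (E.next u v).2.tr = true) :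
    (E v).2.tr = true := by
  by_cases hvu : v = u
  · subst hvu
    rcases ha with ⟨C, h⟩ | ⟨hw, -, C, S, h⟩
    · rwa [next_of_sh h] at ht
    · simp only [next_of_act? h, Function.update_self] at ht
      rwa [hw.tr_iff_of_act? h] at ht
  · rwa [next_of_ne E hvu] at ht

/-- Outside recursions, a name is not free after its last action. -/
theorem not_mem_fn_of_last (hs : SubjLive none E u Q) (hl : Last E u) : u ∉ Q.fn := by
  obtain ⟨d', C, hl⟩ := hl
  exact (hs _ _ _ hl).1 rfl

/-- The components of a name which are not used up by an action are components afterwards, with the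
same types. -/
theorem mem_names_next_of_fn {v : Name} {d : Dir} {x : TName} (ha : Acts E u d)
    (hs : SubjLive none E u Q) (hv : v ∈ Q.fn) :
    (x ∈ (E.next u).names v ↔ x ∈ E.names v ∧ x ∉ E.used u) ∧
      (x ∈ (E.next u).names v → cty (E.next u) x = cty E x) := by
  by_cases hvu : v = u
  · subst hvu
    have hl : ¬ Last E v := fun h => not_mem_fn_of_last hs h hv
    exact ⟨ha.mem_names_next hl, fun hx => ha.cty_next hx hl⟩
  · rw [names_next_of_ne hvu]
    refine ⟨⟨fun hx => ⟨hx, fun h => hvu (eq_of_mem_names hx (ha.used_mem h))⟩, And.left⟩,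
      fun hx => cty_next_of_ne ?_⟩
    rw [base_of_mem_names hx]; simpa using hvu

/-- A linear component of the subject of an action is used up, or the subject is free in the
continuation. -/
theorem mem_used_or_fn {d : Dir} {x : TName} (ha : Acts E u d) (hs : SubjLive none E u Q)
    (hx : x ∈ E.names u) (hses : (E u).2.isSession = true) : x ∈ E.used u ∨ u ∈ Q.fn := by
  by_cases hl : Last E u
  · exact .inl (ha.names_of_last hl hx)
  · exact .inr (live_none.1 (hs.live ha hl hses))

theorem BInv.out (h : BInv E U xs (.out u z Q)) :
    BInv (E.next u) {v | v ∈ U ∧ v ∈ Q.fn} (fnb Q (minus xs (E.used u))) Q := by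
  obtain ⟨ha, hs, -, -, hg⟩ := h.good
  have hfn : ∀ v ∈ Q.fn, v ∈ (SProc.out u z Q).fn := fun v hv => by simp [SProc.fn, hv]
  refine ⟨hg, Comp.fnb (h.comp.1.filter _) fun v hv x hb => ?_, fun v hv hv' => absurd hv.2 hv',
    fun v hv ht => ⟨h.tr_mem v (hfn v hv) (tr_of_tr_next ha ht), hv⟩, h.nodup, fun v hv => ?_⟩
  · refine mem_minus_used ha h.comp ?_ hb
    rintro rfl hl
    exact not_mem_fn_of_last hs hl hv
  · exact h.fresh v (hv.elim (fun h => .inl h.1) fun h => .inr (hfn v h))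

/-- A trio in parallel with the breakdown `R` of the continuation. The trio uses the components in
`D`, beyond those which it receives, and the propagators in `K`; the continuation uses the
components in `A'` and the propagators in `N`. -/
theorem typed_step {π : ℕ → Kind} {Γ : TShEnv} {Ξ : TRecEnv} {n : ℕ} {A A' D K N : Set TName}
    {T R : TProc} (hn : 0 < n) (hπ : π k = .once (xs.map (cty E))) (hΓ : PropsOK Γ π k n)
    (hxs : Comp E U xs) (hR : TTyped Γ Ξ (lenv (ty E π) {x | x ∈ A' ∨ x ∈ N}) R)
    (hDb : ∀ x ∈ D, base x ≠ none) (hDxs : ∀ x ∈ D, x ∉ xs) (hA'b : ∀ x ∈ A', base x ≠ none)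
    (hAb : ∀ x ∈ A, base x ≠ none) (hKb : ∀ x ∈ K, base x = none) (hNb : ∀ x ∈ N, base x = none)
    (hk : cIn k ∉ K)
    (hKN : ∀ x, base x = none →
      (x ∈ dirProps k n ↔ (x ∈ K ∨ x = cIn k ∨ ∃ b, x = (.rprop k, b)) ∨ x ∈ N) ∧
        ¬ ((x ∈ K ∨ x = cIn k ∨ ∃ b, x = (.rprop k, b)) ∧ x ∈ N))
    (hA : ∀ x, (cty E x).isSession = true →
      (x ∈ A ↔ x ∈ D ∨ x ∈ A') ∧ ¬ (x ∈ D ∧ x ∈ A'))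
    (hT : ∀ Γ', (∀ x, Γ' x = if x ∈ xs then (ty E π x).shOf else Γ x) →
      TTyped Γ' Ξ (lenv (ty E π) {x | x ∈ xs ∨ x ∈ D ∨ x ∈ K}) T) :
    TTyped Γ Ξ (lenv (ty E π) {x | x ∈ A ∨ x ∈ dirProps k n}) (.par (.inp (cIn k) xs T) R) := by
  have htrio := typed_prefix (Ξ := Ξ) (A := {x | x ∈ D ∨ x ∈ K}) (T := T) hn hπ
    hΓ hxs.1 hxs.base_ne ?_ ?_ hT
  · refine typed_par (A₁ := D) (N₁ := {x | x ∈ K ∨ x = cIn k ∨ ∃ b, x = (.rprop k, b)})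
      (A₂ := A') (N₂ := N) (N := dirProps k n) ?_ hR hDb hA'b hKN ?_ ?_
    · convert htrio using 1
      refine lenv_ext fun x _ => ?_
      simp only [Set.mem_ofPred_eq, or_assoc]
    · rintro x (hx | (hx | rfl | ⟨b, rfl⟩) | hx)
      · exact base_of_mem_propsIn hx.1
      · exact hKb x hx
      · rfl
      · rfl
      · exact hNb x hx
    · intro x hs
      by_cases hb : base x = none
      · have h1 := mt (hAb x) (not_not.2 hb)
        have h2 := mt (hDb x) (not_not.2 hb)
        have h3 := mt (hA'b x) (not_not.2 hb)
        tauto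
      · rw [ty_of_base hb] at hs; exact hA x hs
  · rintro x hx (h' | h')
    · exact hDxs x h' hx
    · exact hxs.base_ne _ hx (hKb x h')
  · rintro (h' | h')
    · exact hDb _ h' rfl
    · exact hk h'

theorem mem_dirProps_succ {n : ℕ} (hn : 0 < n) (x : TName) :
    (x ∈ dirProps k (n + 1) ↔
      (x ∈ ({cOut (k + 1)} : Set TName) ∨ x = cIn k ∨ ∃ b, x = (.rprop k, b)) ∨
        x ∈ dirProps (k + 1) n) ∧
      ¬ ((x ∈ ({cOut (k + 1)} : Set TName) ∨ x = cIn k ∨ ∃ b, x = (.rprop k, b)) ∧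
        x ∈ dirProps (k + 1) n) := by
  obtain ⟨_ | j | j | j, b⟩ := x <;> cases b <;>
    simp [dirProps, propsIn, pidx, cIn, cOut] <;> omega

/-- The breakdown of a process with one continuation is typable if its first trio and the breakdown
of the continuation are. The first trio uses the components `D` beyond those which it receives. -/
theorem b_step {E' : Ctx} {V : Set Name} {ys : List TName} {D : Set TName} {P : SProc} {T : TProc}
    (hdeg : deg false P = deg false Q + 1)
    (hB : B E k xs P = .par (.inp (cIn k) xs T) (B E' (k + 1) ys Q)) (hxs : Comp E U xs)
    (ih : BTyped E' (k + 1) V ys Q) (hDb : ∀ x ∈ D, base x ≠ none) (hDxs : ∀ x ∈ D, x ∉ xs)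
    (hQ : ∀ v ∈ Q.fn, v ∉ V → ∀ x ∈ E'.names v,
      v ∈ P.fn ∧ v ∉ U ∧ x ∈ E.names v ∧ cty E' x = cty E x)
    (hA : ∀ x, (cty E x).isSession = true →
      (x ∈ direct E U P ↔ x ∈ D ∨ x ∈ direct E' V Q) ∧ ¬ (x ∈ D ∧ x ∈ direct E' V Q))
    (hT : ∀ (π : ℕ → Kind) (Γ : TShEnv) (Ξ : TRecEnv), π (k + 1) = .once (ys.map (cty E')) →
      Γ (cOut (k + 1)) = none →
      (∀ v, v ∈ U ∨ v ∈ P.fn → ∀ x ∈ E.names v, Γ x = (cty E x).shOf) →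
      TTyped Γ Ξ (lenv (ty E π) {x | x ∈ xs ∨ x ∈ D ∨ x = cOut (k + 1)}) T) :
    BTyped E k U xs P := by
  obtain ⟨π₁, h1, h2⟩ := ih
  obtain ⟨π, hπ, hπ₁⟩ := exists_kind_cons π₁ k (.once (xs.map (cty E)))
  unfold BTyped
  rw [hdeg, hB]
  refine ⟨π, hπ, fun Γ Ξ hΓ hdir => ?_⟩
  set n := deg false Q with hn
  have hpos : 0 < n := deg_pos _ _
  have hrest := h2 Γ Ξ (hΓ.sub (by omega) (by omega) fun j hj _ => hπ₁ j hj)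
    fun v hv hvV x hx => by
      obtain ⟨e1, e2, e3, e4⟩ := hQ v hv hvV x hx
      rw [e4]; exact hdir v e1 e2 x e3
  rw [lenv_direct_congr (E' := E) (π' := π) (fun x hx => ⟨base_of_mem_direct hx, by
    obtain ⟨v, hv, hvV, hx⟩ := hx
    exact (hQ v hv hvV x hx).2.2.2⟩) fun j hj _ => (hπ₁ j hj).symm] at hrest
  refine typed_step (by omega) hπ hΓ hxs hrest hDb hDxs (fun x => base_of_mem_direct)
    (fun x => base_of_mem_direct) (K := {cOut (k + 1)}) (by rintro x rfl; rfl)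
    (fun x hx => base_of_mem_propsIn hx.1) (by simp [cIn, cOut])
    (fun x _ => mem_dirProps_succ hpos x) hA fun Γ' hΓ' => ?_
  refine hT π Γ' Ξ (by rw [hπ₁ _ le_rfl, h1]) ?_ ?_
  · rw [sameProps_bind hxs.base_ne hΓ' _ rfl]
    exact (hΓ (k + 1) (by omega) (by omega)).1 true
  · intro v hv x hx
    rw [hΓ' x]
    split_ifs with h
    · rw [ty_of_base (base_ne_none_of_mem_names hx)]
    · have hvU : v ∉ U := fun hv => h ((hxs.2 x).2 ⟨v, hv, hx⟩)
      exact hdir v (hv.resolve_left hvU) hvU x hx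

/-- The last action of a trio. -/
theorem typed_last {π : ℕ → Kind} {Γ : TShEnv} {Ξ : TRecEnv} {ys : List TName}
    (hπ : π k = .once (ys.map (cty E))) (hΓ : Γ (cOut k) = none) (hnd : ys.Nodup)
    (hb : ∀ y ∈ ys, base y ≠ none) (hΓy : ∀ y ∈ ys, Γ y = (cty E y).shOf) :
    TTyped Γ Ξ (lenv (ty E π) ({x | x ∈ ys} ∪ {cOut k})) (.out (cOut k) ys .nil) := by
  have h0 : TTyped Γ Ξ (lenv (ty E π) ∅) .nil := by
    rw [lenv_eq_empty (by simp)]; exact .nil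
  convert typed_cOut h0 hπ hΓ hnd hb hΓy (fun _ _ _ h => h) (fun h => h) using 1
  refine lenv_ext fun x _ => ?_
  simp [or_comm]

theorem mem_comp_iff {v : Name} {x : TName} (h : Comp E U xs) (hx : x ∈ E.names v) :
    x ∈ xs ↔ v ∈ U := by
  rw [h.mem (base_of_mem_names hx)]; exact and_iff_left hx

/-- The trio of an output also uses the components of the subject and of the object that it does not
receive. -/
theorem b_out (h : BInv E U xs (.out u z Q))
    (ih : BTyped (E.next u) (k + 1) {v | v ∈ U ∧ v ∈ Q.fn} (fnb Q (minus xs (E.used u))) Q) :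
    BTyped E k U xs (.out u z Q) := by
  obtain ⟨ha, hs, hz, hzl, -⟩ := h.good
  have hQ := h.out
  have hfn : ∀ v ∈ Q.fn, v ∈ (SProc.out u z Q).fn := fun v hv => by simp [SProc.fn, hv]
  have hlast : Last E u → ¬ Live none Q u := fun hl => by
    rw [live_none]; exact not_mem_fn_of_last hs hl
  have hV : ∀ v, v ∈ {v | v ∈ U ∧ v ∈ Q.fn} ↔ v ∈ U ∧ Live none Q v := fun v => by
    rw [live_none]; rfl
  have hof := fun x => Comp.of_next (x := x) ha hlast hQ.comp hV
  have hnU : ∀ v ∈ Q.fn, v ∉ {v | v ∈ U ∧ v ∈ Q.fn} → v ∉ U := fun v hv h h' => h ⟨h', hv⟩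
  refine b_step (D := {x | x ∉ xs ∧ (x ∈ E.names z ∨ x ∈ E.used u)}) rfl rfl h.comp ih ?_
    (fun x hx => hx.1) (fun v hv hvV x hx => ?_) (fun x hses => ?_) fun π Γ' Ξ hπ hΓk hΓ => ?_
  · rintro x ⟨-, hx | hx⟩
    · exact base_ne_none_of_mem_names hx
    · exact base_ne_none_of_mem_names (ha.used_mem hx)
  · obtain ⟨e1, e2⟩ := mem_names_next_of_fn (x := x) ha hs hv
    exact ⟨hfn v hv, hnU v hv hvV, (e1.1 hx).1, e2 hx⟩
  · constructor
    · constructor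
      · rintro ⟨v, hv, hvU, hx⟩
        have hses := isSession_of_cty hx hses
        have hxs := mt (mem_comp_iff h.comp hx).1 hvU
        by_cases hxu : x ∈ E.used u
        · exact .inl ⟨hxs, .inr hxu⟩
        have key : v ∈ Q.fn → x ∈ direct (E.next u) {v | v ∈ U ∧ v ∈ Q.fn} Q := fun hvQ =>
          ⟨v, hvQ, fun h => hvU h.1, (mem_names_next_of_fn ha hs hvQ).1.2 ⟨hx, hxu⟩⟩
        simp only [SProc.fn, List.mem_cons] at hv
        rcases hv with rfl | rfl | hv
        · exact .inr (key ((mem_used_or_fn ha hs hx hses).resolve_left hxu))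
        · exact .inl ⟨hxs, .inl hx⟩
        · exact .inr (key hv)
      · rintro (⟨hxs, hx | hx⟩ | ⟨v, hv, hvU, hx⟩)
        · exact ⟨z, by simp [SProc.fn], mt (mem_comp_iff h.comp hx).2 hxs, hx⟩
        · have hx' := ha.used_mem hx
          exact ⟨u, by simp [SProc.fn], mt (mem_comp_iff h.comp hx').2 hxs, hx'⟩
        · exact ⟨v, hfn v hv, hnU v hv hvU, ((mem_names_next_of_fn ha hs hv).1.1 hx).1⟩
    · rintro ⟨⟨-, hx⟩, ⟨v, hv, -, hxv⟩⟩
      obtain ⟨hxv, hxu⟩ := (mem_names_next_of_fn ha hs hv).1.1 hxv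
      rcases hx with hx | hx
      · obtain rfl := eq_of_mem_names hx hxv
        exact (hzl (isSession_of_cty hx hses)).2 (live_none.2 hv)
      · exact hxu hx
  · have hπ' : π (k + 1) = .once ((fnb Q (minus xs (E.used u))).map (cty E)) := by
      rw [hπ]; congr 1
      exact List.map_congr_left fun x hx => (hof x hx).2.2
    have htail := typed_last (Ξ := Ξ) hπ' hΓk hQ.comp.1 hQ.comp.base_ne fun x hx => by
      obtain ⟨⟨v, hv, hxv, -⟩, -⟩ := hof x hx
      exact hΓ v (.inl hv) x hxv
    have := typed_output ha hs hlast hz hzl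
      (fun v hv hl => h.drop v hv (by rwa [live_none] at hl))
      (fun ht => h.tr_mem u (by simp [SProc.fn]) ht) h.comp hQ.comp hV
      (K := {cOut (k + 1)}) (by rintro x rfl; rfl) (fun v hv => hΓ v (by
        simp only [SProc.fn, List.mem_cons]; tauto)) htail
    convert this using 1
    refine lenv_ext fun x _ => ?_
    simp only [Set.mem_ofPred_eq, Set.mem_singleton_iff]
    tauto

theorem BInv.inp {y : ℕ} (h : BInv E U xs (.inp u y Q)) :
    let E' := (E.next u).bind (y, false) (E.payload u)
    BInv E' {v | (v ∈ U ∨ v = (y, false)) ∧ v ∈ Q.fn}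
      (fnb Q (minus (xs ++ E'.names (y, false)) (E.used u))) Q := by
  intro E'
  obtain ⟨ha, hs, -, hg⟩ := h.good
  have hnd := List.nodup_cons.1 h.nodup
  have hyU : (y, false) ∉ U := fun hy => h.fresh _ (.inl hy) List.mem_cons_self
  have huy : u ≠ (y, false) := by
    rintro rfl
    exact h.fresh (y, false) (.inr (by simp [SProc.fn])) List.mem_cons_self
  have hfn : ∀ v ∈ Q.fn, v ≠ (y, false) → v ∈ (SProc.inp u y Q).fn := fun v hv hvy => by
    simp [SProc.fn, hv, hvy]
  have hE' : E' = (E.bind (y, false) (E.payload u)).next u := next_bind E _ huy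
  have ha₁ : Acts (E.bind (y, false) (E.payload u)) u .inp := by
    unfold Acts; rw [bind_of_ne E _ huy]; exact ha
  refine ⟨hg, Comp.fnb (U := {v | v ∈ U ∨ v = (y, false)}) ?_ fun v hv x hb => ?_,
    fun v hv hv' => absurd hv.2 hv', fun v hv ht => ⟨?_, hv⟩, hnd.2, fun v hv => ?_⟩
  · refine List.Nodup.filter _ ?_
    rw [hE', names_next_of_ne (Ne.symm huy)]
    exact (h.comp.append_names hyU).1
  · have := mem_minus_used ha₁ (h.comp.append_names (C := E.payload u) hyU) (v := v) (x := x) ?_ hb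
    · rw [hE', names_next_of_ne (Ne.symm huy)]
      have e : (E.bind (y, false) (E.payload u)).used u = E.used u := by
        unfold Ctx.used; rw [bind_of_ne E _ huy]
      rwa [e] at this
    · rintro rfl hl
      unfold Last at hl
      rw [bind_of_ne E _ huy] at hl
      exact not_mem_fn_of_last hs hl hv
  · by_cases hvy : v = (y, false)
    · exact .inr hvy
    · have ht : (E.next u v).2.tr = true := by
        rwa [show E' v = E.next u v from bind_of_ne _ _ hvy] at ht
      exact .inl (h.tr_mem v (hfn v hv hvy) (tr_of_tr_next ha ht))
  · have hv : v = (y, false) ∨ v ∈ U ∨ v ∈ (SProc.inp u y Q).fn := by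
      by_cases hvy : v = (y, false)
      · exact .inl hvy
      · rcases hv with hv | hv
        · exact .inr (.inl (hv.1.resolve_right hvy))
        · exact .inr (.inr (hfn v hv hvy))
    rcases hv with rfl | hv
    · exact hnd.1
    · exact fun hb => h.fresh v hv (List.mem_cons_of_mem _ hb)

theorem b_inp {y : ℕ} (h : BInv E U xs (.inp u y Q))
    (ih : BTyped ((E.next u).bind (y, false) (E.payload u)) (k + 1)
      {v | (v ∈ U ∨ v = (y, false)) ∧ v ∈ Q.fn}
      (fnb Q (minus (xs ++ ((E.next u).bind (y, false) (E.payload u)).names (y, false))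
        (E.used u))) Q) :
    BTyped E k U xs (.inp u y Q) := by
  obtain ⟨ha, hs, hy, -⟩ := h.good
  have hQ := h.inp
  simp only at hQ
  have hyU : (y, false) ∉ U := fun hy => h.fresh _ (.inl hy) List.mem_cons_self
  have huy : u ≠ (y, false) := by
    rintro rfl
    exact h.fresh (y, false) (.inr (by simp [SProc.fn])) List.mem_cons_self
  have hfn : ∀ v ∈ Q.fn, v ≠ (y, false) → v ∈ (SProc.inp u y Q).fn := fun v hv hvy => by
    simp [SProc.fn, hv, hvy]
  set E' := (E.next u).bind (y, false) (E.payload u) with hE'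
  set ys := fnb Q (minus (xs ++ E'.names (y, false)) (E.used u)) with hys
  set E₁ := E.bind (y, false) (E.payload u) with hE₁
  have hEE : E' = E₁.next u := next_bind E _ huy
  have ha₁ : Acts E₁ u .inp := by unfold Acts; rw [hE₁, bind_of_ne E _ huy]; exact ha
  have hlast : Last E u → ¬ Live none Q u := fun hl => by
    rw [live_none]; exact not_mem_fn_of_last hs hl
  have hlast₁ : Last E₁ u → ¬ Live none Q u := by
    unfold Last; rw [hE₁, bind_of_ne E _ huy]; exact hlast
  have hV : ∀ v, v ∈ {v | (v ∈ U ∨ v = (y, false)) ∧ v ∈ Q.fn} ↔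
      (v ∈ U ∨ v = (y, false)) ∧ Live none Q v := fun v => by rw [live_none]; rfl
  have hcomp₁ : Comp (E₁.next u) {v | (v ∈ U ∨ v = (y, false)) ∧ v ∈ Q.fn} ys := by
    rw [← hEE]; exact hQ.comp
  have hof := fun x => Comp.of_next (x := x) (U := {v | v ∈ U ∨ v = (y, false)}) ha₁ hlast₁
    hcomp₁ hV
  have hnV : ∀ v ∈ Q.fn, v ∉ {v | (v ∈ U ∨ v = (y, false)) ∧ v ∈ Q.fn} →
      v ∉ U ∧ v ≠ (y, false) := fun v hv h =>
    ⟨fun h' => h ⟨.inl h', hv⟩, fun h' => h ⟨.inr h', hv⟩⟩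
  have hE'n : ∀ v, v ≠ (y, false) → E'.names v = (E.next u).names v := fun v hv =>
    names_bind_of_ne _ _ hv
  refine b_step (D := {x | x ∉ xs ∧ x ∈ E.used u}) rfl rfl h.comp ih
    (fun x hx => base_ne_none_of_mem_names (ha.used_mem hx.2))
    (fun x hx => hx.1) (fun v hv hvV x hx => ?_) (fun x hses => ?_) fun π Γ' Ξ hπ hΓk hΓ => ?_
  · obtain ⟨hvU, hvy⟩ := hnV v hv hvV
    rw [hE'n v hvy] at hx
    obtain ⟨e1, e2⟩ := mem_names_next_of_fn (x := x) ha hs hv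
    refine ⟨hfn v hv hvy, hvU, (e1.1 hx).1, ?_⟩
    rw [← e2 hx, cty_bind_of_ne]
    rw [base_of_mem_names hx]; simpa using hvy
  · constructor
    · constructor
      · rintro ⟨v, hv, hvU, hx⟩
        have hses := isSession_of_cty hx hses
        have hxs := mt (mem_comp_iff h.comp hx).1 hvU
        by_cases hxu : x ∈ E.used u
        · exact .inl ⟨hxs, hxu⟩
        have hvy : v ≠ (y, false) := fun hvy =>
          h.fresh v (.inr hv) (by rw [hvy]; exact List.mem_cons_self)
        have hvQ : v ∈ Q.fn := by
          simp only [SProc.fn, List.mem_cons] at hv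
          rcases hv with rfl | hv
          · exact (mem_used_or_fn ha hs hx hses).resolve_left hxu
          · exact (List.mem_filter.1 hv).1
        refine .inr ⟨v, hvQ, fun h => h.1.elim hvU hvy, ?_⟩
        rw [hE'n v hvy]
        exact (mem_names_next_of_fn ha hs hvQ).1.2 ⟨hx, hxu⟩
      · rintro (⟨hxs, hx⟩ | ⟨v, hv, hvV, hx⟩)
        · have hx' := ha.used_mem hx
          exact ⟨u, by simp [SProc.fn], mt (mem_comp_iff h.comp hx').2 hxs, hx'⟩
        · obtain ⟨hvU, hvy⟩ := hnV v hv hvV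
          rw [hE'n v hvy] at hx
          exact ⟨v, hfn v hv hvy, hvU, ((mem_names_next_of_fn ha hs hv).1.1 hx).1⟩
    · rintro ⟨⟨-, hx⟩, ⟨v, hv, hvV, hxv⟩⟩
      rw [hE'n v (hnV v hv hvV).2] at hxv
      exact ((mem_names_next_of_fn ha hs hv).1.1 hxv).2 hx
  · have hπ' : π (k + 1) = .once (ys.map (cty E₁)) := by
      refine hπ.trans (congrArg Kind.once ?_)
      change ys.map (cty E') = _
      rw [hEE]
      exact List.map_congr_left fun x hx => (hof x hx).2.2
    have htail : ∀ Γ₂ : TShEnv, (∀ x, base x ≠ some (y, false) → Γ₂ x = Γ' x) →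
        (∀ x ∈ E₁.names (y, false), Γ₂ x = (cty E₁ x).shOf) →
        TTyped Γ₂ Ξ (lenv (ty E₁ π) ({x | x ∈ ys} ∪ {cOut (k + 1)}))
          (.out (cOut (k + 1)) ys .nil) := by
      intro Γ₂ hΓ₂ hΓ₂y
      refine typed_last hπ' (by rw [hΓ₂ _ (by simp [base, cOut]), hΓk]) hQ.comp.1
        hQ.comp.base_ne fun x hx => ?_
      obtain ⟨⟨v, hv, hxv, -⟩, -⟩ := hof x hx
      by_cases hvy : v = (y, false)
      · subst hvy; exact hΓ₂y x hxv
      · have hb : base x ≠ some (y, false) := by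
          rw [base_of_mem_names hxv]; simpa using hvy
        rw [hΓ₂ x hb, hE₁, cty_bind_of_ne E _ hb]
        exact hΓ v (.inl (hv.resolve_right hvy)) x (by rwa [hE₁, names_bind_of_ne E _ hvy] at hxv)
    have := typed_input (xs := xs) ha hs hlast hy
      (fun v hv hl => h.drop v hv (by rwa [live_none] at hl)) hyU huy
      (fun ht => h.tr_mem u (by simp [SProc.fn]) ht) h.comp hQ.comp hV
      (K := {cOut (k + 1)}) (by rintro x rfl; rfl) (fun v hv => hΓ v (by
        simp only [SProc.fn, List.mem_cons]; tauto)) htail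
    convert this using 1
    refine lenv_ext fun x _ => ?_
    simp only [Set.mem_ofPred_eq, Set.mem_singleton_iff]
    tauto

theorem BInv.of_sub {P : SProc} (h : BInv E U xs P) (hg : Good none E Q)
    (hfn : ∀ v ∈ Q.fn, v ∈ P.fn) (hnd : Q.bound.Nodup) (hb : ∀ a ∈ Q.bound, a ∈ P.bound) :
    BInv E {v | v ∈ U ∧ v ∈ Q.fn} (fnb Q xs) Q :=
  ⟨hg, Comp.fnb h.comp.1 fun _ _ _ hb => h.comp.mem hb, fun _ hv hv' => absurd hv.2 hv',
    fun v hv ht => ⟨h.tr_mem v (hfn v hv) ht, hv⟩, hnd,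
    fun v hv h' => h.fresh v (hv.elim (fun h => .inl h.1) fun h => .inr (hfn v h)) (hb _ h')⟩

theorem BInv.par (h : BInv E U xs (.par Q R)) :
    BInv E {v | v ∈ U ∧ v ∈ Q.fn} (fnb Q xs) Q ∧ BInv E {v | v ∈ U ∧ v ∈ R.fn} (fnb R xs) R := by
  obtain ⟨-, hQ, hR⟩ := h.good
  have hnd := List.nodup_append.1 h.nodup
  exact ⟨h.of_sub hQ (fun _ => List.mem_append_left _) hnd.1 fun _ => List.mem_append_left _,
    h.of_sub hR (fun _ => List.mem_append_right _) hnd.2.1 fun _ => List.mem_append_right _⟩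

/-- Components that are not received stay with the part in which they are free; linear ones are free
in one part only. -/
theorem b_par (h : BInv E U xs (.par Q R))
    (ihQ : BTyped E (k + 1) {v | v ∈ U ∧ v ∈ Q.fn} (fnb Q xs) Q)
    (ihR : BTyped E (k + deg false Q + 1) {v | v ∈ U ∧ v ∈ R.fn} (fnb R xs) R) :
    BTyped E k U xs (.par Q R) := by
  obtain ⟨hd, -, -⟩ := h.good
  obtain ⟨hQ, hR⟩ := h.par
  obtain ⟨π₁, h1, h1'⟩ := ihQ
  obtain ⟨π₂, h2, h2'⟩ := ihR
  have hposQ := deg_pos false Q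
  have hposR := deg_pos false R
  have hdeg : deg false (.par Q R) = deg false Q + deg false R + 1 := rfl
  unfold BTyped B
  simp only
  rw [hdeg]
  generalize fnb Q xs = ys at *
  generalize fnb R xs = zs at *
  set l := deg false Q with hl
  -- The kinds of the two parts are joined: `Q` uses the propagators with index up to `k + l`.
  refine ⟨fun j => if j = k then .once (xs.map (cty E)) else
    if j < k + l + 1 then π₁ j else π₂ j, by simp, fun Γ Ξ hΓ hdir => ?_⟩
  set π : ℕ → Kind := fun j => if j = k then .once (xs.map (cty E)) else
    if j < k + l + 1 then π₁ j else π₂ j with hπ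
  have hπk : π k = .once (xs.map (cty E)) := by simp [hπ]
  have hπ₁ : ∀ j, k + 1 ≤ j → j < k + 1 + l → π j = π₁ j := fun j hj hj' => by
    rw [hπ]; simp only; rw [if_neg (by omega), if_pos (by omega)]
  have hπ₂ : ∀ j, k + l + 1 ≤ j → π j = π₂ j := fun j hj => by
    rw [hπ]; simp only; rw [if_neg (by omega), if_neg (by omega)]
  have hπQ : π (k + 1) = .once (ys.map (cty E)) := by rw [hπ₁ _ le_rfl (by omega), h1]
  have hπR : π (k + l + 1) = .once (zs.map (cty E)) := by rw [hπ₂ _ le_rfl, h2]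
  have hrestQ := h1' Γ Ξ (hΓ.sub (by omega) (by omega) hπ₁) fun v hv hvV =>
    hdir v (List.mem_append_left _ hv) fun h => hvV ⟨h, hv⟩
  rw [lenv_direct_congr (E' := E) (π' := π) (fun x hx => ⟨base_of_mem_direct hx, rfl⟩)
    fun j hj hj' => (hπ₁ j hj hj').symm] at hrestQ
  have hrestR := h2' Γ Ξ (hΓ.sub (by omega) (by omega) fun j hj _ => hπ₂ j hj) fun v hv hvV =>
    hdir v (List.mem_append_right _ hv) fun h => hvV ⟨h, hv⟩
  rw [lenv_direct_congr (E' := E) (π' := π) (fun x hx => ⟨base_of_mem_direct hx, rfl⟩)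
    fun j hj _ => (hπ₂ j hj).symm] at hrestR
  have hmemQ : ∀ {x v}, x ∈ E.names v → (x ∈ ys ↔ v ∈ U ∧ v ∈ Q.fn) := fun hx =>
    mem_comp_iff hQ.comp hx
  have hmemR : ∀ {x v}, x ∈ E.names v → (x ∈ zs ↔ v ∈ U ∧ v ∈ R.fn) := fun hx =>
    mem_comp_iff hR.comp hx
  -- A linear name is not free in both parts.
  have hlin : ∀ v x, x ∈ E.names v → (ty E π x).isSession = true → v ∈ Q.fn → v ∉ R.fn := by
    intro v x hx hs
    rw [ty_of_base (base_ne_none_of_mem_names hx)] at hs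
    have := hd v (isSession_of_cty hx hs)
    rwa [live_none, live_none] at this
  set K : Set TName := {x | x = cOut (k + 1) ∨ x = cOut (k + l + 1)} with hK
  have hKb : ∀ x ∈ K, base x = none := by rintro x (rfl | rfl) <;> rfl
  refine typed_step (A' := direct E U (.par Q R)) (D := ∅) (K := K)
    (N := {x | x ∈ dirProps (k + 1) l ∨ x ∈ dirProps (k + l + 1) (deg false R)}) (by omega) hπk hΓ
    h.comp (typed_par hrestQ hrestR (fun x => base_of_mem_direct) (fun x => base_of_mem_direct)
      ?_ ?_ ?_) (by simp) (by simp) (fun x => base_of_mem_direct) (fun x => base_of_mem_direct) hKb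
    ?_ (by simp [hK, cIn, cOut]) ?_ (fun x _ => by simp) ?_
  · intro x hx
    refine ⟨Iff.rfl, ?_⟩
    obtain ⟨_ | j | j | j, b⟩ := x <;> cases b <;>
      simp [dirProps, propsIn, pidx, cOut] <;> omega
  · rintro x ((hx | hx) | hx | hx) <;> exact base_of_mem_propsIn hx.1
  · intro x hs
    constructor
    · constructor
      · rintro ⟨v, hv, hvU, hx⟩
        rcases List.mem_append.1 hv with hv | hv
        · exact .inl ⟨v, hv, fun h => hvU h.1, hx⟩
        · exact .inr ⟨v, hv, fun h => hvU h.1, hx⟩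
      · rintro (⟨v, hv, hvU, hx⟩ | ⟨v, hv, hvU, hx⟩)
        · exact ⟨v, List.mem_append_left _ hv, fun h => hvU ⟨h, hv⟩, hx⟩
        · exact ⟨v, List.mem_append_right _ hv, fun h => hvU ⟨h, hv⟩, hx⟩
    · rintro ⟨⟨v, hv, -, hx⟩, ⟨w, hw, -, hx'⟩⟩
      obtain rfl := eq_of_mem_names hx hx'
      exact hlin v x hx hs hv hw
  · rintro x (hx | hx) <;> exact base_of_mem_propsIn hx.1
  · intro x hx
    obtain ⟨_ | j | j | j, b⟩ := x <;> cases b <;>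
      simp [hK, dirProps, propsIn, pidx, cIn, cOut] <;> omega
  · intro Γ' hΓ'
    have hsame := sameProps_bind h.comp.base_ne hΓ'
    have hcov : ∀ v ∈ U, ∀ x ∈ E.names v, Γ' x = (cty E x).shOf :=
      covers_of_bind h.comp hΓ'
    have hsubQ : ∀ x ∈ ys, ∃ v ∈ U, x ∈ E.names v := fun x hx => by
      obtain ⟨v, hv, hxv⟩ := (hQ.comp.2 x).1 hx
      exact ⟨v, hv.1, hxv⟩
    have hsubR : ∀ x ∈ zs, ∃ v ∈ U, x ∈ E.names v := fun x hx => by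
      obtain ⟨v, hv, hxv⟩ := (hR.comp.2 x).1 hx
      exact ⟨v, hv.1, hxv⟩
    have hprop : ∀ j, k ≤ j → j < k + (l + deg false R + 1) → Γ' (cOut j) = none :=
      fun j h1 h2 => by rw [hsame _ rfl]; exact (hΓ j h1 h2).1 true
    have t2 := typed_last (Ξ := Ξ) hπR (hprop _ (by omega) (by omega)) hR.comp.1 hR.comp.base_ne
      fun x hx => by obtain ⟨v, hv, hxv⟩ := hsubR x hx; exact hcov v hv x hxv
    have t1 := typed_cOut t2 hπQ (hprop _ (by omega) (by omega)) hQ.comp.1 hQ.comp.base_ne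
      (fun x hx => by obtain ⟨v, hv, hxv⟩ := hsubQ x hx; exact hcov v hv x hxv) ?_ ?_
    · refine t1.weaken_list ?_ xs ?_ ?_
      · rintro x (hx | (hx | hx) | hx) _
        · exact .inl ((h.comp.2 x).2 (hsubQ x hx))
        · exact .inl ((h.comp.2 x).2 (hsubR x hx))
        · exact .inr (.inr (.inr hx))
        · exact .inr (.inr (.inl hx))
      · rintro x (hx | ⟨⟨⟩⟩ | hx | hx) hA _
        · exact hx
        · exact absurd (.inr (.inr hx)) hA
        · exact absurd (.inr (.inl (.inr hx))) hA
      · rintro x (hx | ⟨⟨⟩⟩ | hx | hx) hA hs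
        · obtain ⟨v, hv, hxv⟩ := (h.comp.2 x).1 hx
          rw [hcov v hv x hxv]
          rw [ty_of_base (base_ne_none_of_mem_names hxv)] at hs ⊢
          refine ⟨cty_of_drop hxv (h.drop v hv fun hvf => hA ?_) hs, MTy.shOf_eq_none hs⟩
          rcases List.mem_append.1 hvf with hvf | hvf
          · exact .inl ((hmemQ hxv).2 ⟨hv, hvf⟩)
          · exact .inr (.inl (.inl ((hmemR hxv).2 ⟨hv, hvf⟩)))
        · exact absurd (.inr (.inr hx)) hA
        · exact absurd (.inr (.inl (.inr hx))) hA
    · rintro x hx hs (hx' | hx')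
      · obtain ⟨v, hv, hxv⟩ := hsubQ x hx
        refine hlin v x hxv ?_ ((hmemQ hxv).1 hx).2 ((hmemR hxv).1 hx').2
        rwa [ty_of_base (base_ne_none_of_mem_names hxv)]
      · exact hQ.comp.base_ne x hx (by rw [Set.mem_singleton_iff.1 hx']; rfl)
    · rintro (hx | hx)
      · exact hR.comp.base_ne _ hx rfl
      · simp [cOut] at hx; omega

end Direct

section Direct

variable {E : Ctx} {k : ℕ} {U : Set Name} {xs : List TName} {s : ℕ} {C : STy} {Q : SProc}

/-- A linear restricted name which is not free in the process below the restriction has type `end`,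
and shared names need not be used. -/
theorem drop_bindRes (hC : C.isSession = true → C ≠ .fin → ∀ b, Live none Q (s, b)) (b : Bool)
    (hb : (s, b) ∉ Q.fn) : Drop (E.bindRes s C (s, b)).2 := by
  have key : Drop C := by
    by_cases hf : C = .fin
    · exact .inl hf
    · refine .inr ?_
      by_contra hn
      exact hb (live_none.1 (hC (isSession_iff.2 hn) hf b))
  cases b
  · rw [bindRes_false]; exact key
  · rw [bindRes_true]
    rcases key with rfl | ⟨D, rfl⟩
    · exact .inl rfl
    · exact .inr ⟨D, rfl⟩

theorem cty_bindRes_of_ne (E : Ctx) (C : STy) {x : TName} (h : ∀ b, base x ≠ some (s, b)) :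
    cty (E.bindRes s C) x = cty E x := by
  rw [Ctx.bindRes, cty_bind_of_ne _ _ (h true), cty_bind_of_ne _ _ (h false)]

theorem BInv.ne_res {v : Name} (h : BInv E U xs (.res s C Q))
    (hv : v ∈ U ∨ v ∈ (SProc.res s C Q).fn) : v.1 ≠ s :=
  fun hs => h.fresh v hv (by rw [hs]; exact List.mem_cons_self)

theorem BInv.res_tr (h : BInv E U xs (.res s C Q)) (hs : C.isSession = true) :
    BInv (E.bindRes s C) {v | v ∈ U ∨ ∃ b, (b = false ∨ C.isSession = true) ∧ v = (s, b)}
      (xs ++ resNames E s C) Q := by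
  obtain ⟨hC, h1, h2, hg⟩ := h.good
  have hnd := List.nodup_cons.1 h.nodup
  have hU : ∀ v ∈ U, v.1 ≠ s := fun v hv => h.ne_res (.inl hv)
  have hfn : ∀ v ∈ Q.fn, v.1 ≠ s → v ∈ (SProc.res s C Q).fn := fun v hv hvs => by
    simp [SProc.fn, hv, hvs]
  refine ⟨hg, h.comp.append_resNames hU, ?_, fun v hv ht => ?_, hnd.2, ?_⟩
  · rintro v (hv | ⟨b, -, rfl⟩) hvQ
    · rw [bindRes_of_ne E C (hU v hv)]
      exact h.drop v hv fun hv' => hvQ (List.mem_filter.1 hv').1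
    · exact drop_bindRes h1 b hvQ
  · by_cases hvs : v.1 = s
    · exact .inr ⟨v.2, .inr hs, by rw [← hvs]⟩
    · rw [bindRes_of_ne E C hvs] at ht
      exact .inl (h.tr_mem v (hfn v hv hvs) ht)
  · intro v hv hb
    by_cases hvs : v.1 = s
    · rw [hvs] at hb; exact hnd.1 hb
    · have : v ∈ U ∨ v ∈ (SProc.res s C Q).fn := by
        rcases hv with (hv | ⟨b, -, rfl⟩) | hv
        · exact .inl hv
        · exact absurd rfl hvs
        · exact .inr (hfn v hv hvs)
      exact h.fresh v this (List.mem_cons_of_mem _ hb)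

theorem BInv.res (h : BInv E U xs (.res s C Q)) (ht : C.tr = false) :
    BInv (E.bindRes s C) U xs Q := by
  obtain ⟨hC, h1, h2, hg⟩ := h.good
  have hnd := List.nodup_cons.1 h.nodup
  have hU : ∀ v ∈ U, v.1 ≠ s := fun v hv => h.ne_res (.inl hv)
  have hfn : ∀ v ∈ Q.fn, v.1 ≠ s → v ∈ (SProc.res s C Q).fn := fun v hv hvs => by
    simp [SProc.fn, hv, hvs]
  refine ⟨hg, ⟨h.comp.1, fun x => ?_⟩, fun v hv hvQ => ?_, fun v hv ht' => ?_, hnd.2, ?_⟩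
  · rw [h.comp.2]
    refine exists_congr fun v => and_congr_right fun hv => ?_
    rw [names_bindRes_of_ne E C (hU v hv)]
  · rw [bindRes_of_ne E C (hU v hv)]
    exact h.drop v hv fun hv' => hvQ (List.mem_filter.1 hv').1
  · by_cases hvs : v.1 = s
    · obtain ⟨a, b⟩ := v
      cases hvs
      cases b
      · rw [bindRes_false] at ht'; rw [ht] at ht'; cases ht'
      · rw [bindRes_true] at ht'
        simp only [STy.tr_dual, ht] at ht'
        cases ht'
    · rw [bindRes_of_ne E C hvs] at ht'
      exact h.tr_mem v (hfn v hv hvs) ht'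
  · intro v hv hb
    by_cases hvs : v.1 = s
    · rw [hvs] at hb; exact hnd.1 hb
    · exact h.fresh v (hv.imp_right fun hv => hfn v hv hvs) (List.mem_cons_of_mem _ hb)

theorem direct_ne_res (h : BInv E U xs (.res s C Q)) {x : TName}
    (hx : x ∈ direct E U (.res s C Q)) (b : Bool) : base x ≠ some (s, b) := by
  obtain ⟨v, hv, -, hxv⟩ := hx
  rw [base_of_mem_names hxv]
  intro he
  cases he
  exact h.ne_res (.inr hv) rfl

theorem base_dirProps_ne {n : ℕ} {x : TName} (hx : x ∈ dirProps k n) (b : Bool) :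
    base x ≠ some (s, b) := by simp [base_of_mem_propsIn hx.1]

/-- The components of a tail-recursive name are propagated from its restriction on. -/
theorem b_res_tr (h : BInv E U xs (.res s C Q)) (ht : C.tr = true)
    (ih : BTyped (E.bindRes s C) (k + 1)
      {v | v ∈ U ∨ ∃ b, (b = false ∨ C.isSession = true) ∧ v = (s, b)}
      (xs ++ resNames E s C) Q) :
    BTyped E k U xs (.res s C Q) := by
  have hses := STy.isSession_of_tr ht
  obtain ⟨hC, -⟩ := h.good
  have hQ := h.res_tr hses
  obtain ⟨π₁, h1, h2⟩ := ih
  obtain ⟨π, hπ, hπ₁⟩ := exists_kind_cons π₁ k (.once (xs.map (cty E)))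
  have hB : B E k xs (.res s C Q) = nus s C (.par (.inp (cIn k) xs
      (.out (cOut (k + 1)) (xs ++ resNames E s C) .nil))
      (B (E.bindRes s C) (k + 1) (xs ++ resNames E s C) Q)) := by
    rw [B]
    simp only [ht, if_true, resNames, hses]
  have hdeg : deg false (.res s C Q) = deg false Q + 1 := by simp [deg, ht]
  unfold BTyped
  rw [hB, hdeg]
  refine ⟨π, hπ, fun Γ Ξ hΓ hdir => ?_⟩
  set n := deg false Q with hn
  have hpos : 0 < n := deg_pos _ _
  set E' := E.bindRes s C with hE'
  set ys := xs ++ resNames E s C with hys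
  have hfn : ∀ v ∈ Q.fn, v.1 ≠ s → v ∈ (SProc.res s C Q).fn := fun v hv hvs => by
    simp [SProc.fn, hv, hvs]
  have hU : ∀ v ∈ U, v.1 ≠ s := fun v hv => h.ne_res (.inl hv)
  have hxb : ∀ x ∈ xs, ∀ b, base x ≠ some (s, b) := fun x hx b hb => by
    obtain ⟨v, hv, hxv⟩ := (h.comp.2 x).1 hx
    rw [base_of_mem_names hxv] at hb
    cases hb; exact hU _ hv rfl
  have hπk : π k = .once (xs.map (cty E')) := by
    rw [hπ]; congr 1
    exact List.map_congr_left fun x hx => (cty_bindRes_of_ne E C (hxb x hx)).symm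
  have hcomp : Comp E' U xs := ⟨h.comp.1, fun x => by
    rw [h.comp.2]
    refine exists_congr fun v => and_congr_right fun hv => ?_
    rw [names_bindRes_of_ne E C (hU v hv)]⟩
  rw [lenv_direct_congr (E' := E') (π' := π) (fun x hx => ⟨base_of_mem_direct hx,
    (cty_bindRes_of_ne E C (direct_ne_res h hx)).symm⟩) fun _ _ _ => rfl]
  refine typed_nus hC (fun x hx b => hx.elim (fun hx => direct_ne_res h hx b)
    fun hx => base_dirProps_ne hx b) fun Γ₁ hΓ₁ hΓ₁s => ?_
  have hsame : SameProps Γ Γ₁ := fun x hx => hΓ₁ x fun b => by simp [hx]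
  have hcov : ∀ v, v ∈ Q.fn → v ∉ U → v.1 ≠ s → ∀ x ∈ E'.names v, Γ₁ x = (cty E' x).shOf := by
    intro v hv hvU hvs x hx
    have hb : ∀ b, base x ≠ some (s, b) := fun b hb => by
      rw [base_of_mem_names hx] at hb; cases hb; exact hvs rfl
    rw [hΓ₁ x hb, cty_bindRes_of_ne E C hb]
    exact hdir v (hfn v hv hvs) hvU x (by rwa [← names_bindRes_of_ne E C hvs])
  set V : Set Name := {v | v ∈ U ∨ ∃ b, (b = false ∨ C.isSession = true) ∧ v = (s, b)} with hV
  have hnV : ∀ v ∉ V, v ∉ U ∧ v.1 ≠ s := fun v hv =>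
    ⟨fun h => hv (.inl h), fun h => hv (.inr ⟨v.2, .inr hses, by rw [← h]⟩)⟩
  have hrest := h2 Γ₁ Ξ ((hΓ.same hsame).sub (by omega) (by omega) fun j hj _ => hπ₁ j hj)
    fun v hv hvV x hx => hcov v hv (hnV v hvV).1 (hnV v hvV).2 x hx
  rw [lenv_direct_congr (E' := E') (π' := π) (fun x hx => ⟨base_of_mem_direct hx, rfl⟩)
    fun j hj _ => (hπ₁ j hj).symm] at hrest
  have hres := typed_step (E := E') (U := U) (xs := xs) (k := k) (n := n + 1) (Γ := Γ₁) (Ξ := Ξ)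
    (A := {x | x ∈ direct E U (.res s C Q) ∨ ∃ b, (b = false ∨ C.isSession = true) ∧
      x ∈ E'.names (s, b)})
    (D := {x | ∃ b, (b = false ∨ C.isSession = true) ∧ x ∈ E'.names (s, b)})
    (K := {cOut (k + 1)}) (T := .out (cOut (k + 1)) ys .nil) (by omega) hπk (hΓ.same hsame) hcomp
    hrest ?_ ?_ (fun x => base_of_mem_direct) ?_ (by rintro x rfl; rfl)
    (fun x hx => base_of_mem_propsIn hx.1) (by simp [cIn, cOut])
    (fun x _ => mem_dirProps_succ hpos x) ?_ fun Γ₂ hΓ₂ => ?_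
  · convert hres using 1
    refine lenv_ext fun x _ => ?_
    simp only [Set.mem_ofPred_eq, or_assoc]
    exact or_congr_right or_comm
  · rintro x ⟨b, -, hx⟩; exact base_ne_none_of_mem_names hx
  · rintro x ⟨b, -, hx⟩ hxs
    exact hxb x hxs b (base_of_mem_names hx)
  · rintro x (hx | ⟨b, -, hx⟩)
    · exact base_of_mem_direct hx
    · exact base_ne_none_of_mem_names hx
  · intro x _
    have e : x ∈ direct E U (.res s C Q) ↔ x ∈ direct E' V Q := by
      constructor
      · rintro ⟨v, hv, hvU, hx⟩
        have hvs := h.ne_res (.inr hv)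
        refine ⟨v, (List.mem_filter.1 hv).1, ?_, by rwa [names_bindRes_of_ne E C hvs]⟩
        rintro (h' | ⟨b, -, rfl⟩)
        · exact hvU h'
        · exact hvs rfl
      · rintro ⟨v, hv, hvV, hx⟩
        obtain ⟨h1, h2⟩ := hnV v hvV
        exact ⟨v, hfn v hv h2, h1, by rwa [← names_bindRes_of_ne E C h2]⟩
    constructor
    · simp only [Set.mem_ofPred_eq, e]
      exact or_comm
    · rintro ⟨⟨b, -, hx⟩, hx'⟩
      exact direct_ne_res h (e.2 hx') b (base_of_mem_names hx)
  · have hlast := typed_last (E := E') (π := π) (k := k + 1) (ys := ys) (Γ := Γ₂) (Ξ := Ξ)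
      (by rw [hπ₁ _ le_rfl, h1]) ?_ hQ.comp.1 hQ.comp.base_ne ?_
    · convert hlast using 1
      refine lenv_ext fun x _ => ?_
      simp only [Set.mem_ofPred_eq, Set.mem_union, hys, List.mem_append, mem_resNames, or_assoc,
        ← hE']
    · rw [sameProps_bind hcomp.base_ne hΓ₂ _ rfl, hsame _ rfl]
      exact (hΓ (k + 1) (by omega) (by omega)).1 true
    · intro x hx
      rw [hΓ₂ x]
      split_ifs with hxs
      · rw [ty_of_base (hcomp.base_ne x hxs)]
      · obtain ⟨b, hb, hxb⟩ := mem_resNames.1 ((List.mem_append.1 hx).resolve_left hxs)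
        exact hΓ₁s b hb x hxb

/-- The components of a name that is not tail-recursive are not propagated, but used directly in the
breakdown. -/
theorem b_res (h : BInv E U xs (.res s C Q)) (ht : C.tr = false)
    (ih : BTyped (E.bindRes s C) k U xs Q) : BTyped E k U xs (.res s C Q) := by
  obtain ⟨hC, hCl, hCs, -⟩ := h.good
  have hQ := h.res ht
  obtain ⟨π, h1, h2⟩ := ih
  have hB : B E k xs (.res s C Q) = nus s C (B (E.bindRes s C) k xs Q) := by
    rw [B]; simp [ht]
  have hdeg : deg false (.res s C Q) = deg false Q := by simp [deg, ht]
  unfold BTyped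
  rw [hB, hdeg]
  set n := deg false Q with hn
  set E' := E.bindRes s C with hE'
  have hfn : ∀ v ∈ Q.fn, v.1 ≠ s → v ∈ (SProc.res s C Q).fn := fun v hv hvs => by
    simp [SProc.fn, hv, hvs]
  have hU : ∀ v ∈ U, v.1 ≠ s := fun v hv => h.ne_res (.inl hv)
  have hxb : ∀ x ∈ xs, ∀ b, base x ≠ some (s, b) := fun x hx b hb => by
    obtain ⟨v, hv, hxv⟩ := (h.comp.2 x).1 hx
    rw [base_of_mem_names hxv] at hb
    cases hb; exact hU _ hv rfl
  refine ⟨π, ?_, fun Γ Ξ hΓ hdir => ?_⟩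
  · rw [h1]; congr 1
    exact List.map_congr_left fun x hx => cty_bindRes_of_ne E C (hxb x hx)
  rw [lenv_direct_congr (E' := E') (π' := π) (fun x hx => ⟨base_of_mem_direct hx,
    (cty_bindRes_of_ne E C (direct_ne_res h hx)).symm⟩) fun _ _ _ => rfl]
  refine typed_nus hC (fun x hx b => hx.elim (fun hx => direct_ne_res h hx b)
    fun hx => base_dirProps_ne hx b) fun Γ₁ hΓ₁ hΓ₁s => ?_
  have hsame : SameProps Γ Γ₁ := fun x hx => hΓ₁ x fun b => by simp [hx]
  have hsb : ∀ b, (s, b) ∈ Q.fn → b = false ∨ C.isSession = true := by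
    intro b hb
    cases b
    · exact .inl rfl
    · right
      by_contra hn
      exact hCs (by simpa using hn) hb
  refine (h2 Γ₁ Ξ (hΓ.same hsame) fun v hv hvU x hx => ?_).weaken_list ?_
    (E'.names (s, false) ++ E'.names (s, true)) ?_ ?_
  · by_cases hvs : v.1 = s
    · obtain ⟨a, b⟩ := v
      cases hvs
      exact hΓ₁s b (hsb b hv) x hx
    · have hb : ∀ b, base x ≠ some (s, b) := fun b hb => by
        rw [base_of_mem_names hx] at hb; cases hb; exact hvs rfl
      rw [hΓ₁ x hb, cty_bindRes_of_ne E C hb]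
      exact hdir v (hfn v hv hvs) hvU x (by rwa [← names_bindRes_of_ne E C hvs])
  · rintro x (⟨v, hv, hvU, hx⟩ | hx) _
    · by_cases hvs : v.1 = s
      · obtain ⟨a, b⟩ := v
        cases hvs
        exact .inr ⟨b, hsb b hv, hx⟩
      · exact .inl (.inl ⟨v, hfn v hv hvs, hvU, by rwa [← names_bindRes_of_ne E C hvs]⟩)
    · exact .inl (.inr hx)
  · rintro x ((⟨v, hv, hvU, hx⟩ | hx) | ⟨b, -, hx⟩) hxA _
    · have hvs := h.ne_res (.inr hv)
      exact absurd (.inl ⟨v, (List.mem_filter.1 hv).1, hvU, by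
        rwa [names_bindRes_of_ne E C hvs]⟩) hxA
    · exact absurd (.inr hx) hxA
    · cases b
      · exact List.mem_append_left _ hx
      · exact List.mem_append_right _ hx
  · rintro x ((⟨v, hv, hvU, hx⟩ | hx) | ⟨b, hb, hx⟩) hxA hs
    · have hvs := h.ne_res (.inr hv)
      exact absurd (.inl ⟨v, (List.mem_filter.1 hv).1, hvU, by
        rwa [names_bindRes_of_ne E C hvs]⟩) hxA
    · exact absurd (.inr hx) hxA
    · rw [hΓ₁s b hb x hx]
      rw [ty_of_base (base_ne_none_of_mem_names hx)] at hs ⊢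
      refine ⟨cty_of_drop hx (drop_bindRes hCl b fun hbQ => hxA (.inl ?_)) hs,
        MTy.shOf_eq_none hs⟩
      exact ⟨(s, b), hbQ, fun h' => hU _ h' rfl, hx⟩

end Direct

section Direct

variable {E : Ctx} {k : ℕ} {U : Set Name} {xs : List TName} {X : ℕ} {Q : SProc}

/-- At the start of a recursion its free names become the parameters. They are stable by the clause
of `Good` for recursions, and shared if the variable occurs more than once. -/
theorem BInv.recInv (h : BInv E U xs (.mu X Q)) :
    Comp E {v | v ∈ Q.fn} (Q.fn.dedup.flatMap E.names) ∧
      RecInv X Q.fn E E (decide (Q.occ X = 1)) {v | v ∈ Q.fn} (Q.fn.dedup.flatMap E.names) Q := by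
  obtain ⟨-, h1, h2, hg⟩ := h.good
  have hc : Comp E {v | v ∈ Q.fn} (Q.fn.dedup.flatMap E.names) := by
    have := Comp.flatMap (E := E) (List.nodup_dedup Q.fn)
    simpa using this
  have hfn : ∀ v, Live (some (X, Q.fn)) Q v → v ∈ Q.fn := by
    rintro v (hv | ⟨_, _, h3, -, hv⟩)
    · exact hv
    · cases h3; exact hv
  refine ⟨hc, hg, hc, hfn, fun v hv hl => absurd (.inl hv) hl, fun hl => by simpa using hl,
    fun hl ho => h2 ?_, fun ho v hv => ⟨?_, rfl, rfl⟩, h.nodup, fun v hv => h.fresh v (.inr hv)⟩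
  · have : Q.occ X ≠ 1 := by simpa using hl
    omega
  · by_cases hs : (E v).2.isSession = true
    · exact .inl (h1 ho v hv hs)
    · exact .inr (by rwa [isSession_iff, not_not] at hs)

/-- The process which starts the body of a recursion each time it receives the parameters. -/
theorem typed_loop {π : ℕ → Kind} {Γ : TShEnv} {Ξ : TRecEnv} {lin : Bool} {j n : ℕ}
    {ms : List TName} (hms : Comp E U ms) (hπ : π j = .ofMode lin (ms.map (cty E)))
    (hΓ : PropsOK Γ π j n) (hn : 0 < n) (hX : Γ (rX X) = some (ms.map (cty E))) :
    TTyped Γ Ξ (lenv (ty E π) {(.rprop j, true)})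
      (.mu X (.inp (rX X) ms (.out (rOut lin j) ms (.pvar X)))) := by
  set K : Set TName := {(.rprop j, true)} with hK
  have hKb : ∀ x ∈ K, base x = none := by rintro x rfl; rfl
  refine .mu (TTyped.recv_use (A := K) (W := ∅) (fun Γ' hΓ' => ?_)
    (.inr (.inr ⟨by rw [hX, map_ty hms.base_ne], rfl⟩)) hms.1 (fun h => hms.base_ne _ h rfl)
    (fun y hy _ h => hms.base_ne y hy (hKb y h)) fun x _ => by simp) ?_
  · have hsame := sameProps_bind hms.base_ne hΓ'
    refine TTyped.send_use (A := K) (W := ∅) (.pvar (by simp [Env.set])) ?_ hms.1 (fun z hz => ?_)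
      (fun z hz _ => ⟨fun h => hms.base_ne z hz (hKb z h), fun h => h⟩) fun x _ => ?_
    · rw [map_ty hms.base_ne]
      exact use_rOut hπ (hΓ.same hsame) le_rfl (by omega) fun _ => rfl
    · rw [hΓ' z, if_pos hz]
    · simp
  · intro y hy
    have hy : y ∈ ms := by simpa [TProc.bn] using hy
    have hb := hms.base_ne y hy
    refine ⟨?_, lenv_of_notMem fun h => hb (hKb y h)⟩
    simp only [TProc.fn, List.mem_cons, List.mem_filter, decide_eq_true_eq]
    rintro (rfl | ⟨-, h⟩)
    · exact hb rfl
    · exact h hy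

/-- The first trio hands the parameters to the body and starts the loop on `c^r_X`. The parameters
which are not received are used directly. -/
theorem b_mu (h : BInv E U xs (.mu X Q)) : BTyped E k U xs (.mu X Q) := by
  obtain ⟨hc, hinv⟩ := h.recInv
  obtain ⟨π₁, h1, h2⟩ := brec_typed hc Q (k := k + 1) hinv
  obtain ⟨π, hπ, hπ₁⟩ := exists_kind_cons π₁ k (.once (xs.map (cty E)))
  have hdeg : deg false (.mu X Q) = deg true Q + 1 := rfl
  unfold BTyped B
  simp only
  rw [hdeg]
  set ms := Q.fn.dedup.flatMap E.names with hms
  set lin := decide (Q.occ X = 1) with hlin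
  set n := deg true Q with hn
  have hpos : 0 < n := deg_pos _ _
  refine ⟨π, hπ, fun Γ Ξ hΓ hdir => ?_⟩
  have hnr : ∀ b, lenv (ty E π) {x | x ∈ direct E U (.mu X Q) ∨ x ∈ dirProps k (n + 1)}
      (.rvar X, b) = none := fun b => lenv_of_notMem (by
    rintro (h | h)
    · exact base_of_mem_direct h rfl
    · simp [dirProps, propsIn, pidx] at h)
  -- The name `c^r_X` is shared, with the parameters as payload.
  refine .res (ps := ms.map (cty E)) (.inl rfl) (hnr _) (hnr _) ?_
  set Γ₁ : TShEnv := (Γ.set (.rvar X, false) (ms.map (cty E))).erase (.rvar X, true) with hΓ₁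
  have hne : ∀ x : TName, x.1 ≠ .rvar X → Γ₁ x = Γ x := by
    rintro ⟨c, b⟩ hc
    have hc : c ≠ .rvar X := hc
    simp [hΓ₁, Env.erase, Env.set, hc]
  have hΓ₁k : PropsOK Γ₁ π k (n + 1) := fun j hj hj' => by
    rw [hne _ (by simp), hne _ (by simp)]
    refine ⟨fun b => ?_, (hΓ j hj hj').2⟩
    rw [hne _ (by simp)]; exact (hΓ j hj hj').1 b
  have hX : Γ₁ (rX X) = some (ms.map (cty E)) := by simp [hΓ₁, Env.erase, Env.set, rX]
  have hπk : π (k + 1) = .ofMode lin (ms.map (cty E)) := by rw [hπ₁ _ le_rfl, h1]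
  have hrest := h2 Γ₁ Ξ (hΓ₁k.sub (by omega) (by omega) fun j hj _ => hπ₁ j hj) hX
  rw [lenv_ty_congr (E' := E) (π' := π) (fun x => base_of_mem_recProps) (fun x hx j hj => by
    obtain ⟨⟨i, hi, h3, -⟩, -⟩ := hx
    rw [hj] at hi; cases hi
    exact (hπ₁ j h3).symm)] at hrest
  have hmem : ∀ v ∈ Q.fn, ∀ x ∈ E.names v, x ∈ ms := fun v hv x hx => (hc.2 x).2 ⟨v, hv, hx⟩
  refine typed_step (A' := ∅) (D := {x | x ∈ ms ∧ x ∉ xs}) (K := {(.rprop (k + 1), true)})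
    (N := recProps (k + 1) n) (by omega) hπ hΓ₁k h.comp (by simpa using hrest)
    (fun x hx => hc.base_ne x hx.1) (fun x hx => hx.2) (by simp) (fun x => base_of_mem_direct)
    (by rintro x rfl; rfl) (fun x => base_of_mem_recProps) (by simp [cIn]) ?_ ?_ ?_
  · intro x hx
    obtain ⟨_ | j | j | j, b⟩ := x <;> cases b <;>
      simp [dirProps, recProps, propsIn, pidx, cIn, cOut] <;> omega
  · intro x _
    refine ⟨⟨?_, ?_⟩, fun h => h.2⟩
    · rintro ⟨v, hv, hvU, hx⟩
      exact .inl ⟨hmem v hv x hx, mt (mem_comp_iff h.comp hx).1 hvU⟩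
    · rintro (⟨hx, hxs⟩ | hx)
      · obtain ⟨v, hv, hxv⟩ := (hc.2 x).1 hx
        exact ⟨v, hv, mt (mem_comp_iff h.comp hxv).2 hxs, hxv⟩
      · exact hx.elim
  · intro Γ' hΓ'
    have hsame := sameProps_bind h.comp.base_ne hΓ'
    have hΓ'k := (hΓ₁k.same hsame).sub (k' := k + 1) (n' := n) (π' := π) (by omega) (by omega)
      fun _ _ _ => rfl
    have hloop := typed_loop (Ξ := Ξ) hc hπk hΓ'k hpos (by rw [hsame _ rfl, hX])
    have hout := TTyped.send_use (W := ∅) (L := {x | x ∈ ms ∨ x ∈ ({(.rprop (k + 1), true)} :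
      Set TName)}) hloop (u := rOut lin (k + 1)) (zs := ms) ?_ hc.1 ?_ ?_ ?_
    · refine hout.weaken_list ?_ xs ?_ ?_
      · rintro x (hx | hx) _
        · by_cases hxs : x ∈ xs
          · exact .inl hxs
          · exact .inr (.inl ⟨hx, hxs⟩)
        · exact .inr (.inr hx)
      · rintro x (hx | hx | hx) hA _
        · exact hx
        · exact absurd (.inl hx.1) hA
        · exact absurd (.inr hx) hA
      · rintro x (hx | hx | hx) hA hs
        · rw [hΓ' x, if_pos hx, MTy.shOf_eq_none hs]
          obtain ⟨v, hv, hxv⟩ := (h.comp.2 x).1 hx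
          rw [ty_of_base (base_ne_none_of_mem_names hxv)] at hs ⊢
          exact ⟨cty_of_drop hxv (h.drop v hv fun hv' => hA (.inl (hmem v hv' x hxv))) hs, rfl⟩
        · exact absurd (.inl hx.1) hA
        · exact absurd (.inr hx) hA
    · rw [map_ty hc.base_ne]
      exact use_rOut hπk hΓ'k le_rfl (by omega) fun _ => rfl
    · intro x hx
      rw [hΓ' x]
      split_ifs with hxs
      · rfl
      · obtain ⟨v, hv, hxv⟩ := (hc.2 x).1 hx
        rw [ty_of_base (base_ne_none_of_mem_names hxv), hne x]
        · exact hdir v hv (mt (mem_comp_iff h.comp hxv).2 hxs) x hxv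
        · obtain ⟨j, -, rfl⟩ := mem_names.1 hxv; simp [nm]
    · intro x hx _
      refine ⟨fun h' => hc.base_ne x hx ?_, fun h => h⟩
      rw [Set.mem_singleton_iff.1 h']; rfl
    · intro x _
      simp only [Set.mem_ofPred_eq, Set.mem_empty_iff_false, false_or]
      exact or_comm

/-- The breakdown of a process outside recursions is typable. -/
theorem b_typed (P : SProc) : ∀ {E : Ctx} {k : ℕ} {U : Set Name} {xs : List TName},
    BInv E U xs P → BTyped E k U xs P := by
  induction P with
  | nil => exact b_nil
  | out u z Q ih => exact fun h => b_out h (ih h.out)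
  | inp u y Q ih => exact fun h => b_inp h (ih h.inp)
  | par Q R ihQ ihR => exact fun h => b_par h (ihQ h.par.1) (ihR h.par.2)
  | res s C Q ih =>
    intro E k U xs h
    by_cases ht : C.tr = true
    · exact b_res_tr h ht (ih (h.res_tr (STy.isSession_of_tr ht)))
    · have ht : C.tr = false := by simpa using ht
      exact b_res h ht (ih (h.res ht))
  | pvar X =>
    intro E k U xs h
    obtain ⟨M, h'⟩ := h.good
    cases h'
  | mu X Q ih => exact b_mu

end Direct

/-! ### Restriction of the propagators -/

/-- Restriction of the propagators with index in `js`. At most one of `c_j` and `c^r_j` is used, and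
the other one has type `end`. A shared `c^r_j` is assigned its payload in the shared environment. -/
theorem typed_nuProps {E : Ctx} {π : ℕ → Kind} {Ξ : TRecEnv} {P : TProc} (js : List ℕ)
    (hnd : js.Nodup) : ∀ {Γ : TShEnv} {A : Set TName}, (∀ x ∈ A, ∀ j ∈ js, pidx x ≠ some j) →
    (∀ Γ' : TShEnv, (∀ x, (∀ j ∈ js, pidx x ≠ some j) → Γ' x = Γ x) →
      (∀ j ∈ js, (∀ b, Γ' (.prop j, b) = none) ∧ Γ' (.rprop j, true) = none ∧
        Γ' (.rprop j, false) = (π j).shOf) →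
      TTyped Γ' Ξ (lenv (ty E π) {x | x ∈ A ∨ ∃ j ∈ js, pidx x = some j}) P) →
    TTyped Γ Ξ (lenv (ty E π) A) (nuProps js P) := by
  induction js with
  | nil =>
    intro Γ A _ hP
    simpa [nuProps] using hP Γ (fun _ _ => rfl) (by simp)
  | cons j js ih =>
    intro Γ A hA hP
    obtain ⟨hj, hnd⟩ := List.nodup_cons.1 hnd
    have hAj : ∀ x ∈ A, x.1 ≠ .prop j ∧ x.1 ≠ .rprop j := by
      rintro ⟨c, b⟩ hx
      have := hA _ hx j List.mem_cons_self
      refine ⟨?_, ?_⟩ <;> rintro h <;> cases h <;> exact this rfl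
    have hne : ∀ x : TName, pidx x ≠ some j → x.1 ≠ .prop j ∧ x.1 ≠ .rprop j := by
      rintro ⟨c, b⟩ hx
      refine ⟨?_, ?_⟩ <;> rintro h <;> cases h <;> exact hx rfl
    have hjs : ∀ i ∈ js, i ≠ j := fun i hi h => hj (h ▸ hi)
    refine TTyped.res_lenv (L := {x | x ∈ A ∨ x.1 = .prop j}) (fun Γ₁ h1 h2 h3 => ?_) ?_ (.inl rfl)
      (fun x _ => Iff.rfl) fun x hx => (hAj x hx).1
    · refine TTyped.res_lenv (L := {x | (x ∈ A ∨ x.1 = .prop j) ∨ x.1 = .rprop j})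
        (fun Γ₂ h4 h5 h6 => ?_) ?_ (.inl rfl) (fun x _ => Iff.rfl) ?_
      · refine ih hnd ?_ fun Γ₃ h7 h8 => ?_
        · rintro x ((hx | hx) | hx) i hi hp
          · exact hA x hx i (List.mem_cons_of_mem _ hi) hp
          · obtain ⟨c, b⟩ := x; cases hx; cases hp; exact hj hi
          · obtain ⟨c, b⟩ := x; cases hx; cases hp; exact hj hi
        · convert hP Γ₃ ?_ ?_ using 1
          · refine lenv_ext fun x _ => ?_
            have e : pidx x = some j ↔ x.1 = .prop j ∨ x.1 = .rprop j := by
              obtain ⟨_ | i | i | _, b⟩ := x <;> simp [pidx]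
            simp only [Set.mem_ofPred_eq, List.mem_cons, exists_eq_or_imp, e, or_assoc]
          · intro x hx
            obtain ⟨e1, e2⟩ := hne x (hx j List.mem_cons_self)
            rw [h7 x fun i hi => hx i (List.mem_cons_of_mem _ hi), h4 x e2, h1 x e1]
          · intro i hi
            rcases List.mem_cons.1 hi with rfl | hi
            · have e : ∀ x, pidx x = some i → Γ₃ x = Γ₂ x := fun x hx => h7 x fun i' hi' h => by
                rw [hx] at h; cases h; exact hj hi'
              refine ⟨fun b => ?_, by rw [e _ rfl, h6], ?_⟩
              · rw [e _ rfl, h4 _ (by simp)]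
                cases b
                · rw [h2]; cases hπ : π i <;> simp [ty, hπ, MTy.shOf]
                · exact h3
              · rw [e _ rfl, h5]
                cases hπ : π i <;> simp [ty, hπ, MTy.shOf, Kind.shOf]
            · exact h8 i hi
      · cases hπ : π j <;> simp [ty, hπ, MTy.dual, dirOf, Dir.flip]
      · rintro x (hx | hx)
        · exact (hAj x hx).2
        · rw [hx]; simp
    · cases hπ : π j <;> simp [ty, hπ, MTy.dual, dirOf, Dir.flip]

/-! ### The initial environments -/

/-- Linear environments of typed processes are finite. -/
theorem STyped.finite_dom {Γ : ShEnv} {Ξ : RecEnv} {Δ : LinEnv} {P : SProc}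
    (h : STyped Γ Ξ Δ P) (hΞ : ∀ X Δ₀, Ξ X = some Δ₀ → {u | Δ₀ u ≠ none}.Finite) :
    {u | Δ u ≠ none}.Finite := by
  have hset : ∀ (Δ : LinEnv) u T, {v | Δ v ≠ none}.Finite → {v | (Δ.set u T) v ≠ none}.Finite :=
    fun Δ u T h => (h.insert u).subset fun v hv => by
      by_cases hvu : v = u
      · exact .inl hvu
      · exact .inr (by simpa [Env.set_of_ne _ _ hvu] using hv)
  have hsub : ∀ (Δ Δ' : LinEnv) (L : List Name), {v | Δ' v ≠ none}.Finite →
      (∀ v ∉ L, Δ v ≠ none → Δ' v ≠ none) → {v | Δ v ≠ none}.Finite :=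
    fun Δ Δ' L h hs => (h.union L.finite_toSet).subset fun v hv => by
      by_cases hvL : v ∈ L
      · exact .inr hvL
      · exact .inl (hs v hvL hv)
  have hsplit : ∀ (Γ : ShEnv) (Δ Δ₁ Δ₂ : LinEnv) z C, Δ.Split Δ₁ Δ₂ → SVal Γ Δ₂ z C →
      {v | Δ₁ v ≠ none}.Finite → {v | Δ v ≠ none}.Finite := by
    intro Γ Δ Δ₁ Δ₂ z C hsp hz h
    refine hsub Δ Δ₁ [z] h fun v hv hvΔ => ?_
    have hv : v ≠ z := by simpa using hv
    rcases hsp v with ⟨h1, -⟩ | ⟨-, h1⟩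
    · rwa [h1]
    · rcases hz.dom with ⟨D, -, -, h'⟩ | ⟨-, -, h'⟩
      · rw [h' v] at h1; exact absurd h1.symm hvΔ
      · rw [h' v hv] at h1; exact absurd h1.symm hvΔ
  induction h with
  | nil => simp [Env.empty]
  | wk u _ _ _ ih => exact hset _ _ _ (ih hΞ)
  | unf u T T' _ _ _ ih => exact hset _ _ _ (ih hΞ)
  | pvar h => exact hΞ _ _ h
  | @mu _ _ Δ _ P _ hfn _ => exact P.fn.finite_toSet.subset hfn
  | @par _ _ Δ Δ₁ Δ₂ P Q hsp _ _ ihP ihQ =>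
    refine ((ihP hΞ).union (ihQ hΞ)).subset fun v hv => ?_
    rcases hsp v with ⟨h1, -⟩ | ⟨-, h1⟩
    · exact .inl (by simpa [h1] using hv)
    · exact .inr (by simpa [h1] using hv)
  | send _ _ hz hsp _ _ ih => exact hset _ _ _ (hsplit _ _ _ _ _ _ hsp hz (ih hΞ))
  | @rcv _ _ Δ u y P T C S hu _ _ _ _ ih =>
    refine hsub _ _ [(y, false)] (ih hΞ) fun v hv hvΔ => ?_
    rw [linBind_of_ne _ _ (by simpa using hv)]
    by_cases hvu : v = u
    · subst hvu; simp [Env.set]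
    · rwa [Env.set_of_ne _ _ hvu]
  | req _ _ hz hsp ih => exact hsplit _ _ _ _ _ _ hsp hz (ih hΞ)
  | @acc _ _ Δ u y P C _ _ _ ih =>
    refine hsub _ _ [(y, false)] (ih hΞ) fun v hv hvΔ => ?_
    rwa [linBind_of_ne _ _ (by simpa using hv)]
  | @resS _ _ Δ s P S _ _ h1 h2 _ ih =>
    refine hsub _ _ [(s, false), (s, true)] (ih hΞ) fun v hv hvΔ => ?_
    simp only [List.mem_cons, List.not_mem_nil, or_false, not_or] at hv
    rwa [Env.set_of_ne _ _ hv.2, Env.set_of_ne _ _ hv.1]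
  | res _ _ _ _ ih => exact ih hΞ

section initCtx

variable {Γ : ShEnv} {Δ : LinEnv}

theorem initCtx_of_sh {u : Name} {C : STy} (h : Γ u = some C) :
    initCtx Γ Δ u = (1, .sh C) := by simp [initCtx, h]

theorem initCtx_of_lin {u : Name} {S : STy} (h : Γ u = none) (h' : Δ u = some S) :
    initCtx Γ Δ u = (1, S) := by simp [initCtx, h, h']

theorem initCtx_fst (u : Name) : (initCtx Γ Δ u).1 = 1 := by
  unfold initCtx; cases Γ u <;> rfl

/-- The decomposition of `Γ` assigns to a component of a source name its payload if it is shared,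
and nothing otherwise. -/
theorem GSh_of_mem_names (hΔ : ∀ u S, Δ u = some S → S.WF ∧ S.isSession = true) {u : Name}
    {x : TName} (hx : x ∈ (initCtx Γ Δ).names u) :
    GSh Γ x = (cty (initCtx Γ Δ) x).shOf := by
  obtain ⟨j, hj, rfl⟩ := mem_names.1 hx
  rw [cty_nm]
  rw [initCtx_fst]
  cases hu : Γ u with
  | some C =>
    rw [initCtx_of_sh hu] at hj ⊢
    simp only [STy.G, List.length_cons, List.length_nil, Nat.zero_add, Nat.lt_one_iff] at hj
    subst hj
    simp [GSh, nm, hu, STy.G, MTy.shOf]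
  | none =>
    have hs : ((STy.G (initCtx Γ Δ u).2)[j]).isSession = true := by
      cases hu' : Δ u with
      | some S =>
        obtain ⟨h1, h2⟩ := hΔ u S hu'
        simp only [initCtx_of_lin hu hu']
        exact h1.isSession_of_mem_G h2 _ (List.getElem_mem _)
      | none => simp [initCtx, hu, hu', STy.G, MTy.isSession]
    rw [List.getElem?_eq_getElem hj, Option.getD_some, MTy.shOf_eq_none hs]
    simp [GSh, nm, hu]

/-- The decomposition of `Δ` consists of the components of the names in its domain. -/
theorem GLin_eq_lenv (hdisj : ∀ u, Γ u = none ∨ Δ u = none)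
    (hΔ : ∀ u S, Δ u = some S → S.WF ∧ S.isSession = true) (π : ℕ → Kind) :
    GLin Δ = lenv (ty (initCtx Γ Δ) π) {x | ∃ u, Δ u ≠ none ∧ x ∈ (initCtx Γ Δ).names u} := by
  funext ⟨c, b⟩
  rcases c with a | j | j | X
  case idx i =>
    cases hu : Δ (a, b) with
    | none =>
      rw [lenv_of_notMem]
      · simp [GLin, hu]
      · rintro ⟨u, h, hx⟩
        have := base_of_mem_names hx
        simp only [base, Option.some.injEq] at this
        subst this
        exact h hu
    | some S =>
      have hE : initCtx Γ Δ (a, b) = (1, S) :=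
        initCtx_of_lin ((hdisj _).resolve_right (by simp [hu])) hu
      by_cases hi : i ≠ 0 ∧ i - 1 < (STy.G S).length
      · obtain ⟨hi, hi'⟩ := hi
        have ht : ty (initCtx Γ Δ) π (.idx a i, b) = (STy.G S)[i - 1] := by
          simp [ty, cty, hE, hi']
        rw [lenv_of_mem, ht]
        · simp [GLin, hi, hu, hi']
        · refine ⟨(a, b), by simp [hu], mem_names.2 ⟨i - 1, by rwa [hE], ?_⟩⟩
          simp only [nm, hE, Prod.mk.injEq, TChan.idx.injEq, true_and, and_true]
          omega
        · rw [ht]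
          exact (hΔ _ S hu).1.isSession_of_mem_G (hΔ _ S hu).2 _ (List.getElem_mem _)
      · rw [lenv_of_notMem]
        · by_cases h0 : i = 0
          · simp [GLin, h0]
          · have : (STy.G S).length ≤ i - 1 := by omega
            simp [GLin, h0, hu, this]
        · rintro ⟨u, -, hx⟩
          have := base_of_mem_names hx
          simp only [base, Option.some.injEq] at this
          subst this
          obtain ⟨j, hj, hx⟩ := mem_names.1 hx
          rw [hE] at hj hx
          simp only [nm, Prod.mk.injEq, TChan.idx.injEq, true_and, and_true] at hx
          have hj : j < (STy.G S).length := hj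
          omega
  all_goals
    rw [lenv_of_notMem]
    · rfl
    · rintro ⟨u, -, hx⟩
      have := base_of_mem_names hx
      simp [base] at this

end initCtx

end MST

open MST in
theorem mainTheorem2 (Γ : ShEnv) (Δ : LinEnv) (P : SProc) (k : ℕ) (vs : List Name)
    (hdisj : ∀ u, Γ u = none ∨ Δ u = none)
    (hΓ : ∀ u C, Γ u = some C → (STy.sh C).WF)
    (hΔ : ∀ u S, Δ u = some S → S.WF ∧ S.isSession = true)
    (hP : P.Barendregt) (hrec : P.NoNested)
    (hty : STyped Γ Env.empty Δ P)
    (hk : 0 < k) (hnd : vs.Nodup) (hsub : ∀ u ∈ vs, u ∈ P.fn)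
    (hrfn : ∀ u ∈ P.fn, ∀ S, Δ u = some S → S.tr = true → u ∈ vs) :
    TTyped (GSh Γ) Env.empty (GLin Δ) (decomp Γ Δ k vs P) := by
  have hM : Match (initCtx Γ Δ) Γ Δ := by
    refine ⟨fun u C hu => ⟨initCtx_of_sh hu, hΓ u C hu⟩, fun u S hu => ?_⟩
    obtain ⟨h1, h2⟩ := hΔ u S hu
    rw [initCtx_of_lin ((hdisj u).resolve_right (by simp [hu])) hu]
    exact ⟨.refl _, h1, ⟨h2, h1⟩, fun _ => rfl⟩
  have hinv : BInv (initCtx Γ Δ) {v | v ∈ vs} (vs.flatMap (initCtx Γ Δ).names) P := by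
    refine ⟨hty.good hdisj hM hP.1 hP.2 (fun X Δ₀ h => by cases h) (fun X M h => by cases h)
      (.inl ⟨rfl, hrec⟩), Comp.flatMap hnd, fun v hv hv' => absurd (hsub v hv) hv',
      fun v hv ht => ?_, hP.1, fun v hv => hP.2 v (hv.elim (hsub v) id)⟩
    rcases hty.dom_of_mem_fn hv with h | h
    · obtain ⟨C, hC⟩ := Option.ne_none_iff_exists'.1 h
      rw [initCtx_of_sh hC] at ht; cases ht
    · obtain ⟨S, hS⟩ := Option.ne_none_iff_exists'.1 h
      rw [initCtx_of_lin ((hdisj v).resolve_right h) hS] at ht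
      exact hrfn v hv S hS ht
  obtain ⟨π, hπ, hB⟩ := b_typed P (k := k) hinv
  have hpos := deg_pos false P
  unfold decomp
  rw [GLin_eq_lenv hdisj hΔ π]
  set E := initCtx Γ Δ with hE
  set n := deg false P with hn
  set rs := vs.flatMap E.names with hrs
  have hr : ∀ i, i ∈ List.range' k n ↔ k ≤ i ∧ i < k + n := fun i => by
    rw [List.mem_range'_1]
  refine typed_nuProps _ List.nodup_range' ?_ fun Γ' h1 h2 => ?_
  · rintro x ⟨u, -, hx⟩ j - hp
    obtain ⟨i, -, rfl⟩ := mem_names.1 hx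
    simp [pidx, nm] at hp
  have hcov : ∀ v, ∀ x ∈ E.names v, Γ' x = (cty E x).shOf := fun v x hx => by
    rw [h1 x, GSh_of_mem_names hΔ hx]
    rintro j - hp
    obtain ⟨i, -, rfl⟩ := mem_names.1 hx
    simp [pidx, nm] at hp
  have hprops : PropsOK Γ' π k n := fun j hj hj' => h2 j ((hr j).2 ⟨hj, hj'⟩)
  have hlast := typed_last (Ξ := Env.empty) hπ ((hprops k le_rfl (by omega)).1 true) hinv.comp.1
    hinv.comp.base_ne fun y hy => by
      obtain ⟨v, -, hx⟩ := (hinv.comp.2 y).1 hy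
      exact hcov v y hx
  -- The names in `vs` are handed over on the first propagator, all others are used directly.
  have hpar := typed_par (A := {x | x ∈ rs ∨ x ∈ direct E {v | v ∈ vs} P}) (N := propsIn k n)
    hlast (hB Γ' Env.empty hprops fun u _ _ => hcov u) hinv.comp.base_ne
    (fun x => base_of_mem_direct) ?_ ?_ ?_
  · refine hpar.weaken ?_ ?_ ?_
    · rintro x (hx | hx) hs
      · left
        have : ∃ v ∈ P.fn, x ∈ E.names v := by
          rcases hx with hx | ⟨v, hv, -, hx⟩
          · obtain ⟨v, hv, hx⟩ := (hinv.comp.2 x).1 hx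
            exact ⟨v, hsub v hv, hx⟩
          · exact ⟨v, hv, hx⟩
        obtain ⟨v, hv, hx⟩ := this
        refine ⟨v, fun hvΔ => ?_, hx⟩
        obtain ⟨C, hC⟩ :=
          Option.ne_none_iff_exists'.1 ((hty.dom_of_mem_fn hv).resolve_right (not_not.2 hvΔ))
        rw [ty_of_base (base_ne_none_of_mem_names hx)] at hs
        have := isSession_of_cty hx hs
        rw [hE, initCtx_of_sh hC] at this
        cases this
      · obtain ⟨j, hj, hj'⟩ := hx
        exact .inr ⟨j, (hr j).2 hj', hj⟩
    · refine ((hty.finite_dom fun X Δ₀ h => by cases h).biUnion fun u _ =>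
        (E.names u).finite_toSet).subset ?_
      rintro x ⟨hx | ⟨j, hj, hx⟩, hxA, -⟩
      · obtain ⟨u, hu, hx⟩ := hx
        exact Set.mem_biUnion (show u ∈ {u | Δ u ≠ none} from hu) hx
      · exact absurd (.inr ⟨j, hx, (hr j).1 hj⟩) hxA
    · rintro x (⟨u, hu, hx⟩ | ⟨j, hj, hx⟩) hxA hs
      · rw [hcov u x hx]
        rw [ty_of_base (base_ne_none_of_mem_names hx)] at hs ⊢
        refine ⟨?_, MTy.shOf_eq_none hs⟩
        obtain ⟨S, hS⟩ := Option.ne_none_iff_exists'.1 hu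
        refine cty_of_drop hx (.inl ?_) hs
        rw [hE, initCtx_of_lin ((hdisj u).resolve_right hu) hS]
        -- A name of `Δ` which is not free in `P` has type `end`.
        by_contra hne
        rcases hty.mem_fn_of_ne_fin hS hne with h | ⟨X, Δ₀, h, -⟩
        · refine hxA (.inl ?_)
          by_cases huv : u ∈ vs
          · exact .inl ((hinv.comp.2 x).2 ⟨u, huv, hx⟩)
          · exact .inr ⟨u, h, huv, hx⟩
        · cases h
      · exact absurd (.inr ⟨j, hx, (hr j).1 hj⟩) hxA
  · intro x hx
    obtain ⟨_ | j | j | j, b⟩ := x <;> cases b <;>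
      simp [dirProps, propsIn, pidx, cOut] <;> omega
  · rintro x (hx | rfl | hx)
    · exact base_of_mem_propsIn hx
    · rfl
    · exact base_of_mem_propsIn hx.1
  · intro x _
    refine ⟨Iff.rfl, ?_⟩
    rintro ⟨hx, ⟨v, -, hv, hxv⟩⟩
    exact hv ((mem_comp_iff hinv.comp hxv).1 hx)
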